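/- Let $G_{\mathbb C}$ be a connected complex semisimple Lie group with Lie algebra $\mathfrak g_{\mathbb C}$, let $G\subset G_{\mathbb C}$ be a connected closed subgroup whose Lie algebra $\mathfrak g$ is a real form of $\mathfrak g_{\mathbb C}$, and let $T\in\mathfrak g$ be a non-zero elliptic element (that is, $\mathrm{ad}\,T$ is a semisimple endomorphism of $\mathfrak g$ all of whose eigenvalues are purely imaginary). For $c\in\mathbb R$ put $\mathfrak g^c=\{X\in\mathfrak g_{\mathbb C} : [T,X]=icX\}$, and set $$\mathfrak u^+=\bigoplus_{c>0}\mathfrak g^c,\qquad U^+=\exp\mathfrak u^+,\qquad \mathfrak q^-=\bigoplus_{c\le 0}\mathfrak g^c,\qquad Q^-=\{x\in G_{\mathbb C} : \mathrm{Ad}\,x(\mathfrak q^-)\subset\mathfrak q^-\}.$$ Let $\mathfrak g=\mathfrak k\oplus\mathfrak p$ be a Cartan decomposition with $T\in\mathfrak k$, and let $K\subset G$ be the connected Lie subgroup with Lie algebra $\mathfrak k$. Let $V$ be a finite-dimensional complex vector space, let $\rho:Q^-\to GL(V)$ be a holomorphic homomorphism, and let $\mathcal V_{G/L}$ be the space of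 holomorphic maps $\psi:GQ^-\to V$ such that $\psi(yq)=\rho(q)^{-1}\psi(y)$ for all $y\in GQ^-$, $q\in Q^-$, on which $G$ acts by $(\varrho(g)\psi)(y)=\psi(g^{-1}y)$. Let $\varphi\in\mathcal V_{G/L}$ be $K$-finite, i.e. the space $\mathcal V_\varphi=\mathrm{span}_{\mathbb C}\{\varrho(k)\varphi : k\in K\}$ is finite-dimensional. Then: (1) Let $e_1,\dots,e_r$ be a complex basis of $\mathfrak u^+$. Let $\varphi_1,\dots,\varphi_m$ be a basis of $\mathcal V_\varphi$ and $\mu_1,\dots,\mu_m\in\mathbb R$ with $\varrho(\exp\lambda T)\varphi_a=e^{i\mu_a\lambda}\varphi_a$ for all $a$ and all $\lambda\in\mathbb R$, and let $v_1,\dots,v_k$ be a basis of $V$ and $\theta_1,\dots,\theta_k\in\mathbb R$ with $\rho(\exp\lambda T)v_b=e^{i\theta_b\lambda}v_b$ for all $b$ and all $\lambda\in\mathbb R$. Write $\varphi_a(y)=\sum_b\varphi_a^b(y)v_b$ for $y\in GQ^-$. Then for all $a,b$ there is a unique polynomial $P\in\mathbb C[z_1,\dots,z_r]$ such that $$\varphi_a^b\bigl(\exp(z_1e_1+\dots+z_re_r)\bigr)=P(z_1,\dots,z_r)$$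 for all $z\in\mathbb C^r$ with $\exp(z_1e_1+\dots+z_re_r)\in GQ^-$. (2) For every $\phi\in\mathcal V_\varphi$ there is a unique holomorphic map $\phi':U^+\to V$ such that $\phi'=\phi$ on $U^+\cap GQ^-$. -/

import Mathlib

open scoped Manifold ContDiff Topology Pointwise

noncomputable section

namespace EllipticOrbit

/-! ### Lie algebras -/

section LieAlgebras

/-- A Cartan decomposition `L = k ⊕ p` of a real Lie algebra: `k` is a subalgebra, `p` a complementary
subspace with `[k, p] ⊆ p`, `[p, p] ⊆ k`, and the Killing form is negative definite on `k` and
positive definite on `p`. -/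
structure IsCartanDecomposition {L : Type*} [LieRing L] [LieAlgebra ℝ L]
    (k : LieSubalgebra ℝ L) (p : Submodule ℝ L) : Prop where
  isCompl : IsCompl k.toSubmodule p
  lie_k_p : ∀ X ∈ k, ∀ Y ∈ p, ⁅X, Y⁆ ∈ p
  lie_p_p : ∀ X ∈ p, ∀ Y ∈ p, ⁅X, Y⁆ ∈ k
  killing_neg : ∀ X ∈ k, X ≠ 0 → killingForm ℝ L X X < 0
  killing_pos : ∀ X ∈ p, X ≠ 0 → 0 < killingForm ℝ L X X

/-- `T` is elliptic: `ad T` is semisimple and all its (complex) eigenvalues are purely imaginary. -/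
def IsElliptic {L : Type*} [LieRing L] [LieAlgebra ℝ L] [Module.Finite ℝ L] (T : L) : Prop :=
  (LieAlgebra.ad ℝ L T).IsSemisimple ∧
    ∀ z ∈ (LieAlgebra.ad ℝ L T).charpoly.aroots ℂ, z.re = 0

/-- The space `𝔤^c = {X | [T, X] = i c X}`, for a real number `c`. -/
def gradedPiece {L : Type*} [LieRing L] [LieAlgebra ℂ L] (T : L) (c : ℝ) : Submodule ℂ L :=
  (LieAlgebra.ad ℂ L T).eigenspace (Complex.I * (c : ℂ))

/-- `𝔲⁺`, the sum of the `𝔤^c` over `c > 0`. -/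
def uPlus {L : Type*} [LieRing L] [LieAlgebra ℂ L] (T : L) : Submodule ℂ L :=
  ⨆ c : {c : ℝ // 0 < c}, gradedPiece T c

/-- `𝔮⁻`, the sum of the `𝔤^c` over `c ≤ 0`. -/
def qMinus {L : Type*} [LieRing L] [LieAlgebra ℂ L] (T : L) : Submodule ℂ L :=
  ⨆ c : {c : ℝ // c ≤ 0}, gradedPiece T c

end LieAlgebras

/-! ### Holomorphic maps on subsets of a complex manifold -/

section Holomorphic

variable {E : Type*} [NormedAddCommGroup E] [NormedSpace ℂ E]
  {M : Type*} [TopologicalSpace M] [ChartedSpace E M]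
  {W : Type*} [NormedAddCommGroup W] [NormedSpace ℂ W]

/-- A map on a subset `s` of a complex manifold is holomorphic if near every point of `s` it is the
restriction of a holomorphic map defined on an open subset of the manifold. For an open subset, and
for an embedded complex submanifold, this is the usual notion. -/
def IsHolomorphic {s : Set M} (f : s → W) : Prop :=
  ∀ x ∈ s, ∃ (N : Set M) (F : M → W), IsOpen N ∧ x ∈ N ∧
    MDifferentiableOn 𝓘(ℂ, E) 𝓘(ℂ, W) F N ∧ ∀ y : s, (y : M) ∈ N → F y = f y

theorem IsHolomorphic.zero {s : Set M} : IsHolomorphic (E := E) (0 : s → W) := fun _ _ =>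
  ⟨Set.univ, fun _ => 0, isOpen_univ, trivial, mdifferentiableOn_const, fun _ _ => rfl⟩

theorem IsHolomorphic.add {s : Set M} {f g : s → W} (hf : IsHolomorphic (E := E) f)
    (hg : IsHolomorphic (E := E) g) : IsHolomorphic (E := E) (f + g) := by
  intro x hx
  obtain ⟨N, F, hN, hxN, hF, h⟩ := hf x hx
  obtain ⟨N', F', hN', hxN', hF', h'⟩ := hg x hx
  refine ⟨N ∩ N', F + F', hN.inter hN', ⟨hxN, hxN'⟩,
    (hF.mono Set.inter_subset_left).add (hF'.mono Set.inter_subset_right), fun y hy => ?_⟩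
  simp [h y hy.1, h' y hy.2]

theorem IsHolomorphic.const_smul {s : Set M} {f : s → W} (a : ℂ)
    (hf : IsHolomorphic (E := E) f) : IsHolomorphic (E := E) (a • f) := by
  intro x hx
  obtain ⟨N, F, hN, hxN, hF, h⟩ := hf x hx
  exact ⟨N, a • F, hN, hxN, hF.const_smul a, fun y hy => by simp [h y hy]⟩

end Holomorphic

/-! ### Complex Lie groups -/

section Groups

variable {E : Type*} [NormedAddCommGroup E] [NormedSpace ℂ E]
  {Gc : Type*} [TopologicalSpace Gc] [ChartedSpace E Gc] [Group Gc]

/-- `γ : ℝ → Gc` is the one-parameter subgroup with initial velocity `X`. -/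
structure IsOneParameterSubgroup (X : GroupLieAlgebra 𝓘(ℂ, E) Gc) (γ : ℝ → Gc) : Prop where
  map_zero : γ 0 = 1
  map_add : ∀ s t : ℝ, γ (s + t) = γ s * γ t
  hasMFDerivAt : HasMFDerivAt 𝓘(ℝ, ℝ) 𝓘(ℝ, E) γ 0
    (ContinuousLinearMap.toSpanSingleton ℝ (X : E) : ℝ →L[ℝ] E)

open Classical in
/-- The exponential map: `exp X = γ 1`, where `γ` is the (existing and unique) one-parameter subgroup
with initial velocity `X`. -/
def lieExp (X : GroupLieAlgebra 𝓘(ℂ, E) Gc) : Gc :=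
  if h : ∃ γ : ℝ → Gc, IsOneParameterSubgroup X γ then h.choose 1 else 1

/-- `Ad g`, the derivative at the identity of `x ↦ g x g⁻¹`. -/
def Ad (g : Gc) : GroupLieAlgebra 𝓘(ℂ, E) Gc →L[ℂ] GroupLieAlgebra 𝓘(ℂ, E) Gc :=
  (mfderiv 𝓘(ℂ, E) 𝓘(ℂ, E) (fun x : Gc => g * x * g⁻¹) 1 : E →L[ℂ] E)

theorem Ad_one : Ad (E := E) (1 : Gc) = ContinuousLinearMap.id ℂ _ := by
  have : (fun x : Gc => 1 * x * (1 : Gc)⁻¹) = id := by ext x; simp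
  unfold Ad
  rw [this]
  exact mfderiv_id

variable [LieGroup 𝓘(ℂ, E) ω Gc]

theorem mdifferentiable_mul_left (g : Gc) :
    MDifferentiable 𝓘(ℂ, E) 𝓘(ℂ, E) (fun x : Gc => g * x) :=
  (contMDiff_mul_left (I := 𝓘(ℂ, E)) (n := ω)).mdifferentiable (by simp)

theorem mdifferentiable_conj (g : Gc) :
    MDifferentiable 𝓘(ℂ, E) 𝓘(ℂ, E) (fun x : Gc => g * x * g⁻¹) :=
  ((contMDiff_mul_right (I := 𝓘(ℂ, E)) (n := ω)).comp
    (contMDiff_mul_left (I := 𝓘(ℂ, E)) (n := ω))).mdifferentiable (by simp)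

theorem Ad_mul (g h : Gc) : Ad (E := E) (g * h) = (Ad g).comp (Ad (E := E) h) := by
  have e : (fun x : Gc => g * h * x * (g * h)⁻¹)
      = (fun x : Gc => g * x * g⁻¹) ∘ (fun x : Gc => h * x * h⁻¹) := by
    ext x; simp [mul_assoc]
  have hg : HasMFDerivAt 𝓘(ℂ, E) 𝓘(ℂ, E) (fun x : Gc => g * x * g⁻¹)
      ((fun x : Gc => h * x * h⁻¹) 1) (Ad (E := E) g : E →L[ℂ] E) := by
    have h1 : (fun x : Gc => h * x * h⁻¹) 1 = 1 := by simp
    rw [h1]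
    exact (mdifferentiable_conj (E := E) g 1).hasMFDerivAt
  have hh := (mdifferentiable_conj (E := E) h 1).hasMFDerivAt
  have k := (hg.comp (1 : Gc) hh).mfderiv
  rw [← e] at k
  exact k

variable [CompleteSpace E]

/-- The Lie algebra of a complex Lie group, regarded as a real Lie algebra. -/
instance realLieAlgebra : LieAlgebra ℝ (GroupLieAlgebra 𝓘(ℂ, E) Gc) where
  toModule := Module.complexToReal _
  lie_smul a X Y := by
    change ⁅X, (a : ℂ) • Y⁆ = (a : ℂ) • ⁅X, Y⁆
    exact lie_smul _ _ _

instance realFinite [FiniteDimensional ℂ E] :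
    Module.Finite ℝ (GroupLieAlgebra 𝓘(ℂ, E) Gc) :=
  (FiniteDimensional.complexToReal E : FiniteDimensional ℝ E)

/-- The real Lie subalgebra `𝔤` is the Lie algebra of the closed subgroup `G`. -/
def IsLieAlgebraOf (𝔤 : LieSubalgebra ℝ (GroupLieAlgebra 𝓘(ℂ, E) Gc)) (G : Subgroup Gc) : Prop :=
  ∀ X : GroupLieAlgebra 𝓘(ℂ, E) Gc, X ∈ 𝔤 ↔ ∀ t : ℝ, lieExp (t • X) ∈ G

/-- `𝔤` is a real form of the complex Lie algebra: every `Z` is uniquely `X + i Y` with `X`, `Y`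
in `𝔤`. -/
def IsRealForm (𝔤 : LieSubalgebra ℝ (GroupLieAlgebra 𝓘(ℂ, E) Gc)) : Prop :=
  ∀ Z : GroupLieAlgebra 𝓘(ℂ, E) Gc, ∃! P : 𝔤 × 𝔤,
    Z = (P.1 : GroupLieAlgebra 𝓘(ℂ, E) Gc) + Complex.I • (P.2 : GroupLieAlgebra 𝓘(ℂ, E) Gc)

/-- `U⁺ = exp 𝔲⁺`. -/
def UPlus (T : GroupLieAlgebra 𝓘(ℂ, E) Gc) : Set Gc :=
  lieExp '' (uPlus T : Set (GroupLieAlgebra 𝓘(ℂ, E) Gc))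

/-- `Q⁻`, the normalizer in `Gc` of `𝔮⁻`. (As `𝔮⁻` is finite dimensional, `Ad x (𝔮⁻) ⊆ 𝔮⁻` amounts
to `Ad x (𝔮⁻) = 𝔮⁻`, see `mem_QMinus_iff`.) -/
def QMinus (T : GroupLieAlgebra 𝓘(ℂ, E) Gc) : Subgroup Gc where
  carrier := {x | (qMinus T).map (Ad x).toLinearMap = qMinus T}
  one_mem' := by
    simp only [Set.mem_ofPred_eq, Ad_one]
    exact Submodule.map_id _
  mul_mem' := by
    intro x y hx hy
    simp only [Set.mem_ofPred_eq] at hx hy ⊢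
    rw [Ad_mul, ContinuousLinearMap.toLinearMap_comp, Submodule.map_comp, hy, hx]
  inv_mem' := by
    intro x hx
    simp only [Set.mem_ofPred_eq] at hx ⊢
    conv_lhs => rw [← hx]
    rw [← Submodule.map_comp, ← ContinuousLinearMap.toLinearMap_comp, ← Ad_mul, inv_mul_cancel,
      Ad_one]
    exact Submodule.map_id _

theorem mem_QMinus_iff [FiniteDimensional ℂ E] (T : GroupLieAlgebra 𝓘(ℂ, E) Gc) (x : Gc) :
    x ∈ QMinus T ↔ ∀ X ∈ qMinus T, Ad x X ∈ qMinus T := by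
  have key : x ∈ QMinus T ↔ (qMinus T).map (Ad x).toLinearMap = qMinus T := Iff.rfl
  rw [key]
  constructor
  · intro h X hX
    rw [← h]
    exact Submodule.mem_map_of_mem hX
  · intro h
    have : FiniteDimensional ℂ (GroupLieAlgebra 𝓘(ℂ, E) Gc) :=
      (inferInstance : FiniteDimensional ℂ E)
    have inj : Function.Injective (Ad (E := E) x).toLinearMap := by
      refine Function.LeftInverse.injective (g := Ad (E := E) x⁻¹) fun X => ?_
      have := congrArg (fun A => A X) (Ad_mul (E := E) x⁻¹ x)
      simpa [Ad_one] using this.symm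
    refine Submodule.eq_of_le_of_finrank_eq (Submodule.map_le_iff_le_comap.2 h) ?_
    exact (Submodule.equivMapOfInjective _ inj _).finrank_eq.symm

/-- The set `G Q⁻`. -/
def GQ (G : Subgroup Gc) (T : GroupLieAlgebra 𝓘(ℂ, E) Gc) : Set Gc :=
  (G : Set Gc) * (QMinus T : Set Gc)

theorem mul_mem_GQ_left {G : Subgroup Gc} {T : GroupLieAlgebra 𝓘(ℂ, E) Gc} (g : G) {y : Gc}
    (hy : y ∈ GQ G T) : (g : Gc) * y ∈ GQ G T := by
  obtain ⟨a, ha, q, hq, rfl⟩ := hy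
  exact ⟨g * a, G.mul_mem g.2 ha, q, hq, mul_assoc _ _ _⟩

theorem mul_mem_GQ_right {G : Subgroup Gc} {T : GroupLieAlgebra 𝓘(ℂ, E) Gc} {y : Gc}
    (hy : y ∈ GQ G T) (q : QMinus T) : y * (q : Gc) ∈ GQ G T := by
  obtain ⟨a, ha, p, hp, rfl⟩ := hy
  exact ⟨a, ha, p * q, (QMinus T).mul_mem hp q.2, (mul_assoc _ _ _).symm⟩

/-- The connected Lie subgroup `K` of `Gc` corresponding to the subalgebra `𝔨` of `𝔤`: it is
generated by `exp 𝔨`. -/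
def connectedSubgroup {𝔤 : LieSubalgebra ℝ (GroupLieAlgebra 𝓘(ℂ, E) Gc)}
    (𝔨 : LieSubalgebra ℝ 𝔤) : Subgroup Gc :=
  Subgroup.closure
    ((fun X : 𝔤 => lieExp (X : GroupLieAlgebra 𝓘(ℂ, E) Gc)) '' (𝔨 : Set 𝔤))

/-! ### Homogeneous vector bundles -/

variable {V : Type*} [NormedAddCommGroup V] [NormedSpace ℂ V]

/-- The homomorphism `ρ : Q⁻ → GL(V)` is holomorphic: so is `q ↦ ρ(q) v` for every `v`. -/
def IsHolomorphicHom {T : GroupLieAlgebra 𝓘(ℂ, E) Gc}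
    (ρ : QMinus T →* LinearMap.GeneralLinearGroup ℂ V) : Prop :=
  ∀ v : V, IsHolomorphic (E := E) (s := (QMinus T : Set Gc))
    (fun q => (ρ q : V →ₗ[ℂ] V) v)

/-- The space of holomorphic sections over `G/L`: the holomorphic maps `ψ : G Q⁻ → V` such that
`ψ (y q) = ρ(q)⁻¹ ψ(y)`. -/
def Sections (G : Subgroup Gc) (T : GroupLieAlgebra 𝓘(ℂ, E) Gc)
    (ρ : QMinus T →* LinearMap.GeneralLinearGroup ℂ V) : Submodule ℂ (GQ G T → V) where
  carrier := {ψ | IsHolomorphic (E := E) ψ ∧ ∀ (y : GQ G T) (q : QMinus T),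
    ψ ⟨y * q, mul_mem_GQ_right y.2 q⟩ = ((ρ q)⁻¹ : LinearMap.GeneralLinearGroup ℂ V).val (ψ y)}
  zero_mem' := ⟨IsHolomorphic.zero, fun y q => by simp⟩
  add_mem' := by
    intro a b ha hb
    exact ⟨ha.1.add hb.1, fun y q => by
      simp only [Pi.add_apply, ha.2 y q, hb.2 y q, map_add]⟩
  smul_mem' := by
    intro c a ha
    exact ⟨ha.1.const_smul c, fun y q => by
      simp only [Pi.smul_apply, ha.2 y q, map_smul]⟩

/-- The representation `ϱ` of `G` on the space of sections, `(ϱ(g) ψ)(y) = ψ(g⁻¹ y)`. -/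
def sectionRep (G : Subgroup Gc) (T : GroupLieAlgebra 𝓘(ℂ, E) Gc)
    (ρ : QMinus T →* LinearMap.GeneralLinearGroup ℂ V) :
    Representation ℂ G (Sections G T ρ) where
  toFun g :=
    { toFun := fun ψ => ⟨fun y => ψ.1 ⟨(g⁻¹ : G) * y, mul_mem_GQ_left g⁻¹ y.2⟩, by
        constructor
        · intro x hx
          obtain ⟨N, F, hN, hxN, hF, h⟩ := ψ.2.1 _ (mul_mem_GQ_left g⁻¹ hx)
          have hd := mdifferentiable_mul_left (E := E) ((g⁻¹ : G) : Gc)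
          refine ⟨(fun z => ((g⁻¹ : G) : Gc) * z) ⁻¹' N, fun z => F (((g⁻¹ : G) : Gc) * z),
            hN.preimage hd.continuous, hxN, hF.comp hd.mdifferentiableOn (fun _ hz => hz),
            fun y hy =>
              h ⟨_, mul_mem_GQ_left g⁻¹ y.2⟩ hy⟩
        · intro y q
          have := ψ.2.2 ⟨(g⁻¹ : G) * y, mul_mem_GQ_left g⁻¹ y.2⟩ q
          simpa only [mul_assoc] using this⟩
      map_add' := fun _ _ => rfl
      map_smul' := fun _ _ => rfl }
  map_one' := by
    ext ψ y
    simp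
  map_mul' g h := by
    ext ψ y
    simp [mul_assoc]

/-- The complex span of the sections `ϱ(k) φ`, for `k` in the subgroup `K`. -/
def orbitSpan {G : Subgroup Gc} {T : GroupLieAlgebra 𝓘(ℂ, E) Gc}
    {ρ : QMinus T →* LinearMap.GeneralLinearGroup ℂ V} (K : Subgroup Gc) (φ : Sections G T ρ) :
    Submodule ℂ (Sections G T ρ) :=
  Submodule.span ℂ {ψ | ∃ k : G, (k : Gc) ∈ K ∧ ψ = sectionRep G T ρ k φ}

end Groups

end EllipticOrbit

end

/-!
# Polynomiality of `K`-finite sections over an elliptic orbit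

Ellipticity of `T` grades the complex Lie algebra by the eigenspaces `𝔤^c` of `ad T`
(`isGraded_of_isElliptic`), and the one-parameter group `exp (λ T)` lies in `G`, in `K` and in `Q⁻`.
It acts on `𝔲⁺` with weights `c > 0` only. A basis of the finite-dimensional span of the `K`-orbit
of `φ`, read in the exponential coordinates `z ↦ φ (exp z)` on `𝔲⁺`, is a holomorphic germ at `0`
which intertwines this linear flow with a family of endomorphisms of a finite-dimensional space.
Its `n`-th derivative at `0` takes weight vectors to eigenvectors whose weight grows linearly with
`n`. Only finitely many weights occur in a finite-dimensional space, so the Taylor series is a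
polynomial (`exists_polynomial_of_equivariant`, `exists_polynomial_eventually_eq`).

This determines `φ` on `U⁺ ∩ G Q⁻` near the identity only, and `U⁺ ∩ G Q⁻` is not known to be
connected, so the identity theorem cannot be applied on it directly. Instead, the polynomial is
carried to the group. The big cell `U⁺ Q⁻` is the set `{h ≠ 0}` for a holomorphic function `h` on
the group, and its elements factor as `x = exp (κ x) q` with `q ∈ Q⁻` and `κ` holomorphic
(`exists_bigCell_coordinates`). If `p` is the polynomial, then `x ↦ φ (exp (κ x)) - p (κ x)` is
holomorphic on `G Q⁻ ∩ {h ≠ 0}`, invariant under right translation by `Q⁻`, and zero near the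
identity. As `G` is connected and a proper analytic subset does not disconnect locally, it vanishes
near every point of `G` off `{h = 0}` (`eventually_eq_zero_of_isPreconnected`), hence, by
invariance, on all of `G Q⁻ ∩ {h ≠ 0}`, which contains `U⁺ ∩ G Q⁻` (`eq_of_eventually_eq_expE`).
The composite `p ∘ κ` is holomorphic on the big cell and gives the extension to `U⁺`. Uniqueness
follows along the complex lines of `𝔲⁺` (`eq_of_isHolomorphic_UPlus`).

The big cell is described through the adjoint representation: `x` lies in it when `Ad x 𝔮⁻` is
transversal to `𝔲⁺`, and then `Ad x 𝔮⁻` meets `T + 𝔲⁺` in exactly one point, which depends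
holomorphically on `x` (`exists_transversality_function`). The orbit map `z ↦ Ad (exp z) T` is a
biholomorphism of `𝔲⁺` onto `T + 𝔲⁺`, because it is a local biholomorphism at `0` commuting with the
flow `Ad (exp (i s T))`, which contracts `𝔲⁺` to `0` (`exists_inverse_of_contraction`); its inverse
yields `κ`. That `G Q⁻` is open follows from `𝔤 + 𝔮⁻` being the whole Lie algebra
(`range_inclE_sup_qE`).

The Lie theory on which this rests is developed from the definition of a Lie group: existence and
uniqueness of one-parameter subgroups, the fact that the derivative of `Ad` is `ad`
(`exists_hasFDerivAt_Ad_symm`), `Ad (exp X) = exp (ad X)` (`AdE_expE`), and the holomorphy of the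
exponential map (`contMDiff_expE`). For the last, `ad` is injective by semisimplicity, so near the
identity a component of `Ad` is a holomorphic coordinate system, in which `exp` becomes
`X ↦ exp (ad X)`.
-/

noncomputable section

namespace EllipticOrbit

/-! ### Holomorphic functions of several variables -/

section SeveralVariables

open Metric Filter Set

variable {X : Type*} [NormedAddCommGroup X] [NormedSpace ℂ X]
  {W : Type*} [NormedAddCommGroup W] [NormedSpace ℂ W]

/-- Cauchy's estimate for the Fréchet derivative. -/
theorem norm_fderiv_le_of_norm_le_on_ball {f : X → W} {x : X} {R M : ℝ} (hR : 0 < R)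
    (hd : DifferentiableOn ℂ f (ball x R)) (hM : ∀ y ∈ ball x R, ‖f y‖ ≤ M) :
    ‖fderiv ℂ f x‖ ≤ 2 * M / R := by
  refine Complex.norm_fderiv_le_div_of_mapsTo_ball hd (fun y hy => ?_) hR
  rw [mem_closedBall, dist_eq_norm]
  linarith [norm_sub_le (f y) (f x), hM y hy, hM x (mem_ball_self hR)]

theorem hasFDerivAt_comp_add_right {f : X → W} {f' : X →L[ℂ] W} {x v : X}
    (h : HasFDerivAt f f' (x + v)) : HasFDerivAt (fun y => f (y + v)) f' x := by
  simpa [Function.comp_def] using h.comp x ((hasFDerivAt_id x).add_const v)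

/-- A bounded holomorphic function has Lipschitz derivative on smaller balls, by Cauchy's estimate
for `w ↦ f (w + (z - y)) - f w`. -/
theorem norm_fderiv_sub_le_of_norm_le_on_ball {f : X → W} {x : X} {R M : ℝ} (hR : 0 < R)
    (hd : DifferentiableOn ℂ f (ball x (3 * R))) (hM : ∀ y ∈ ball x (3 * R), ‖f y‖ ≤ M)
    {y z : X} (hy : y ∈ ball x R) (hz : z ∈ ball x R) :
    ‖fderiv ℂ f z - fderiv ℂ f y‖ ≤ 2 * (2 * M / R * ‖z - y‖) / R := by
  have sub : ∀ w ∈ ball x (2 * R), ball w R ⊆ ball x (3 * R) := fun w hw =>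
    ball_subset_ball' (by rw [mem_ball] at hw; linarith)
  have hb : ∀ w ∈ ball x (2 * R), ‖fderiv ℂ f w‖ ≤ 2 * M / R := fun w hw =>
    norm_fderiv_le_of_norm_le_on_ball hR (hd.mono (sub w hw)) fun y hy => hM y (sub w hw hy)
  have hda : ∀ w ∈ ball x (2 * R), DifferentiableAt ℂ f w := fun w hw =>
    hd.differentiableAt (isOpen_ball.mem_nhds (sub w hw (mem_ball_self hR)))
  have s1 : ball y R ⊆ ball x (2 * R) := ball_subset_ball' (by rw [mem_ball] at hy; linarith)
  have s2 : ∀ w ∈ ball y R, w + (z - y) ∈ ball x (2 * R) := fun w hw => by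
    rw [mem_ball, dist_eq_norm] at hw hz ⊢
    calc ‖w + (z - y) - x‖ = ‖(w - y) + (z - x)‖ := by congr 1; abel
      _ ≤ _ := norm_add_le _ _
      _ < _ := by linarith
  have hy' : y + (z - y) = z := by abel
  have hdf : fderiv ℂ (fun w => f (w + (z - y)) - f w) y = fderiv ℂ f z - fderiv ℂ f y := by
    have h1 := (hda _ (s2 y (mem_ball_self hR))).hasFDerivAt
    have h2 := (hda _ (s1 (mem_ball_self hR))).hasFDerivAt
    have h3 := (hasFDerivAt_comp_add_right h1).sub h2
    rw [hy'] at h3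
    exact h3.fderiv
  rw [← hdf]
  refine norm_fderiv_le_of_norm_le_on_ball hR (fun w hw => ?_) fun w hw => ?_
  · have h1 := hasFDerivAt_comp_add_right (hda _ (s2 w hw)).hasFDerivAt
    exact (h1.sub (hda _ (s1 hw)).hasFDerivAt).differentiableAt.differentiableWithinAt
  · have := (convex_ball x (2 * R)).norm_image_sub_le_of_norm_fderiv_le hda hb (s1 hw) (s2 w hw)
    simpa using this

/-- A directional derivative of a holomorphic function is holomorphic: it is the locally uniform
limit of difference quotients, whose derivatives converge by Cauchy's estimate. -/
theorem differentiableOn_fderiv_apply [CompleteSpace W] {f : X → W} {U : Set X} (hU : IsOpen U)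
    (hf : DifferentiableOn ℂ f U) (w : X) :
    DifferentiableOn ℂ (fun x => fderiv ℂ f x w) U := by
  intro x hx
  obtain ⟨R, M, hR, hRU, hM⟩ : ∃ R M : ℝ, 0 < R ∧ ball x (3 * R) ⊆ U ∧
      ∀ y ∈ ball x (3 * R), ‖f y‖ ≤ M := by
    have hc : ContinuousAt f x := (hf.differentiableAt (hU.mem_nhds hx)).continuousAt
    have h1 : ∀ᶠ y in 𝓝 x, ‖f y‖ < ‖f x‖ + 1 := hc.norm.eventually_lt_const (by linarith)
    obtain ⟨r, hr, h⟩ := Metric.eventually_nhds_iff_ball.1 (h1.and (hU.mem_nhds hx))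
    refine ⟨r / 3, ‖f x‖ + 1, by positivity, fun y hy => ?_, fun y hy => ?_⟩ <;>
    rw [mul_div_cancel₀ r three_ne_zero] at hy
    exacts [(h y hy).2, (h y hy).1.le]
  have hd := hf.mono hRU
  set C := 2 * (2 * M / R) / R with hC
  have hM0 : 0 ≤ M := (norm_nonneg _).trans (hM x (mem_ball_self (by positivity)))
  have hC0 : 0 ≤ C := by positivity
  have hL : ∀ y ∈ ball x R, ∀ z ∈ ball x R, ‖fderiv ℂ f z - fderiv ℂ f y‖ ≤ C * ‖z - y‖ :=
    fun y hy z hz => (norm_fderiv_sub_le_of_norm_le_on_ball hR hd hM hy hz).trans_eq (by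
      rw [hC]; ring)
  have hda : ∀ y ∈ ball x R, DifferentiableAt ℂ f y := fun y hy =>
    hd.differentiableAt (isOpen_ball.mem_nhds (ball_subset_ball (by linarith) hy))
  -- the difference quotients in the direction `w`, for all large `n`
  obtain ⟨n₀, hn₀⟩ := exists_nat_gt (‖w‖ / (R / 2))
  let s : ℕ → ℂ := fun n => ((n + n₀ + 1 : ℕ) : ℂ)⁻¹
  have hsn : ∀ n, ‖s n‖ = ((n + n₀ + 1 : ℕ) : ℝ)⁻¹ := fun n => by
    simp only [s, norm_inv, Complex.norm_natCast]
  have hs0 : ∀ n, s n ≠ 0 := fun n => inv_ne_zero (Nat.cast_ne_zero.2 (by omega))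
  have hsw : ∀ n, ‖s n • w‖ < R / 2 := fun n => by
    rw [norm_smul, hsn, inv_mul_lt_iff₀ (by positivity), ← div_lt_iff₀ (by positivity)]
    refine hn₀.trans_le ?_
    push_cast; linarith [n.cast_nonneg (α := ℝ)]
  have hst : Tendsto (fun n => ‖s n‖) atTop (𝓝 0) := by
    simp only [hsn]
    have h := (tendsto_add_atTop_iff_nat (f := fun n : ℕ => ((n : ℝ))⁻¹) (n₀ + 1)).2
      tendsto_inv_atTop_nhds_zero_nat
    exact h
  let g : ℕ → X → W := fun n z => (s n)⁻¹ • (f (z + s n • w) - f z)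
  have hin : ∀ n, ∀ z ∈ ball x (R / 2), z + s n • w ∈ ball x R := fun n z hz => by
    rw [mem_ball, dist_eq_norm] at hz ⊢
    calc ‖z + s n • w - x‖ = ‖(z - x) + s n • w‖ := by congr 1; abel
      _ ≤ _ := norm_add_le _ _
      _ < _ := by linarith [hsw n]
  have hin' : ball x (R / 2) ⊆ ball x R := ball_subset_ball (by linarith)
  have hg : ∀ n, DifferentiableOn ℂ (g n) (ball x (R / 2)) := fun n z hz => by
    have h1 := hasFDerivAt_comp_add_right (hda _ (hin n z hz)).hasFDerivAt
    exact ((h1.sub (hda _ (hin' hz)).hasFDerivAt).const_smul (s n)⁻¹).differentiableAt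
      |>.differentiableWithinAt
  have happ : ∀ n, ∀ z ∈ ball x (R / 2), ‖g n z - fderiv ℂ f z w‖ ≤ C * ‖w‖ * ‖w‖ * ‖s n‖ := by
    intro n z hz
    have hseg : segment ℝ z (z + s n • w) ⊆ ball x R :=
      (convex_ball x R).segment_subset (hin' hz) (hin n z hz)
    have h := (convex_segment z (z + s n • w)).norm_image_sub_le_of_norm_fderiv_le'
      (𝕜 := ℂ) (f := f) (φ := fderiv ℂ f z) (C := C * ‖s n • w‖)
      (fun y hy => hda y (hseg hy)) (fun y hy => ?_) (left_mem_segment ℝ _ _)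
      (right_mem_segment ℝ _ _)
    · have e : g n z - fderiv ℂ f z w
          = (s n)⁻¹ • (f (z + s n • w) - f z - fderiv ℂ f z (z + s n • w - z)) := by
        simp only [g, add_sub_cancel_left, map_smul, smul_sub, smul_smul, inv_mul_cancel₀ (hs0 n),
          one_smul]
      have hn0 : (0 : ℝ) < ‖s n‖ := norm_pos_iff.2 (hs0 n)
      rw [e, norm_smul, norm_inv, inv_mul_le_iff₀ hn0]
      refine h.trans_eq ?_
      rw [add_sub_cancel_left, norm_smul]; ring
    · refine (hL z (hin' hz) y (hseg hy)).trans (mul_le_mul_of_nonneg_left ?_ hC0)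
      have := norm_sub_le_of_mem_segment hy
      simpa using this
  set A := C * ‖w‖ * ‖w‖ with hA
  have hA0 : 0 ≤ A := by positivity
  have hsub : ∀ z ∈ ball x (R / 4), ball z (R / 4) ⊆ ball x (R / 2) := fun z hz =>
    ball_subset_ball' (by rw [mem_ball] at hz; linarith)
  have hcau : ∀ m n, ∀ z ∈ ball x (R / 4), ‖fderiv ℂ (g m) z - fderiv ℂ (g n) z‖
      ≤ 2 * (A * (‖s m‖ + ‖s n‖)) / (R / 4) := by
    intro m n z hz
    have hz' := hsub z hz (mem_ball_self (by positivity))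
    have h1 := ((hg m).differentiableAt (isOpen_ball.mem_nhds hz'))
    have h2 := ((hg n).differentiableAt (isOpen_ball.mem_nhds hz'))
    rw [← fderiv_sub h1 h2]
    refine norm_fderiv_le_of_norm_le_on_ball (by positivity)
      (((hg m).sub (hg n)).mono (hsub z hz)) fun y hy => ?_
    have h3 := happ m y (hsub z hz hy)
    have h4 := happ n y (hsub z hz hy)
    calc ‖g m y - g n y‖ = ‖(g m y - fderiv ℂ f y w) - (g n y - fderiv ℂ f y w)‖ := by
          congr 1; abel
      _ ≤ _ := norm_sub_le _ _
      _ ≤ _ := by rw [mul_add]; exact add_le_add h3 h4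
  have hU' : UniformCauchySeqOn (fun n => fderiv ℂ (g n)) atTop (ball x (R / 4)) := by
    rw [Metric.uniformCauchySeqOn_iff]
    intro ε hε
    have h1 : Tendsto (fun n => 2 * (A * ‖s n‖) / (R / 4)) atTop (𝓝 0) := by
      have h := ((hst.const_mul A).const_mul 2).div_const (R / 4)
      simpa using h
    obtain ⟨N, hN⟩ := eventually_atTop.1 (h1.eventually_lt_const (half_pos hε))
    refine ⟨N, fun m hm n hn z hz => ?_⟩
    rw [dist_eq_norm]
    refine (hcau m n z hz).trans_lt ?_
    have e : 2 * (A * (‖s m‖ + ‖s n‖)) / (R / 4)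
      = 2 * (A * ‖s m‖) / (R / 4) + 2 * (A * ‖s n‖) / (R / 4) := by ring
    rw [e]
    linarith [hN m hm, hN n hn]
  have hlim : ∀ z : X, ∃ l, z ∈ ball x (R / 4) →
      Tendsto (fun n => fderiv ℂ (g n) z) atTop (𝓝 l) := fun z => by
    by_cases hz : z ∈ ball x (R / 4)
    · obtain ⟨l, hl⟩ := cauchySeq_tendsto_of_complete (hU'.cauchySeq hz)
      exact ⟨l, fun _ => hl⟩
    · exact ⟨0, fun h => (hz h).elim⟩
  choose g' hg' using hlim
  have hT := hU'.tendstoUniformlyOn_of_tendsto fun z hz => hg' z hz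
  have hx4 : x ∈ ball x (R / 4) := mem_ball_self (by positivity)
  have hsub4 : ball x (R / 4) ⊆ ball x (R / 2) := ball_subset_ball (by linarith)
  refine (hasFDerivAt_of_tendstoUniformlyOn (g := fun z => fderiv ℂ f z w) isOpen_ball hT
    (fun n z hz => ((hg n).differentiableAt (isOpen_ball.mem_nhds (hsub4 hz))).hasFDerivAt)
    (fun z hz => ?_) hx4).differentiableAt.differentiableWithinAt
  rw [tendsto_iff_norm_sub_tendsto_zero]
  refine squeeze_zero (fun _ => norm_nonneg _) (fun n => happ n z (hsub4 hz)) ?_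
  simpa using hst.const_mul A

/-- A function of several complex variables which is complex differentiable on an open set is
infinitely differentiable there. -/
theorem contDiffOn_of_differentiableOn_complex [FiniteDimensional ℂ X] [CompleteSpace W]
    {f : X → W} {U : Set X} (hU : IsOpen U) (hf : DifferentiableOn ℂ f U) :
    ContDiffOn ℂ ∞ f U := by
  rw [contDiffOn_infty]
  intro n
  induction n generalizing f with
  | zero => simpa [contDiffOn_zero] using hf.continuousOn
  | succ n ih =>
    push_cast
    rw [contDiffOn_succ_iff_fderiv_of_isOpen hU]
    refine ⟨hf, by simp, ?_⟩
    rw [contDiffOn_clm_apply]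
    exact fun w => ih (differentiableOn_fderiv_apply hU hf w)

end SeveralVariables

/-! ### Equivariant holomorphic germs are polynomial -/

section Equivariant

open Metric Filter Set

variable {X : Type*} [NormedAddCommGroup X] [NormedSpace ℂ X]
  {W : Type*} [NormedAddCommGroup W] [NormedSpace ℂ W]

/-- A family of endomorphisms of a finite-dimensional space has only finitely many characters
`t ↦ exp (i w t)` with a common eigenvector: at a small enough `t`, distinct frequencies `w` give
distinct eigenvalues. -/
theorem finite_setOf_character {W : Type*} [AddCommGroup W] [Module ℂ W] [FiniteDimensional ℂ W]
    (R : ℝ → Module.End ℂ W) :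
    {w : ℝ | ∃ x : W, x ≠ 0 ∧ ∀ t : ℝ, R t x = Complex.exp (Complex.I * w * t) • x}.Finite := by
  by_contra hinf
  obtain ⟨s, hs, hcard⟩ := Set.Infinite.exists_subset_card_eq hinf (Module.finrank ℂ W + 1)
  have hs' : ∀ w : s, ∃ x : W, x ≠ 0 ∧
      ∀ t : ℝ, R t x = Complex.exp (Complex.I * (w : ℝ) * t) • x := fun w => hs w.2
  choose x hx0 hx using hs'
  -- for this `t`, all `w t` lie in `(-π, π)`, where `x ↦ exp (i x)` is injective
  set t : ℝ := (1 + ∑ w ∈ s, |w|)⁻¹ with ht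
  have hS : 0 ≤ ∑ w ∈ s, |w| := Finset.sum_nonneg fun w _ => abs_nonneg w
  have htw : ∀ w ∈ s, |w * t| < Real.pi := fun w hw => by
    have h1 : |w| ≤ ∑ w ∈ s, |w| := Finset.single_le_sum (fun w _ => abs_nonneg w) hw
    rw [abs_mul, ht, abs_inv, abs_of_pos (show 0 < 1 + ∑ w ∈ s, |w| by linarith),
      ← div_eq_mul_inv]
    refine lt_of_le_of_lt ?_ (show (1 : ℝ) < Real.pi by linarith [Real.pi_gt_three])
    rw [div_le_one (by linarith)]
    linarith
  have him : ∀ w : ℝ, (Complex.I * w * t).im = w * t := fun w => by simp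
  have hind : LinearIndependent ℂ x := by
    refine Module.End.eigenvectors_linearIndependent' (R t)
      (fun w : s => Complex.exp (Complex.I * (w : ℝ) * t)) (fun w w' hww => ?_) x fun w => ?_
    · have h1 := abs_lt.1 (htw w w.2)
      have h2 := abs_lt.1 (htw w' w'.2)
      have h := Complex.exp_inj_of_neg_pi_lt_of_le_pi (by rw [him]; exact h1.1)
        (by rw [him]; exact h1.2.le) (by rw [him]; exact h2.1) (by rw [him]; exact h2.2.le) hww
      have h' := congrArg Complex.im h
      rw [him, him] at h'
      have ht0 : t ≠ 0 := by positivity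
      exact Subtype.ext (mul_right_cancel₀ ht0 h')
    · rw [Module.End.hasEigenvector_iff, Module.End.mem_eigenspace_iff]
      exact ⟨hx w t, hx0 w⟩
  have := hind.fintype_card_le_finrank
  rw [Fintype.card_coe, hcard] at this
  omega

theorem iteratedFDeriv_comp_clm_zero {Y : Type*} [NormedAddCommGroup Y] [NormedSpace ℂ Y]
    {f : X → W} {U : Set X} (hU : IsOpen U) (h0 : (0 : X) ∈ U)
    (hf : ContDiffOn ℂ ∞ f U) (g : Y →L[ℂ] X) (n : ℕ) :
    iteratedFDeriv ℂ n (f ∘ g) 0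
      = (iteratedFDeriv ℂ n f 0).compContinuousLinearMap fun _ => g := by
  have hU' : IsOpen (g ⁻¹' U) := hU.preimage g.continuous
  have h0' : g 0 ∈ U := by rwa [map_zero]
  have h := g.iteratedFDerivWithin_comp_right hf hU.uniqueDiffOn hU'.uniqueDiffOn h0'
    (i := n) (by exact_mod_cast le_top)
  rw [iteratedFDerivWithin_of_isOpen n hU' h0', iteratedFDerivWithin_of_isOpen n hU h0'] at h
  rw [h, map_zero]

/-- If a holomorphic germ at `0` intertwines a linear flow with positive weights on the
source with a family of endomorphisms of a finite-dimensional target, its Taylor coefficients of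
high degree vanish: the value of the `n`-th derivative on weight vectors is an eigenvector of
weight at least `n` times the smallest weight. -/
theorem exists_iteratedFDeriv_eq_zero_of_equivariant [FiniteDimensional ℂ X]
    [FiniteDimensional ℂ W] {f : X → W} {U : Set X} (hU : IsOpen U) (h0 : (0 : X) ∈ U)
    (hf : DifferentiableOn ℂ f U) (τ : ℝ → X →L[ℂ] X)
    (hτ : Submodule.span ℂ {x : X | ∃ c : ℝ, 0 < c ∧
      ∀ t : ℝ, τ t x = Complex.exp (Complex.I * c * t) • x} = ⊤)
    (R : ℝ → W →ₗ[ℂ] W) (hR : ∀ t, ∀ᶠ z in 𝓝 0, f (τ t z) = R t (f z)) :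
    ∃ N, ∀ n, N ≤ n → iteratedFDeriv ℂ n f 0 = 0 := by
  have : CompleteSpace W := FiniteDimensional.complete ℂ W
  have hcd := contDiffOn_of_differentiableOn_complex hU hf
  -- a basis of weight vectors
  let B := Module.Basis.ofSpan hτ.ge
  have : Finite _ := Module.Finite.finite_basis B
  have hB : ∀ i, ∃ c : ℝ, 0 < c ∧ ∀ t : ℝ, τ t (B i) = Complex.exp (Complex.I * c * t) • B i :=
    fun i => Module.Basis.ofSpan_subset hτ.ge (mem_range_self i)
  choose c hc0 hc using hB
  obtain ⟨c₀, hc₀, hcle⟩ : ∃ c₀ : ℝ, 0 < c₀ ∧ ∀ i, c₀ ≤ c i := by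
    by_cases h : Nonempty (Set.range B)
    · obtain ⟨_, i₁, rfl⟩ := h
      have : Nonempty _ := ⟨i₁⟩
      obtain ⟨i, hi⟩ := Finite.exists_min c
      exact ⟨c i, hc0 i, hi⟩
    · exact ⟨1, one_pos, fun i => (h ⟨B i, mem_range_self i⟩).elim⟩
  have hfin := finite_setOf_character R
  obtain ⟨b, hb⟩ := hfin.bddAbove
  refine ⟨⌊b / c₀⌋₊ + 1, fun n hn => ?_⟩
  have hder : ∀ t, (iteratedFDeriv ℂ n f 0).compContinuousLinearMap (fun _ => τ t)
      = (R t).toContinuousLinearMap.compContinuousMultilinearMap (iteratedFDeriv ℂ n f 0) := by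
    intro t
    have h1 : (f ∘ τ t) =ᶠ[𝓝 0] ((R t).toContinuousLinearMap ∘ f) := hR t
    have h2 := (h1.iteratedFDeriv ℂ n).eq_of_nhds
    rw [iteratedFDeriv_comp_clm_zero hU h0 hcd, ContinuousLinearMap.iteratedFDeriv_comp_left _
      (hcd.contDiffAt (hU.mem_nhds h0)) (by exact_mod_cast le_top)] at h2
    exact h2
  -- a nonzero value on basis vectors would have weight `∑ c (J i) ≥ n c₀ > b`
  have hz : (iteratedFDeriv ℂ n f 0).toMultilinearMap = 0 := by
    refine Module.Basis.ext_multilinear (fun _ => B) fun J => ?_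
    by_contra hne
    have hmem : (∑ i, c (J i)) ∈ {w : ℝ | ∃ x : W, x ≠ 0 ∧
        ∀ t : ℝ, R t x = Complex.exp (Complex.I * w * t) • x} := by
      refine ⟨iteratedFDeriv ℂ n f 0 fun i => B (J i), hne, fun t => ?_⟩
      have h := congrArg (fun M => M fun i => B (J i)) (hder t)
      simp only [ContinuousMultilinearMap.compContinuousLinearMap_apply, hc,
        ContinuousMultilinearMap.map_smul_univ, ← Complex.exp_sum] at h
      refine h.symm.trans ?_
      congr 2
      push_cast
      rw [Finset.mul_sum, Finset.sum_mul]
    have h1 : (n : ℝ) * c₀ ≤ b := by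
      refine le_trans ?_ (hb hmem)
      have := Finset.card_nsmul_le_sum Finset.univ (fun i => c (J i)) c₀ fun i _ => hcle _
      simpa using this
    have h2 : b / c₀ < n := (Nat.lt_floor_add_one _).trans_le (by exact_mod_cast hn)
    rw [div_lt_iff₀ hc₀] at h2
    linarith
  ext v
  exact congrArg (fun M => M v) hz

/-- A holomorphic germ with finitely many non-zero derivatives is given by its finite Taylor
expansion. -/
theorem eventually_eq_taylor_sum [FiniteDimensional ℂ X] [CompleteSpace W]
    {f : X → W} {U : Set X} (hU : IsOpen U) (h0 : (0 : X) ∈ U) (hf : DifferentiableOn ℂ f U)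
    {N : ℕ} (hN : ∀ n, N ≤ n → iteratedFDeriv ℂ n f 0 = 0) :
    ∀ᶠ z in 𝓝 0, f z
      = ∑ n ∈ Finset.range N, ((n.factorial : ℂ))⁻¹ • iteratedFDeriv ℂ n f 0 fun _ => z := by
  have hcd := contDiffOn_of_differentiableOn_complex hU hf
  obtain ⟨r, hr, hrU⟩ := Metric.isOpen_iff.1 hU 0 h0
  filter_upwards [ball_mem_nhds (0 : X) (half_pos hr)] with z hz
  -- `z` has norm less than `r / 2`, so `t ↦ f (t z)` has a Taylor series on a disc containing `1`
  let g : ℂ →L[ℂ] X := ContinuousLinearMap.toSpanSingleton ℂ z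
  have hd : DifferentiableOn ℂ (f ∘ g) (ball 0 2) := by
    refine hf.comp g.differentiableOn fun t ht => hrU ?_
    rw [mem_ball_zero_iff] at ht hz ⊢
    simp only [g, ContinuousLinearMap.toSpanSingleton_apply, norm_smul]
    nlinarith [norm_nonneg z, norm_nonneg t]
  have h := Complex.hasSum_taylorSeries_on_ball hd (z := 1) (by simp)
  have hterm : ∀ n, iteratedDeriv n (f ∘ g) 0 = iteratedFDeriv ℂ n f 0 fun _ => z := fun n => by
    rw [iteratedDeriv_eq_iteratedFDeriv, iteratedFDeriv_comp_clm_zero hU h0 hcd]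
    simp [g]
  simp only [hterm, sub_zero, one_pow, one_smul, Function.comp_apply, g,
    ContinuousLinearMap.toSpanSingleton_apply] at h
  refine h.unique (hasSum_sum_of_ne_finset_zero fun n hn => ?_)
  rw [hN n (by simpa using hn)]
  simp

theorem exists_mvPolynomial_multilinear {X W : Type*} [AddCommGroup X] [Module ℂ X]
    [AddCommGroup W] [Module ℂ W] {n r : ℕ}
    (M : MultilinearMap ℂ (fun _ : Fin n => X) W) (ℓ : W →ₗ[ℂ] ℂ) (e : Fin r → X) :
    ∃ P : MvPolynomial (Fin r) ℂ, ∀ z : Fin r → ℂ,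
      ℓ (M fun _ => ∑ j, z j • e j) = MvPolynomial.eval z P := by
  refine ⟨∑ J : Fin n → Fin r, MvPolynomial.C (ℓ (M fun i => e (J i))) *
    ∏ i, MvPolynomial.X (J i), fun z => ?_⟩
  rw [MultilinearMap.map_sum, map_sum, map_sum]
  refine Finset.sum_congr rfl fun J _ => ?_
  rw [MultilinearMap.map_smul_univ, map_smul, map_mul, MvPolynomial.eval_C, map_prod, smul_eq_mul,
    mul_comm]
  simp

/-- An equivariant holomorphic germ, see `exists_iteratedFDeriv_eq_zero_of_equivariant`, agrees near
`0` with a globally defined map whose coordinates are polynomials. -/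
theorem exists_polynomial_of_equivariant [FiniteDimensional ℂ X]
    [FiniteDimensional ℂ W] {f : X → W} {U : Set X} (hU : IsOpen U) (h0 : (0 : X) ∈ U)
    (hf : DifferentiableOn ℂ f U) (τ : ℝ → X →L[ℂ] X)
    (hτ : Submodule.span ℂ {x : X | ∃ c : ℝ, 0 < c ∧
      ∀ t : ℝ, τ t x = Complex.exp (Complex.I * c * t) • x} = ⊤)
    (R : ℝ → W →ₗ[ℂ] W) (hR : ∀ t, ∀ᶠ z in 𝓝 0, f (τ t z) = R t (f z)) :
    ∃ p : X → W, Differentiable ℂ p ∧ (∀ᶠ z in 𝓝 0, f z = p z) ∧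
      ∀ (r : ℕ) (e : Fin r → X) (ℓ : W →ₗ[ℂ] ℂ), ∃ P : MvPolynomial (Fin r) ℂ,
        ∀ z : Fin r → ℂ, ℓ (p (∑ j, z j • e j)) = MvPolynomial.eval z P := by
  have : CompleteSpace W := FiniteDimensional.complete ℂ W
  obtain ⟨N, hN⟩ := exists_iteratedFDeriv_eq_zero_of_equivariant hU h0 hf τ hτ R hR
  refine ⟨fun z => ∑ n ∈ Finset.range N, ((n.factorial : ℂ))⁻¹ • iteratedFDeriv ℂ n f 0 fun _ => z,
    ?_, eventually_eq_taylor_sum hU h0 hf hN, fun r e ℓ => ?_⟩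
  · refine Differentiable.fun_sum fun n _ => Differentiable.const_smul ?_ _
    exact ((iteratedFDeriv ℂ n f 0).contDiff (n := 1)).differentiable (by simp) |>.comp
      (differentiable_pi.2 fun _ => differentiable_id)
  · choose P hP using fun n : ℕ =>
      exists_mvPolynomial_multilinear (iteratedFDeriv ℂ n f 0).toMultilinearMap ℓ e
    refine ⟨∑ n ∈ Finset.range N, MvPolynomial.C ((n.factorial : ℂ))⁻¹ * P n, fun z => ?_⟩
    rw [map_sum, map_sum]
    refine Finset.sum_congr rfl fun n _ => ?_
    rw [map_smul, map_mul, MvPolynomial.eval_C, ← hP, smul_eq_mul]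
    rfl

end Equivariant

/-! ### Identity theorems -/

section Identity

open Metric Filter Set

variable {X : Type*} [NormedAddCommGroup X] [NormedSpace ℂ X]
  {W : Type*} [NormedAddCommGroup W] [NormedSpace ℂ W]

/-- A punctured disc is the image of a half plane under the exponential function. -/
theorem isPreconnected_ball_diff_center (t : ℂ) (r : ℝ) : IsPreconnected (ball t r \ {t}) := by
  rcases le_or_gt r 0 with hr | hr
  · rw [ball_eq_empty.2 hr, empty_sdiff]
    exact isPreconnected_empty
  have h : ball t r \ {t} = (fun z => t + Complex.exp z) '' {z | z.re < Real.log r} := by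
    ext s
    simp only [Set.mem_sdiff, mem_ball, mem_singleton_iff, mem_image, mem_ofPred_eq]
    constructor
    · rintro ⟨h1, h2⟩
      refine ⟨Complex.log (s - t), ?_, ?_⟩
      · rw [Complex.log_re]
        exact Real.log_lt_log (norm_pos_iff.2 (sub_ne_zero.2 h2)) (by rwa [← dist_eq_norm])
      · rw [Complex.exp_log (sub_ne_zero.2 h2)]; abel
    · rintro ⟨z, hz, rfl⟩
      refine ⟨?_, by simp⟩
      rw [dist_eq_norm, add_sub_cancel_left, Complex.norm_exp]
      exact (Real.lt_log_iff_exp_lt hr).1 hz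
  rw [h]
  exact (convex_halfSpace_re_lt _).isPreconnected.image _ (by fun_prop)

/-- The identity theorem on the complement of the zero set of a holomorphic function of one
variable: its zeros are isolated, and removing a point does not disconnect a disc. -/
theorem eq_zero_of_ne_zero_one_variable [CompleteSpace W] {Ω : Set ℂ} (hΩ : IsOpen Ω)
    (hc : IsPreconnected Ω) {h : ℂ → ℂ} (hh : DifferentiableOn ℂ h Ω) {D : ℂ → W}
    (hD : ∀ t ∈ Ω, h t ≠ 0 → DifferentiableAt ℂ D t) {p : ℂ} (hp : p ∈ Ω) (hp0 : h p ≠ 0)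
    (hDp : ∀ᶠ t in 𝓝 p, D t = 0) {q : ℂ} (hq : q ∈ Ω) (hq0 : h q ≠ 0) : D q = 0 := by
  set S : Set ℂ := {t | ∀ᶠ s in 𝓝[≠] t, D s = 0} with hS
  have hha := hh.analyticOnNhd hΩ
  have hSo : IsOpen S := by
    rw [isOpen_iff_mem_nhds]
    intro t ht
    have h1 : ∀ᶠ s in 𝓝[≠] t, ∀ᶠ u in 𝓝[≠] s, D u = 0 := by
      have h3 : ∀ᶠ s in 𝓝[≠] t, ∀ᶠ u in 𝓝[{t}ᶜ] s, D u = 0 := eventually_eventually_nhdsWithin.2 ht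
      filter_upwards [h3, self_mem_nhdsWithin] with s hs hst
      rw [(isOpen_compl_singleton).nhdsWithin_eq hst] at hs
      exact hs.filter_mono nhdsWithin_le_nhds
    have h4 : ∀ᶠ s in 𝓝 t, s ∈ S := by
      rw [eventually_nhdsWithin_iff] at h1
      filter_upwards [h1] with s hs
      by_cases hst : s = t
      · rw [hst]; exact ht
      · exact hs hst
    exact h4
  have hsub : Ω ⊆ S := by
    refine hc.subset_of_closure_inter_subset hSo
      ⟨p, hp, hDp.filter_mono nhdsWithin_le_nhds⟩ ?_
    rintro t ⟨htS, htΩ⟩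
    have hne : ∀ᶠ s in 𝓝[≠] t, h s ≠ 0 := by
      refine (hha t htΩ).eventually_eq_zero_or_eventually_ne_zero.resolve_left fun hz => hp0 ?_
      exact hha.eqOn_zero_of_preconnected_of_eventuallyEq_zero hc htΩ hz hp
    rw [eventually_nhdsWithin_iff] at hne
    obtain ⟨r, hr, hball⟩ := Metric.eventually_nhds_iff_ball.1 (hne.and (hΩ.mem_nhds htΩ))
    obtain ⟨s, hsb, hsS⟩ := Metric.mem_closure_iff.1 htS r hr
    have hsb' : s ∈ ball t r := by rw [mem_ball, dist_comm]; exact hsS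
    -- a point of the punctured disc near which `D` vanishes
    obtain ⟨s', hs't, hs'⟩ : ∃ s' ∈ ball t r \ {t}, ∀ᶠ u in 𝓝 s', D u = 0 := by
      have h1 : ∀ᶠ u in 𝓝[≠] s, ∀ᶠ v in 𝓝[{s}ᶜ] u, D v = 0 := eventually_eventually_nhdsWithin.2 hsb
      have h2 : ∀ᶠ u in 𝓝[≠] s, u ∈ ball t r :=
        mem_nhdsWithin_of_mem_nhds (isOpen_ball.mem_nhds hsb')
      have h3 : ∀ᶠ u in 𝓝[≠] s, u ≠ t := by
        by_cases hst : s = t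
        · rw [hst]; exact self_mem_nhdsWithin
        · exact mem_nhdsWithin_of_mem_nhds (isOpen_compl_singleton.mem_nhds hst)
      obtain ⟨u, ⟨⟨hu1, hu2⟩, hu3⟩, hu4⟩ := (((h1.and h2).and h3).and self_mem_nhdsWithin).exists
      rw [(isOpen_compl_singleton).nhdsWithin_eq hu4] at hu1
      exact ⟨u, ⟨hu2, hu3⟩, hu1⟩
    have hDa : AnalyticOnNhd ℂ D (ball t r \ {t}) := by
      refine DifferentiableOn.analyticOnNhd (fun u hu => ?_) (isOpen_ball.sdiff isClosed_singleton)
      have := hball u hu.1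
      exact (hD u this.2 (this.1 hu.2)).differentiableWithinAt
    have hz := hDa.eqOn_zero_of_preconnected_of_eventuallyEq_zero
      (isPreconnected_ball_diff_center t r) hs't hs'
    have : ∀ᶠ u in 𝓝[≠] t, u ∈ ball t r \ {t} :=
      inter_mem (mem_nhdsWithin_of_mem_nhds (ball_mem_nhds t hr)) self_mem_nhdsWithin
    filter_upwards [this] with u hu using hz hu
  have h1 : ∀ᶠ s in 𝓝[≠] q, D s = 0 := hsub hq
  have h2 : Tendsto D (𝓝[≠] q) (𝓝 (D q)) :=
    ((hD q hq hq0).continuousAt).mono_left nhdsWithin_le_nhds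
  have h3 : Tendsto D (𝓝[≠] q) (𝓝 0) := tendsto_const_nhds.congr' (h1.mono fun s hs => hs.symm)
  exact tendsto_nhds_unique h2 h3

/-- The identity theorem on the complement, in a ball, of the zero set of a holomorphic function. -/
theorem eq_zero_of_ne_zero_ball [CompleteSpace W] {x : X} {r : ℝ} {h : X → ℂ}
    (hh : DifferentiableOn ℂ h (ball x r)) {D : X → W}
    (hD : ∀ y ∈ ball x r, h y ≠ 0 → DifferentiableAt ℂ D y) {p : X} (hp : p ∈ ball x r)
    (hp0 : h p ≠ 0) (hDp : ∀ᶠ y in 𝓝 p, D y = 0) {q : X} (hq : q ∈ ball x r) (hq0 : h q ≠ 0) :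
    D q = 0 := by
  -- restrict to the complex line through `p` and `q`
  let L : ℂ → X := fun t => p + t • (q - p)
  have hLd : Differentiable ℂ L := by fun_prop
  have hL0 : L 0 = p := by simp [L]
  have hL1 : L 1 = q := by simp [L]
  have hΩ : IsOpen (L ⁻¹' ball x r) := isOpen_ball.preimage hLd.continuous
  have hconv : Convex ℝ (L ⁻¹' ball x r) := by
    intro s hs t ht a b ha hb hab
    have e : L (a • s + b • t) = a • L s + b • L t := by
      have : p = a • p + b • p := by rw [← add_smul, hab, one_smul]
      simp only [L, smul_add, add_smul, smul_assoc]
      nth_rewrite 1 [this]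
      abel
    change L (a • s + b • t) ∈ ball x r
    rw [e]
    exact convex_ball x r hs ht ha hb hab
  have key := eq_zero_of_ne_zero_one_variable (W := W) hΩ hconv.isPreconnected (h := h ∘ L)
    (D := D ∘ L) (hh.comp hLd.differentiableOn fun _ h => h)
    (fun t ht h0 => (hD (L t) ht h0).comp t (hLd t)) (p := 0) (q := 1)
    (by rw [mem_preimage, hL0]; exact hp) (by rw [Function.comp_apply, hL0]; exact hp0)
    (by
      have : Tendsto L (𝓝 0) (𝓝 p) := by
        have := hLd.continuous.tendsto 0
        rwa [hL0] at this
      exact this.eventually hDp)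
    (by rw [mem_preimage, hL1]; exact hq) (by rw [Function.comp_apply, hL1]; exact hq0)
  rwa [Function.comp_apply, hL1] at key

/-- A holomorphic function on a ball which vanishes near a point vanishes. -/
theorem eq_zero_of_eventually_ball [CompleteSpace W] {x : X} {r : ℝ} {D : X → W}
    (hD : DifferentiableOn ℂ D (ball x r)) {p : X} (hp : p ∈ ball x r)
    (hDp : ∀ᶠ y in 𝓝 p, D y = 0) {q : X} (hq : q ∈ ball x r) : D q = 0 :=
  eq_zero_of_ne_zero_ball (h := fun _ => 1) (differentiableOn_const _)
    (fun _ hy _ => hD.differentiableAt (isOpen_ball.mem_nhds hy)) hp one_ne_zero hDp hq one_ne_zero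

end Identity

/-! ### One-parameter subgroups -/

section RestrictScalars

variable {E E' : Type*} [NormedAddCommGroup E] [NormedSpace ℂ E]
  [NormedAddCommGroup E'] [NormedSpace ℂ E'] {M M' : Type*} [TopologicalSpace M]
  [ChartedSpace E M] [TopologicalSpace M'] [ChartedSpace E' M']

theorem contMDiff_restrictScalars {n : WithTop ℕ∞} {f : M → M'}
    (h : ContMDiff 𝓘(ℂ, E) 𝓘(ℂ, E') n f) : ContMDiff 𝓘(ℝ, E) 𝓘(ℝ, E') n f := fun x =>
  contMDiffAt_iff.2 ⟨(contMDiffAt_iff.1 (h x)).1, (contMDiffAt_iff.1 (h x)).2.restrict_scalars ℝ⟩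

theorem hasMFDerivAt_restrictScalars {f : M → M'} {x : M} {f' : E →L[ℂ] E'}
    (h : HasMFDerivAt 𝓘(ℂ, E) 𝓘(ℂ, E') f x f') :
    HasMFDerivAt 𝓘(ℝ, E) 𝓘(ℝ, E') f x (f'.restrictScalars ℝ) :=
  ⟨h.1, h.2.restrictScalars ℝ⟩

theorem isManifold_real [IsManifold 𝓘(ℂ, E) ω M] : IsManifold 𝓘(ℝ, E) ω M :=
  isManifold_of_contDiffOn _ _ _ fun e e' he he' => by
    have h : ContDiffOn ℂ ω _ _ := ((contDiffGroupoid ω 𝓘(ℂ, E)).compatible he he').1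
    exact h.restrict_scalars ℝ

end RestrictScalars

section Rescale

variable {E : Type*} [NormedAddCommGroup E] [NormedSpace ℂ E]
  {Gc : Type*} [TopologicalSpace Gc] [ChartedSpace E Gc] [Group Gc]

theorem IsOneParameterSubgroup.comp_mul {X : E} {γ : ℝ → Gc}
    (h : IsOneParameterSubgroup (E := E) X γ) (a : ℝ) :
    IsOneParameterSubgroup (E := E) (Gc := Gc) (a • X) fun t => γ (a * t) where
  map_zero := by simp [h.map_zero]
  map_add s t := by rw [mul_add, h.map_add]
  hasMFDerivAt := by
    have h0 : HasMFDerivAt 𝓘(ℝ, ℝ) 𝓘(ℝ, ℝ) (fun s : ℝ => a * s) 0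
        (a • ContinuousLinearMap.id ℝ ℝ) := ((hasFDerivAt_id (0 : ℝ)).const_mul a).hasMFDerivAt
    have h1 : HasMFDerivAt 𝓘(ℝ, ℝ) 𝓘(ℝ, E) γ (a * 0)
        (ContinuousLinearMap.toSpanSingleton ℝ X : ℝ →L[ℝ] E) := by
      rw [mul_zero]; exact h.hasMFDerivAt
    refine (HasMFDerivAt.comp (f := fun s : ℝ => a * s) 0 h1 h0).congr_mfderiv
      (ContinuousLinearMap.ext fun (b : ℝ) => ?_)
    change (a • b) • X = b • (a • X)
    rw [smul_eq_mul, mul_comm, mul_smul]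

end Rescale

section OneParameter

open Set Filter

variable {E : Type*} [NormedAddCommGroup E] [NormedSpace ℂ E]
  {Gc : Type*} [TopologicalSpace Gc] [ChartedSpace E Gc] [Group Gc] [LieGroup 𝓘(ℂ, E) ω Gc]

/-- A complex Lie group is a real Lie group. -/
theorem lieGroup_real : LieGroup 𝓘(ℝ, E) ω Gc where
  toIsManifold := isManifold_real
  contMDiff_mul := fun x =>
    have h := contMDiffAt_iff.1 (contMDiff_mul 𝓘(ℂ, E) ω (G := Gc) x)
    contMDiffAt_iff.2 ⟨h.1, h.2.restrict_scalars ℝ⟩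
  contMDiff_inv := contMDiff_restrictScalars (contMDiff_inv 𝓘(ℂ, E) ω)

instance isManifold_real_one : IsManifold 𝓘(ℝ, E) 1 Gc :=
  have := lieGroup_real (E := E) (Gc := Gc)
  IsManifold.of_le (n := ω) le_top

/-- The left-invariant vector field with value `X` at the identity, on the underlying real
manifold. -/
def leftField (X : E) (x : Gc) : TangentSpace 𝓘(ℝ, E) x :=
  (mfderiv 𝓘(ℝ, E) 𝓘(ℝ, E) (fun y : Gc => x * y) 1 : E →L[ℝ] E) X

theorem contMDiff_leftField (X : E) :
    ContMDiff 𝓘(ℝ, E) 𝓘(ℝ, E).tangent 1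
      (fun x => (⟨x, leftField X x⟩ : TangentBundle 𝓘(ℝ, E) Gc)) := by
  have := lieGroup_real (E := E) (Gc := Gc)
  have : LieGroup 𝓘(ℝ, E) (minSmoothness ℝ 3) Gc := LieGroup.of_le (n := ω) le_top
  have h := contMDiff_mulInvariantVectorField (I := 𝓘(ℝ, E)) (G := Gc) (X : E)
  exact h.of_le (by rw [minSmoothness_of_isRCLikeNormedField]; norm_num)

theorem hasMFDerivAt_mul_left_real (x y : Gc) :
    HasMFDerivAt 𝓘(ℝ, E) 𝓘(ℝ, E) (fun z : Gc => x * z) y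
      (mfderiv 𝓘(ℝ, E) 𝓘(ℝ, E) (fun z : Gc => x * z) y) := by
  have := lieGroup_real (E := E) (Gc := Gc)
  exact ((contMDiff_mul_left (I := 𝓘(ℝ, E)) (n := ω) (a := x)).mdifferentiable (by simp) y)
    |>.hasMFDerivAt

theorem mfderiv_mul_left_leftField (x y : Gc) (X : E) :
    (mfderiv 𝓘(ℝ, E) 𝓘(ℝ, E) (fun z : Gc => x * z) y : E →L[ℝ] E) (leftField X y)
      = (leftField X (x * y) : E) := by
  have h1 := hasMFDerivAt_mul_left_real (E := E) y 1
  have h2 : HasMFDerivAt 𝓘(ℝ, E) 𝓘(ℝ, E) (fun z : Gc => x * z) (y * 1)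
      (mfderiv 𝓘(ℝ, E) 𝓘(ℝ, E) (fun z : Gc => x * z) y : E →L[ℝ] E) := by
    rw [mul_one]
    exact hasMFDerivAt_mul_left_real x y
  have h3 := (h2.comp (1 : Gc) h1).mfderiv
  have e : (fun z : Gc => x * z) ∘ (fun z : Gc => y * z) = fun z => x * y * z := by
    ext z; simp [mul_assoc]
  rw [e] at h3
  exact (congrArg (fun A : E →L[ℝ] E => A X) h3).symm

/-- A left translate of an integral curve of a left-invariant vector field is an integral curve. -/
theorem isMIntegralCurveOn_mul_left {X : E} {γ : ℝ → Gc} {s : Set ℝ}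
    (h : IsMIntegralCurveOn γ (leftField X) s) (x : Gc) :
    IsMIntegralCurveOn (fun t => x * γ t) (leftField X) s := by
  intro t ht
  have h1 := (hasMFDerivAt_mul_left_real (E := E) x (γ t)).comp_hasMFDerivWithinAt t (h t ht)
  refine h1.congr_mfderiv ?_
  refine ContinuousLinearMap.ext fun (a : ℝ) => ?_
  change (mfderiv 𝓘(ℝ, E) 𝓘(ℝ, E) (fun z : Gc => x * z) (γ t) : E →L[ℝ] E)
    (a • (leftField X (γ t) : E)) = a • (leftField X (x * γ t) : E)
  rw [map_smul, mfderiv_mul_left_leftField]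

theorem IsOneParameterSubgroup.isMIntegralCurve {X : E} {γ : ℝ → Gc}
    (h : IsOneParameterSubgroup (E := E) X γ) : IsMIntegralCurve γ (leftField X) := by
  intro t
  have e : γ = (fun z => γ t * z) ∘ γ ∘ fun s => s - t := by
    ext s
    simp [← h.map_add]
  have h0 : HasMFDerivAt 𝓘(ℝ, ℝ) 𝓘(ℝ, ℝ) (fun s : ℝ => s - t) t (ContinuousLinearMap.id ℝ ℝ) :=
    ((hasFDerivAt_id t).sub_const t).hasMFDerivAt
  have h1 : HasMFDerivAt 𝓘(ℝ, ℝ) 𝓘(ℝ, E) γ (t - t)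
      (ContinuousLinearMap.toSpanSingleton ℝ X : ℝ →L[ℝ] E) := by
    rw [sub_self]; exact h.hasMFDerivAt
  have h2 : HasMFDerivAt 𝓘(ℝ, E) 𝓘(ℝ, E) (fun z : Gc => γ t * z) (γ (t - t))
      (mfderiv 𝓘(ℝ, E) 𝓘(ℝ, E) (fun z : Gc => γ t * z) 1 : E →L[ℝ] E) := by
    rw [sub_self, h.map_zero]
    exact hasMFDerivAt_mul_left_real _ _
  have h3 := h2.comp t (HasMFDerivAt.comp (f := fun s : ℝ => s - t) t h1 h0)
  rw [← e] at h3
  refine h3.congr_mfderiv (ContinuousLinearMap.ext fun (a : ℝ) => ?_)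
  change (mfderiv 𝓘(ℝ, E) 𝓘(ℝ, E) (fun z : Gc => γ t * z) 1 : E →L[ℝ] E) (a • X)
    = a • (leftField X (γ t) : E)
  exact (mfderiv 𝓘(ℝ, E) 𝓘(ℝ, E) (fun z : Gc => γ t * z) 1 : E →L[ℝ] E).map_smul a X

variable [T2Space Gc]

/-- Integral curves of a left-invariant vector field that meet at a common time coincide. -/
theorem eq_of_isMIntegralCurve {X : E} {γ γ' : ℝ → Gc}
    (h : IsMIntegralCurve γ (leftField X)) (h' : IsMIntegralCurve γ' (leftField X)) {t : ℝ}
    (ht : γ t = γ' t) : γ = γ' := by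
  have := lieGroup_real (E := E) (Gc := Gc)
  exact isMIntegralCurve_Ioo_eq_of_contMDiff_boundaryless (contMDiff_leftField X) h h' ht

/-- Uniqueness of one-parameter subgroups. -/
theorem IsOneParameterSubgroup.eq {X : E} {γ γ' : ℝ → Gc}
    (h : IsOneParameterSubgroup (E := E) X γ) (h' : IsOneParameterSubgroup (E := E) X γ') :
    γ = γ' :=
  eq_of_isMIntegralCurve h.isMIntegralCurve h'.isMIntegralCurve
    (h.map_zero.trans h'.map_zero.symm)

/-- An integral curve through the identity is a homomorphism, since `t ↦ γ (s + t)` and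
`t ↦ γ s * γ t` are integral curves with the same initial value. -/
theorem isOneParameterSubgroup_of_isMIntegralCurve {X : E} {γ : ℝ → Gc} (h0 : γ 0 = 1)
    (h : IsMIntegralCurve γ (leftField X)) : IsOneParameterSubgroup (E := E) X γ where
  map_zero := h0
  map_add s t := by
    have h1 : IsMIntegralCurve (fun t => γ s * γ t) (leftField X) :=
      isMIntegralCurve_iff_isMIntegralCurveOn.2
        (isMIntegralCurveOn_mul_left (h.isMIntegralCurveOn _) _)
    have h2 := eq_of_isMIntegralCurve (h.comp_add s) h1 (t := 0) (by simp [h0])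
    have h3 := congrFun h2 t
    simpa [add_comm] using h3
  hasMFDerivAt := by
    refine (h 0).congr_mfderiv (ContinuousLinearMap.ext fun (a : ℝ) => ?_)
    change a • (leftField X (γ 0) : E) = a • X
    have e : (fun y : Gc => 1 * y) = id := by ext; simp
    have : (leftField X (1 : Gc) : E) = X := by
      unfold leftField
      rw [e, mfderiv_id]
      rfl
    rw [h0, this]
    rfl

theorem lieExp_eq {X : E} {γ : ℝ → Gc} (h : IsOneParameterSubgroup (E := E) X γ) :
    lieExp (E := E) (Gc := Gc) X = γ 1 := by
  have hex : ∃ γ : ℝ → Gc, IsOneParameterSubgroup (E := E) X γ := ⟨γ, h⟩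
  unfold lieExp
  rw [dif_pos hex, hex.choose_spec.eq h]

section Existence

variable [CompleteSpace E]

/-- Existence of one-parameter subgroups: left translation shows that the integral curves of a
left-invariant vector field all exist for the same time. -/
theorem exists_isOneParameterSubgroup (X : E) :
    ∃ γ : ℝ → Gc, IsOneParameterSubgroup (E := E) X γ := by
  have := lieGroup_real (E := E) (Gc := Gc)
  obtain ⟨γ, h0, hγ⟩ := exists_isMIntegralCurveAt_of_contMDiffAt_boundaryless (t₀ := 0)
    ((contMDiff_leftField X) (1 : Gc))
  obtain ⟨ε, hε, hγ'⟩ := isMIntegralCurveAt_iff'.1 hγ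
  rw [Real.ball_eq_Ioo, zero_sub, zero_add] at hγ'
  obtain ⟨β, hβ0, hβ⟩ := exists_isMIntegralCurve_of_isMIntegralCurveOn
    (contMDiff_leftField (Gc := Gc) X) hε
    (fun x => ⟨fun t => x * γ t, by simp [h0], isMIntegralCurveOn_mul_left hγ' x⟩) 1
  exact ⟨β, isOneParameterSubgroup_of_isMIntegralCurve hβ0 hβ⟩

theorem isOneParameterSubgroup_lieExp (X : E) :
    IsOneParameterSubgroup (E := E) (Gc := Gc) X
      fun t : ℝ => lieExp (E := E) (Gc := Gc) (t • X : E) := by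
  obtain ⟨γ, h⟩ := exists_isOneParameterSubgroup (Gc := Gc) X
  have e : (fun t : ℝ => lieExp (E := E) (Gc := Gc) (t • X : E)) = γ := by
    ext t
    rw [lieExp_eq (h.comp_mul t), mul_one]
  rw [e]
  exact h

theorem lieExp_add_smul (X : E) (s t : ℝ) : lieExp (E := E) (Gc := Gc) ((s + t) • X : E)
    = lieExp (E := E) (Gc := Gc) (s • X : E) * lieExp (E := E) (Gc := Gc) (t • X : E) :=
  (isOneParameterSubgroup_lieExp X).map_add s t

theorem lieExp_zero : lieExp (E := E) (Gc := Gc) (0 : E) = 1 := by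
  simpa using (isOneParameterSubgroup_lieExp (Gc := Gc) (0 : E)).map_zero

theorem lieExp_neg (X : E) :
    lieExp (E := E) (Gc := Gc) (-X : E) = (lieExp (E := E) (Gc := Gc) X)⁻¹ := by
  have h := lieExp_add_smul (Gc := Gc) X (-1) 1
  rw [neg_add_cancel, zero_smul, lieExp_zero, neg_one_smul, one_smul] at h
  exact eq_inv_of_mul_eq_one_left h.symm

theorem lieExp_nsmul (X : E) (n : ℕ) :
    lieExp (E := E) (Gc := Gc) ((n : ℝ) • X : E) = lieExp (E := E) (Gc := Gc) X ^ n := by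
  induction n with
  | zero => simp [lieExp_zero]
  | succ n ih => push_cast; rw [lieExp_add_smul, ih, pow_succ, one_smul]

theorem continuous_lieExp_smul (X : E) :
    Continuous fun t : ℝ => lieExp (E := E) (Gc := Gc) (t • X : E) :=
  (isOneParameterSubgroup_lieExp X).isMIntegralCurve.continuous

/-- Conjugation carries the one-parameter subgroup of `X` to that of `Ad g X`. -/
theorem conj_lieExp (g : Gc) (X : E) :
    g * lieExp (E := E) (Gc := Gc) X * g⁻¹ = lieExp (E := E) (Gc := Gc) (Ad (E := E) g X) := by
  have h := isOneParameterSubgroup_lieExp (Gc := Gc) X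
  have h' : IsOneParameterSubgroup (E := E) (Gc := Gc) (Ad (E := E) g X)
      fun t : ℝ => g * lieExp (E := E) (Gc := Gc) (t • X : E) * g⁻¹ :=
    { map_zero := by rw [h.map_zero]; simp
      map_add := fun s t => by rw [h.map_add]; group
      hasMFDerivAt := by
        have h1 : HasMFDerivAt 𝓘(ℝ, E) 𝓘(ℝ, E) (fun x : Gc => g * x * g⁻¹)
            (lieExp (E := E) (Gc := Gc) ((0 : ℝ) • X : E))
            ((Ad (E := E) g : E →L[ℂ] E).restrictScalars ℝ) := by
          rw [h.map_zero]
          exact hasMFDerivAt_restrictScalars (mdifferentiable_conj (E := E) g 1).hasMFDerivAt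
        refine (h1.comp 0 h.hasMFDerivAt).congr_mfderiv (ContinuousLinearMap.ext fun (b : ℝ) => ?_)
        change (Ad (E := E) g : E →L[ℂ] E) ((b : ℂ) • X) = (b : ℂ) • (Ad (E := E) g : E →L[ℂ] E) X
        exact (Ad (E := E) g : E →L[ℂ] E).map_smul (b : ℂ) X }
  rw [lieExp_eq h', one_smul]

end Existence

end OneParameter

/-! ### The adjoint representation and its derivative -/

section Calculus

open Filter VectorField

variable {E : Type*} [NormedAddCommGroup E] [NormedSpace ℂ E]

theorem fderiv_prodMk_left {F : Type*} [NormedAddCommGroup F] [NormedSpace ℂ F] {m : E × E → F}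
    {x o : E} (h : DifferentiableAt ℂ m (x, o)) (Y : E) :
    fderiv ℂ (fun y => m (x, y)) o Y = fderiv ℂ m (x, o) (0, Y) := by
  have h1 : HasFDerivAt (fun y : E => (x, y)) (ContinuousLinearMap.inr ℂ E E) o :=
    hasFDerivAt_prodMk_right x o
  have := (h.hasFDerivAt.comp o h1).fderiv
  rw [Function.comp_def] at this
  rw [this]
  simp

/-- A local group law `m`, with conjugation `C`, written in a chart: the derivative at the identity
`o` of the adjoint representation `x ↦ ∂C(x, ·)(o)` is the Lie bracket of the left-invariant vector
fields `x ↦ ∂m(x, ·)(o) X`. Both are read off from the second derivative of `m` at `(o, o)`, by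
differentiating the identity `m (x, y) = m (C (x, y), x)`. -/
theorem hasFDerivAt_conj_eq_lieBracket {m C : E × E → E} {o : E}
    (hm : ContDiffAt ℂ ω m (o, o)) (hC : ContDiffAt ℂ ω C (o, o))
    (hmr : ∀ᶠ x in 𝓝 o, m (x, o) = x) (hml : ∀ᶠ y in 𝓝 o, m (o, y) = y)
    (hCo : ∀ᶠ x in 𝓝 o, C (x, o) = o) (hCl : ∀ᶠ y in 𝓝 o, C (o, y) = y)
    (hmC : ∀ᶠ p in 𝓝 (o, o), m p = m (C p, p.1)) :
    ∃ A' : E →L[ℂ] E →L[ℂ] E, HasFDerivAt (fun x => fderiv ℂ (fun y => C (x, y)) o) A' o ∧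
      ∀ X Y, A' X Y = lieBracket ℂ (fun x => fderiv ℂ m (x, o) (0, X))
        (fun x => fderiv ℂ m (x, o) (0, Y)) o := by
  have hA : ContDiffAt ℂ ω (fun x => fderiv ℂ (fun y => C (x, y)) o) o :=
    ContDiffAt.fderiv (f := fun x y => C (x, y)) (g := fun _ => o) (n := ω) hC contDiffAt_const
      (by simp)
  have hAd := (hA.differentiableAt (by simp)).hasFDerivAt
  refine ⟨_, hAd, fun X Y => ?_⟩
  set A := fun x => fderiv ℂ (fun y => C (x, y)) o
  set A' := fderiv ℂ A o
  have hm' : ContDiffAt ℂ ω (fderiv ℂ m) (o, o) := hm.fderiv_right (by simp)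
  set B := fderiv ℂ (fderiv ℂ m) (o, o)
  have hB : HasFDerivAt (fderiv ℂ m) B (o, o) := (hm'.differentiableAt (by simp)).hasFDerivAt
  have hsymm : ∀ v w, B v w = B w v := (hm.isSymmSndFDerivAt_of_omega)
  have hdm : ∀ᶠ p in 𝓝 (o, o), DifferentiableAt ℂ m p :=
    (hm.eventually (by simp)).mono fun p hp => hp.differentiableAt (by simp)
  have hdC : ∀ᶠ p in 𝓝 (o, o), DifferentiableAt ℂ C p :=
    (hC.eventually (by simp)).mono fun p hp => hp.differentiableAt (by simp)
  -- the two partial derivatives of `m` at `(o, o)` are the identity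
  have hm1 : ∀ Z, fderiv ℂ m (o, o) (Z, 0) = Z := fun Z => by
    have h1 : HasFDerivAt (fun x : E => (x, o)) (ContinuousLinearMap.inl ℂ E E) o :=
      hasFDerivAt_prodMk_left o o
    have h2 := HasFDerivAt.comp (f := fun x : E => (x, o)) o hdm.self_of_nhds.hasFDerivAt h1
    have h3 : (m ∘ fun x : E => (x, o)) =ᶠ[𝓝 o] id := hmr
    have h4 := (h2.congr_of_eventuallyEq h3.symm).unique (hasFDerivAt_id o)
    simpa using congrArg (fun T => T Z) h4
  have hm2 : ∀ Z, fderiv ℂ m (o, o) (0, Z) = Z := fun Z => by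
    rw [← fderiv_prodMk_left hdm.self_of_nhds]
    have h3 : (fun y => m (o, y)) =ᶠ[𝓝 o] id := hml
    rw [h3.fderiv_eq, fderiv_id]
    rfl
  have hA0 : A o Y = Y := by
    have h3 : (fun y => C (o, y)) =ᶠ[𝓝 o] id := hCl
    simp only [A]
    rw [h3.fderiv_eq, fderiv_id]
    rfl
  -- the derivative of the left-invariant vector fields
  have hV : ∀ Z : E, HasFDerivAt (fun x => fderiv ℂ m (x, o) (0, Z))
      (((ContinuousLinearMap.apply ℂ E ((0 : E), Z)).comp B).comp
        (ContinuousLinearMap.inl ℂ E E)) o := fun Z =>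
    HasFDerivAt.comp (f := fun x : E => (x, o)) o
      ((ContinuousLinearMap.apply ℂ E ((0 : E), Z)).hasFDerivAt.comp _ hB)
      (hasFDerivAt_prodMk_left o o)
  have hlie : lieBracket ℂ (fun x => fderiv ℂ m (x, o) (0, X))
      (fun x => fderiv ℂ m (x, o) (0, Y)) o = B (X, 0) (0, Y) - B (Y, 0) (0, X) := by
    simp only [lieBracket, (hV X).fderiv, (hV Y).fderiv, hm2]
    simp
  rw [hlie]
  -- differentiate `m (x, y) = m (C (x, y), x)` in `y` at `o`
  have hto : Tendsto (fun x : E => (x, o)) (𝓝 o) (𝓝 (o, o)) :=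
    (Continuous.prodMk_left o).tendsto o
  have hto' : Tendsto (fun x : E => (o, x)) (𝓝 o) (𝓝 (o, o)) :=
    (Continuous.prodMk_right o).tendsto o
  have hkey : (fun x => fderiv ℂ m (x, o) (0, Y)) =ᶠ[𝓝 o]
      fun x => fderiv ℂ m (o, x) (A x Y, 0) := by
    filter_upwards [hto.eventually hmC.eventually_nhds, hto.eventually hdm, hto.eventually hdC,
      hto'.eventually hdm, hCo] with x h1 h2 h3 h4 h5
    have h6 : Tendsto (fun y : E => (x, y)) (𝓝 o) (𝓝 (x, o)) :=
      (Continuous.prodMk_right x).tendsto o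
    have h7 : (fun y => m (x, y)) =ᶠ[𝓝 o] fun y => m (C (x, y), x) := h6.eventually h1
    have h8 : HasFDerivAt (fun y => C (x, y)) (A x) o :=
      (h3.comp o (hasFDerivAt_prodMk_right x o).differentiableAt).hasFDerivAt
    have h9 : HasFDerivAt (fun y => (C (x, y), x)) ((A x).prod 0) o :=
      h8.prodMk (hasFDerivAt_const x o)
    have h10 : HasFDerivAt m (fderiv ℂ m (o, x)) (C (x, o), x) := by
      rw [h5]; exact h4.hasFDerivAt
    rw [← fderiv_prodMk_left h2, h7.fderiv_eq]
    have h11 := (h10.comp o h9).fderiv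
    rw [Function.comp_def] at h11
    rw [h11]
    simp
  -- and then in `x` at `o`
  have hR1 : HasFDerivAt (fun x => fderiv ℂ m (o, x)) (B.comp (ContinuousLinearMap.inr ℂ E E)) o :=
    hB.comp o (hasFDerivAt_prodMk_right o o)
  have hR2 : HasFDerivAt (fun x => (A x Y, (0 : E)))
      (((ContinuousLinearMap.apply ℂ E Y).comp A').prod 0) o :=
    ((ContinuousLinearMap.apply ℂ E Y).hasFDerivAt.comp o hAd).prodMk (hasFDerivAt_const _ _)
  have hR := hR1.clm_apply hR2
  have h := congrArg (fun T => T X) (((hV Y).congr_of_eventuallyEq hkey.symm).unique hR)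
  simp only [ContinuousLinearMap.comp_apply, ContinuousLinearMap.apply_apply,
    ContinuousLinearMap.inl_apply, add_apply, ContinuousLinearMap.flip_apply,
    ContinuousLinearMap.inr_apply, ContinuousLinearMap.prod_apply, zero_apply,
    hm1, hA0] at h
  rw [h, hsymm (0, X) (Y, 0)]
  abel

end Calculus

section ChartAtOne

variable {E : Type*} [NormedAddCommGroup E] [NormedSpace ℂ E]
  {Gc : Type*} [TopologicalSpace Gc] [ChartedSpace E Gc] [One Gc]

theorem mfderiv_one_eq_fderiv {f : Gc → E} (hf : MDifferentiableAt 𝓘(ℂ, E) 𝓘(ℂ, E) f 1) :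
    (mfderiv 𝓘(ℂ, E) 𝓘(ℂ, E) f 1 : E →L[ℂ] E)
      = fderiv ℂ (f ∘ (extChartAt 𝓘(ℂ, E) (1 : Gc)).symm) (extChartAt 𝓘(ℂ, E) (1 : Gc) 1) := by
  rw [hf.mfderiv]
  simp only [writtenInExtChartAt, fderivWithin_univ, mfld_simps]
  rfl

variable [IsManifold 𝓘(ℂ, E) ω Gc]

theorem hasMFDerivAt_extChartAt_one :
    HasMFDerivAt 𝓘(ℂ, E) 𝓘(ℂ, E) (extChartAt 𝓘(ℂ, E) (1 : Gc)) 1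
      (ContinuousLinearMap.id ℂ E) := by
  have hd : MDifferentiableAt 𝓘(ℂ, E) 𝓘(ℂ, E) (extChartAt 𝓘(ℂ, E) (1 : Gc)) 1 :=
    mdifferentiableAt_extChartAt (mem_chart_source E 1)
  have h := hd.hasMFDerivAt
  have e : (extChartAt 𝓘(ℂ, E) (1 : Gc)) ∘ (extChartAt 𝓘(ℂ, E) (1 : Gc)).symm
      =ᶠ[𝓝 (extChartAt 𝓘(ℂ, E) (1 : Gc) 1)] id := by
    filter_upwards [extChartAt_target_mem_nhds (I := 𝓘(ℂ, E)) (1 : Gc)] with y hy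
    exact (extChartAt 𝓘(ℂ, E) (1 : Gc)).right_inv hy
  have h' := mfderiv_one_eq_fderiv hd
  rw [e.fderiv_eq, fderiv_id] at h'
  exact h.congr_mfderiv h'

end ChartAtOne

section Adjoint

open Filter VectorField

variable {E : Type*} [NormedAddCommGroup E] [NormedSpace ℂ E]
  {Gc : Type*} [TopologicalSpace Gc] [ChartedSpace E Gc] [Group Gc] [LieGroup 𝓘(ℂ, E) ω Gc]

/-- The adjoint representation, read in the chart at the identity. -/
theorem Ad_eq_fderiv (g : Gc) : (Ad (E := E) g : E →L[ℂ] E) =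
    fderiv ℂ (fun y => extChartAt 𝓘(ℂ, E) (1 : Gc)
      (g * (extChartAt 𝓘(ℂ, E) (1 : Gc)).symm y * g⁻¹)) (extChartAt 𝓘(ℂ, E) (1 : Gc) 1) := by
  have h1 := (mdifferentiable_conj (E := E) g 1).hasMFDerivAt
  have h2 : HasMFDerivAt 𝓘(ℂ, E) 𝓘(ℂ, E) (extChartAt 𝓘(ℂ, E) (1 : Gc)) (g * 1 * g⁻¹)
      (ContinuousLinearMap.id ℂ E) := by
    have : g * 1 * g⁻¹ = 1 := by simp
    rw [this]
    exact hasMFDerivAt_extChartAt_one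
  have h3 := HasMFDerivAt.comp (f := fun x : Gc => g * x * g⁻¹) 1 h2 h1
  have h4 := mfderiv_one_eq_fderiv h3.mdifferentiableAt
  rw [h3.mfderiv] at h4
  exact h4

/-- The left-invariant vector field, read in the chart at the identity. -/
theorem mpullbackWithin_mulInvariantVectorField (X : E) {x : E}
    (hx : x ∈ (extChartAt 𝓘(ℂ, E) (1 : Gc)).target) :
    mpullbackWithin 𝓘(ℂ, E) 𝓘(ℂ, E) (extChartAt 𝓘(ℂ, E) (1 : Gc)).symm
      (mulInvariantVectorField (I := 𝓘(ℂ, E)) (G := Gc) X) (Set.range 𝓘(ℂ, E)) x =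
    fderiv ℂ (fun y => extChartAt 𝓘(ℂ, E) (1 : Gc)
      ((extChartAt 𝓘(ℂ, E) (1 : Gc)).symm x * (extChartAt 𝓘(ℂ, E) (1 : Gc)).symm y))
      (extChartAt 𝓘(ℂ, E) (1 : Gc) 1) X := by
  have hinv : (mfderivWithin 𝓘(ℂ, E) 𝓘(ℂ, E) (extChartAt 𝓘(ℂ, E) (1 : Gc)).symm
      (Set.range 𝓘(ℂ, E)) x).inverse = mfderiv 𝓘(ℂ, E) 𝓘(ℂ, E) (extChartAt 𝓘(ℂ, E) (1 : Gc))
        ((extChartAt 𝓘(ℂ, E) (1 : Gc)).symm x) :=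
    ContinuousLinearMap.inverse_eq (mfderivWithin_extChartAt_symm_comp_mfderiv_extChartAt hx)
      (mfderiv_extChartAt_comp_mfderivWithin_extChartAt_symm hx)
  rw [mpullbackWithin_apply, hinv]
  set g := (extChartAt 𝓘(ℂ, E) (1 : Gc)).symm x with hg
  have hgs : g ∈ (chartAt E (1 : Gc)).source := by
    rw [← extChartAt_source 𝓘(ℂ, E)]
    exact (extChartAt 𝓘(ℂ, E) (1 : Gc)).map_target hx
  have h1 := (mdifferentiable_mul_left (E := E) g 1).hasMFDerivAt
  have h2 : HasMFDerivAt 𝓘(ℂ, E) 𝓘(ℂ, E) (extChartAt 𝓘(ℂ, E) (1 : Gc)) (g * 1)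
      (mfderiv 𝓘(ℂ, E) 𝓘(ℂ, E) (extChartAt 𝓘(ℂ, E) (1 : Gc)) g : E →L[ℂ] E) := by
    rw [mul_one]
    exact (mdifferentiableAt_extChartAt hgs).hasMFDerivAt
  have h3 := HasMFDerivAt.comp (f := fun x : Gc => g * x) 1 h2 h1
  have h4 := mfderiv_one_eq_fderiv h3.mdifferentiableAt
  rw [h3.mfderiv] at h4
  exact congrArg (fun A : E →L[ℂ] E => A X) h4

variable (Gc) in
/-- The group law in the chart at the identity. -/
def chartMul (p : E × E) : E :=
  extChartAt 𝓘(ℂ, E) (1 : Gc) ((extChartAt 𝓘(ℂ, E) (1 : Gc)).symm p.1 *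
    (extChartAt 𝓘(ℂ, E) (1 : Gc)).symm p.2)

variable (Gc) in
/-- Conjugation in the chart at the identity. -/
def chartConj (p : E × E) : E :=
  extChartAt 𝓘(ℂ, E) (1 : Gc) ((extChartAt 𝓘(ℂ, E) (1 : Gc)).symm p.1 *
    (extChartAt 𝓘(ℂ, E) (1 : Gc)).symm p.2 * ((extChartAt 𝓘(ℂ, E) (1 : Gc)).symm p.1)⁻¹)

theorem contMDiffAt_extChartAt_symm_one : ContMDiffAt 𝓘(ℂ, E) 𝓘(ℂ, E) ω
    (extChartAt 𝓘(ℂ, E) (1 : Gc)).symm (extChartAt 𝓘(ℂ, E) (1 : Gc) 1) :=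
  (contMDiffOn_extChartAt_symm (1 : Gc)).contMDiffAt (extChartAt_target_mem_nhds (1 : Gc))

theorem contMDiffAt_symm_fst : ContMDiffAt 𝓘(ℂ, E × E) 𝓘(ℂ, E) ω
    (fun p : E × E => (extChartAt 𝓘(ℂ, E) (1 : Gc)).symm p.1)
    (extChartAt 𝓘(ℂ, E) (1 : Gc) 1, extChartAt 𝓘(ℂ, E) (1 : Gc) 1) :=
  ContMDiffAt.comp (f := fun p : E × E => p.1) _ contMDiffAt_extChartAt_symm_one
    contDiff_fst.contMDiff.contMDiffAt

theorem contMDiffAt_symm_snd : ContMDiffAt 𝓘(ℂ, E × E) 𝓘(ℂ, E) ω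
    (fun p : E × E => (extChartAt 𝓘(ℂ, E) (1 : Gc)).symm p.2)
    (extChartAt 𝓘(ℂ, E) (1 : Gc) 1, extChartAt 𝓘(ℂ, E) (1 : Gc) 1) :=
  ContMDiffAt.comp (f := fun p : E × E => p.2) _ contMDiffAt_extChartAt_symm_one
    contDiff_snd.contMDiff.contMDiffAt

theorem contDiffAt_chartMul : ContDiffAt ℂ ω (chartMul (E := E) Gc)
    (extChartAt 𝓘(ℂ, E) (1 : Gc) 1, extChartAt 𝓘(ℂ, E) (1 : Gc) 1) := by
  rw [← contMDiffAt_iff_contDiffAt]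
  have h1 := (contMDiffAt_symm_fst (E := E) (Gc := Gc)).mul contMDiffAt_symm_snd
  refine ContMDiffAt.comp (g := extChartAt 𝓘(ℂ, E) (1 : Gc)) _ ?_ h1
  simp only [extChartAt_to_inv, mul_one]
  exact contMDiffAt_extChartAt

theorem contDiffAt_chartConj : ContDiffAt ℂ ω (chartConj (E := E) Gc)
    (extChartAt 𝓘(ℂ, E) (1 : Gc) 1, extChartAt 𝓘(ℂ, E) (1 : Gc) 1) := by
  rw [← contMDiffAt_iff_contDiffAt]
  have h1 := ((contMDiffAt_symm_fst (E := E) (Gc := Gc)).mul contMDiffAt_symm_snd).mul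
    contMDiffAt_symm_fst.inv
  refine ContMDiffAt.comp (g := extChartAt 𝓘(ℂ, E) (1 : Gc)) _ ?_ h1
  simp only [extChartAt_to_inv, mul_one, mul_inv_cancel]
  exact contMDiffAt_extChartAt

/-- The adjoint representation is holomorphic near the identity, with derivative the adjoint
representation of the Lie algebra. -/
theorem exists_hasFDerivAt_Ad_symm :
    ∃ A' : E →L[ℂ] E →L[ℂ] E,
      HasFDerivAt (fun x => (Ad (E := E) ((extChartAt 𝓘(ℂ, E) (1 : Gc)).symm x) : E →L[ℂ] E)) A'
        (extChartAt 𝓘(ℂ, E) (1 : Gc) 1) ∧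
      ∀ X Y : GroupLieAlgebra 𝓘(ℂ, E) Gc, A' X Y = (⁅X, Y⁆ : GroupLieAlgebra 𝓘(ℂ, E) Gc) := by
  set c := extChartAt 𝓘(ℂ, E) (1 : Gc) with hc
  have hs : c.symm (c 1) = 1 := extChartAt_to_inv _
  have ht : ∀ᶠ x in 𝓝 (c 1), x ∈ c.target := extChartAt_target_mem_nhds (1 : Gc)
  have hcs : ∀ᶠ p in 𝓝 (c 1, c 1), c.symm p.1 * c.symm p.2 * (c.symm p.1)⁻¹ ∈ c.source := by
    have h1 := (((contMDiffAt_symm_fst (E := E) (Gc := Gc)).mul contMDiffAt_symm_snd).mul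
      contMDiffAt_symm_fst.inv).continuousAt
    refine h1.eventually_mem ?_
    simp only [Pi.mul_apply, extChartAt_to_inv, mul_one, mul_inv_cancel]
    exact extChartAt_source_mem_nhds _
  obtain ⟨A', hA', h⟩ := hasFDerivAt_conj_eq_lieBracket (contDiffAt_chartMul (E := E) (Gc := Gc))
    contDiffAt_chartConj
    (by filter_upwards [ht] with x hx; simp only [chartMul, ← hc, hs, mul_one, c.right_inv hx])
    (by filter_upwards [ht] with x hx; simp only [chartMul, ← hc, hs, one_mul, c.right_inv hx])
    (by filter_upwards [ht] with x hx; simp only [chartConj, ← hc, hs, mul_one, mul_inv_cancel])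
    (by filter_upwards [ht] with x hx
        simp only [chartConj, ← hc, hs, one_mul, inv_one, mul_one, c.right_inv hx])
    (by filter_upwards [hcs] with p hp
        simp only [chartMul, chartConj, ← hc]
        rw [c.left_inv hp]
        group)
  refine ⟨A', ?_, fun X Y => ?_⟩
  · have e : (fun x => (Ad (E := E) (c.symm x) : E →L[ℂ] E))
        = fun x => fderiv ℂ (fun y => chartConj (E := E) Gc (x, y)) (c 1) := by
      ext1 x
      exact Ad_eq_fderiv (c.symm x)
    rw [e]
    exact hA'
  · refine (h X Y).trans ?_
    rw [GroupLieAlgebra.bracket_def, ← mlieBracketWithin_univ, mlieBracketWithin_apply]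
    have hid : ∀ Z : E, (mfderiv 𝓘(ℂ, E) 𝓘(ℂ, E) c 1 : E →L[ℂ] E).inverse Z = Z := fun Z => by
      rw [hasMFDerivAt_extChartAt_one.mfderiv]
      exact congrArg (fun A : E →L[ℂ] E => A Z) ContinuousLinearMap.inverse_id
    have hd : ∀ᶠ x in 𝓝 (c 1), DifferentiableAt ℂ (chartMul (E := E) Gc) (x, c 1) := by
      have h1 : ∀ᶠ p in 𝓝 (c 1, c 1), DifferentiableAt ℂ (chartMul (E := E) Gc) p :=
        (contDiffAt_chartMul.eventually (by simp)).mono fun p hp => hp.differentiableAt (by simp)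
      exact ((Continuous.prodMk_left (c 1)).tendsto (c 1)).eventually h1
    have hV : ∀ Z : E, (fun x => fderiv ℂ (chartMul (E := E) Gc) (x, c 1) (0, Z)) =ᶠ[𝓝 (c 1)]
        mpullbackWithin 𝓘(ℂ, E) 𝓘(ℂ, E) c.symm
          (mulInvariantVectorField (I := 𝓘(ℂ, E)) (G := Gc) Z) (Set.range 𝓘(ℂ, E)) := by
      intro Z
      filter_upwards [ht, hd] with x hx hdx
      rw [mpullbackWithin_mulInvariantVectorField Z hx, ← fderiv_prodMk_left hdx]
      rfl
    have hr : (c.symm ⁻¹' Set.univ ∩ Set.range 𝓘(ℂ, E)) = Set.univ := by simp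
    rw [hr]
    refine (Filter.EventuallyEq.lieBracket_vectorField_eq (hV X) (hV Y)).trans ?_
    refine Eq.trans ?_ (hid _).symm
    exact congrFun lieBracketWithin_univ.symm _

end Adjoint

/-! ### The exponential map -/

section Exponential

open Filter

variable {E : Type*} [NormedAddCommGroup E] [NormedSpace ℂ E]
  {Gc : Type*} [TopologicalSpace Gc] [ChartedSpace E Gc] [Group Gc]

/-- The exponential map, as a function on the model space. Mathlib's `GroupLieAlgebra` is a synonym
of the model space that carries the Lie bracket; analysis takes place on the model space itself. -/
def expE (X : E) : Gc := lieExp (E := E) (Gc := Gc) X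

/-- The adjoint representation, on the model space. -/
def AdE (g : Gc) : E →L[ℂ] E := Ad (E := E) g

variable [LieGroup 𝓘(ℂ, E) ω Gc]

theorem AdE_one : AdE (E := E) (1 : Gc) = 1 := Ad_one

theorem AdE_mul (g h : Gc) : AdE (E := E) (g * h) = AdE g * AdE (E := E) h := Ad_mul g h

theorem AdE_mul_apply (g h : Gc) (X : E) :
    AdE (E := E) (g * h) X = AdE g (AdE (E := E) h X) := by
  rw [AdE_mul]; rfl

theorem AdE_inv_apply_apply (g : Gc) (X : E) : AdE g⁻¹ (AdE (E := E) g X) = X := by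
  rw [← AdE_mul_apply, inv_mul_cancel, AdE_one]; rfl

theorem AdE_apply_inv_apply (g : Gc) (X : E) : AdE g (AdE (E := E) g⁻¹ X) = X := by
  rw [← AdE_mul_apply, mul_inv_cancel, AdE_one]; rfl

variable (Gc) in
/-- The adjoint representation of the Lie algebra, on the model space; see `adE_apply`. -/
def adE : E →L[ℂ] E →L[ℂ] E := (exists_hasFDerivAt_Ad_symm (E := E) (Gc := Gc)).choose

theorem adE_apply (X Y : GroupLieAlgebra 𝓘(ℂ, E) Gc) :
    adE (E := E) Gc X Y = (⁅X, Y⁆ : GroupLieAlgebra 𝓘(ℂ, E) Gc) :=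
  (exists_hasFDerivAt_Ad_symm (E := E) (Gc := Gc)).choose_spec.2 X Y

theorem hasFDerivAt_AdE_symm :
    HasFDerivAt (fun x => AdE (E := E) ((extChartAt 𝓘(ℂ, E) (1 : Gc)).symm x)) (adE Gc)
      (extChartAt 𝓘(ℂ, E) (1 : Gc) 1) :=
  (exists_hasFDerivAt_Ad_symm (E := E) (Gc := Gc)).choose_spec.1

theorem contDiffAt_AdE_symm :
    ContDiffAt ℂ ω (fun x => AdE (E := E) ((extChartAt 𝓘(ℂ, E) (1 : Gc)).symm x))
      (extChartAt 𝓘(ℂ, E) (1 : Gc) 1) := by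
  have e : (fun x => AdE (E := E) ((extChartAt 𝓘(ℂ, E) (1 : Gc)).symm x))
      = fun x => fderiv ℂ (fun y => chartConj (E := E) Gc (x, y))
        (extChartAt 𝓘(ℂ, E) (1 : Gc) 1) := by
    ext1 x
    exact Ad_eq_fderiv _
  rw [e]
  exact ContDiffAt.fderiv (f := fun x y => chartConj (E := E) Gc (x, y)) (n := ω)
    contDiffAt_chartConj contDiffAt_const (by simp)

theorem AdE_eventuallyEq_symm_comp :
    AdE (E := E) (Gc := Gc) =ᶠ[𝓝 1] (fun x => AdE ((extChartAt 𝓘(ℂ, E) (1 : Gc)).symm x)) ∘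
      extChartAt 𝓘(ℂ, E) (1 : Gc) := by
  filter_upwards [extChartAt_source_mem_nhds (I := 𝓘(ℂ, E)) (1 : Gc)] with x hx
  rw [Function.comp_apply, (extChartAt 𝓘(ℂ, E) (1 : Gc)).left_inv hx]

/-- The adjoint representation is holomorphic. -/
theorem contMDiff_AdE : ContMDiff 𝓘(ℂ, E) 𝓘(ℂ, E →L[ℂ] E) ω (AdE (E := E) (Gc := Gc)) := by
  have h1 : ContMDiffAt 𝓘(ℂ, E) 𝓘(ℂ, E →L[ℂ] E) ω (AdE (E := E) (Gc := Gc)) 1 := by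
    refine ContMDiffAt.congr_of_eventuallyEq ?_ AdE_eventuallyEq_symm_comp
    exact (contDiffAt_AdE_symm.contMDiffAt).comp 1 contMDiffAt_extChartAt
  intro g
  have e : AdE (E := E) (Gc := Gc) = (fun A => AdE g * A) ∘ AdE ∘ fun x => g⁻¹ * x := by
    ext1 x
    simp [← AdE_mul]
  have h2 : ContMDiffAt 𝓘(ℂ, E) 𝓘(ℂ, E →L[ℂ] E) ω (AdE (E := E) (Gc := Gc)) (g⁻¹ * g) := by
    rw [inv_mul_cancel]; exact h1
  have h3 : ContMDiffAt 𝓘(ℂ, E) 𝓘(ℂ, E →L[ℂ] E) ω (AdE (E := E) ∘ fun x : Gc => g⁻¹ * x) g :=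
    ContMDiffAt.comp (f := fun x : Gc => g⁻¹ * x) g h2 contMDiffAt_mul_left
  have h4 : ContDiff ℂ ω (fun A : E →L[ℂ] E => AdE g * A) := contDiff_const.mul contDiff_id
  rw [e]
  exact h4.contMDiff.contMDiffAt.comp g h3

theorem hasMFDerivAt_AdE_one :
    HasMFDerivAt 𝓘(ℂ, E) 𝓘(ℂ, E →L[ℂ] E) (AdE (E := E) (Gc := Gc)) 1
      (adE Gc : E →L[ℂ] E →L[ℂ] E) := by
  have h : HasMFDerivAt 𝓘(ℂ, E) 𝓘(ℂ, E →L[ℂ] E)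
      ((fun x => AdE (E := E) ((extChartAt 𝓘(ℂ, E) (1 : Gc)).symm x)) ∘
        extChartAt 𝓘(ℂ, E) (1 : Gc)) 1 (adE Gc : E →L[ℂ] E →L[ℂ] E) :=
    HasMFDerivAt.comp (f := extChartAt 𝓘(ℂ, E) (1 : Gc)) (1 : Gc)
      (hasFDerivAt_AdE_symm (E := E) (Gc := Gc)).hasMFDerivAt hasMFDerivAt_extChartAt_one
  exact h.congr_of_eventuallyEq AdE_eventuallyEq_symm_comp

variable [CompleteSpace E]

theorem adE_self (X : E) : adE Gc X X = 0 := by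
  have h : ∀ X : GroupLieAlgebra 𝓘(ℂ, E) Gc, adE (E := E) Gc X X = 0 := fun X =>
    (adE_apply X X).trans (lie_self X)
  exact h X

theorem adE_leibniz (X Y Z : E) :
    adE Gc X (adE Gc Y Z) = adE Gc (adE Gc X Y) Z + adE Gc Y (adE Gc X Z) := by
  have h : ∀ X Y Z : GroupLieAlgebra 𝓘(ℂ, E) Gc, adE (E := E) Gc X (adE (E := E) Gc Y Z) =
      adE (E := E) Gc (adE (E := E) Gc X Y) Z + adE (E := E) Gc Y (adE (E := E) Gc X Z) := by
    intro X Y Z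
    have h1 := leibniz_lie X Y Z
    have h2 := (adE_apply X ⁅Y, Z⁆).trans (h1.trans (congrArg₂ (· + ·)
      (adE_apply ⁅X, Y⁆ Z).symm (adE_apply Y ⁅X, Z⁆).symm))
    have e1 : adE (E := E) Gc Y Z = (⁅Y, Z⁆ : GroupLieAlgebra 𝓘(ℂ, E) Gc) := adE_apply Y Z
    have e2 : adE (E := E) Gc X Y = (⁅X, Y⁆ : GroupLieAlgebra 𝓘(ℂ, E) Gc) := adE_apply X Y
    have e3 : adE (E := E) Gc X Z = (⁅X, Z⁆ : GroupLieAlgebra 𝓘(ℂ, E) Gc) := adE_apply X Z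
    rw [e1, e2, e3]
    exact h2
  exact h X Y Z

theorem adE_swap (X Y : E) : adE Gc X Y = -adE Gc Y X := by
  have h : ∀ X Y : GroupLieAlgebra 𝓘(ℂ, E) Gc, adE (E := E) Gc X Y = -adE (E := E) Gc Y X :=
    fun X Y => (adE_apply X Y).trans ((lie_skew X Y).symm.trans
      (congrArg (fun Z : GroupLieAlgebra 𝓘(ℂ, E) Gc => -Z) (adE_apply Y X).symm))
  exact h X Y

section T2

variable [T2Space Gc]

theorem expE_zero : expE (Gc := Gc) (0 : E) = 1 := lieExp_zero

theorem expE_add_smul (X : E) (s t : ℝ) :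
    expE (Gc := Gc) ((s + t) • X) = expE (s • X) * expE (t • X) := lieExp_add_smul X s t

theorem expE_neg (X : E) : expE (Gc := Gc) (-X) = (expE X)⁻¹ := lieExp_neg X

theorem expE_nsmul (X : E) (n : ℕ) : expE (Gc := Gc) ((n : ℝ) • X) = expE X ^ n :=
  lieExp_nsmul X n

theorem conj_expE (g : Gc) (X : E) : g * expE X * g⁻¹ = expE (AdE g X) := conj_lieExp g X

theorem continuous_expE_smul (X : E) : Continuous fun t : ℝ => expE (Gc := Gc) (t • X) :=
  continuous_lieExp_smul X

theorem hasMFDerivAt_expE_smul (X : E) :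
    HasMFDerivAt 𝓘(ℝ, ℝ) 𝓘(ℝ, E) (fun t : ℝ => expE (Gc := Gc) (t • X)) 0
      (ContinuousLinearMap.toSpanSingleton ℝ X) :=
  (isOneParameterSubgroup_lieExp X).hasMFDerivAt

theorem hasDerivAt_AdE_expE_smul_zero (X : E) :
    HasDerivAt (fun t : ℝ => AdE (E := E) (expE (Gc := Gc) (t • X))) (adE Gc X) 0 := by
  have h1 : HasMFDerivAt 𝓘(ℝ, E) 𝓘(ℝ, E →L[ℂ] E) (AdE (E := E) (Gc := Gc))
      (expE (E := E) ((0 : ℝ) • X)) ((adE (E := E) Gc).restrictScalars ℝ) := by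
    rw [zero_smul, expE_zero]
    exact hasMFDerivAt_restrictScalars hasMFDerivAt_AdE_one
  have h2 := HasMFDerivAt.comp (f := fun t : ℝ => expE (Gc := Gc) (t • X)) 0 h1
    (hasMFDerivAt_expE_smul X)
  have h3 : HasFDerivAt (fun t : ℝ => AdE (E := E) (expE (Gc := Gc) (t • X)))
      (((adE (E := E) Gc).restrictScalars ℝ).comp (ContinuousLinearMap.toSpanSingleton ℝ X)) 0 :=
    hasMFDerivAt_iff_hasFDerivAt.1 h2
  replace h3 := h3.hasDerivAt
  refine h3.congr_deriv ?_
  change adE Gc ((1 : ℝ) • X) = adE Gc X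
  rw [one_smul]

/-- `Ad (exp X) = exp (ad X)`. -/
theorem AdE_expE (X : E) : AdE (expE (Gc := Gc) X) = NormedSpace.exp (adE Gc X) := by
  have hd : ∀ t : ℝ, HasDerivAt (fun t : ℝ => AdE (E := E) (expE (Gc := Gc) (t • X)))
      (AdE (expE (Gc := Gc) (t • X)) * adE Gc X) t := fun t => by
    have h0 : HasDerivAt (fun t : ℝ => AdE (E := E) (expE (Gc := Gc) (t • X))) (adE Gc X)
        (t - t) := by
      rw [sub_self]; exact hasDerivAt_AdE_expE_smul_zero X
    have h1 := (h0.comp_sub_const t t).const_mul (AdE (expE (Gc := Gc) (t • X)))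
    refine h1.congr_of_eventuallyEq (Eventually.of_forall fun s => ?_)
    change _ = AdE (expE (Gc := Gc) (t • X)) * AdE (expE (Gc := Gc) ((s - t) • X))
    rw [← AdE_mul, ← expE_add_smul, add_sub_cancel]
  have he : ∀ t : ℝ, HasDerivAt (fun t : ℝ => NormedSpace.exp (t • -adE Gc X))
      (-adE Gc X * NormedSpace.exp (t • -adE Gc X)) t := fun t =>
    hasDerivAt_exp_smul_const' (-adE Gc X) t
  have hp : ∀ t : ℝ, HasDerivAt (fun t : ℝ => AdE (E := E) (expE (Gc := Gc) (t • X)) *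
      NormedSpace.exp (t • -adE Gc X)) 0 t := fun t => by
    refine ((hd t).mul (he t)).congr_deriv ?_
    simp [mul_assoc]
  have hc := is_const_of_deriv_eq_zero (fun t => (hp t).differentiableAt)
    (fun t => (hp t).deriv) 1 0
  simp only [one_smul, zero_smul, expE_zero, AdE_one, NormedSpace.exp_zero, mul_one] at hc
  have hinv : NormedSpace.exp (-adE Gc X) * NormedSpace.exp (adE Gc X) = 1 := by
    let _ : NormedAlgebra ℚ (E →L[ℂ] E) := NormedAlgebra.restrictScalars ℚ ℂ (E →L[ℂ] E)
    have h := NormedSpace.exp_add_of_commute (Commute.refl (adE Gc X)).neg_left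
    rw [neg_add_cancel, NormedSpace.exp_zero] at h
    exact h.symm
  calc AdE (expE (Gc := Gc) X)
      = AdE (expE (Gc := Gc) X) * (NormedSpace.exp (-adE Gc X) * NormedSpace.exp (adE Gc X)) := by
        rw [hinv, mul_one]
    _ = _ := by rw [← mul_assoc, hc, one_mul]

/-- `Ad g` is a homomorphism of Lie algebras. -/
theorem AdE_adE (g : Gc) (X Y : E) : AdE g (adE Gc X Y) = adE Gc (AdE g X) (AdE g Y) := by
  have h1 : HasDerivAt (fun t : ℝ => AdE g (AdE (expE (Gc := Gc) (t • X)) Y))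
      (AdE g (adE Gc X Y)) 0 := by
    have h := ((((ContinuousLinearMap.apply ℂ E Y).restrictScalars ℝ).hasFDerivAt).comp_hasDerivAt
      0 (hasDerivAt_AdE_expE_smul_zero (Gc := Gc) X))
    exact (((AdE (E := E) g).restrictScalars ℝ).hasFDerivAt).comp_hasDerivAt 0 h
  have h2 : HasDerivAt (fun t : ℝ => AdE (expE (Gc := Gc) (t • AdE g X)) (AdE g Y))
      (adE Gc (AdE g X) (AdE g Y)) 0 :=
    (((ContinuousLinearMap.apply ℂ E (AdE g Y)).restrictScalars ℝ).hasFDerivAt).comp_hasDerivAt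
      0 (hasDerivAt_AdE_expE_smul_zero (Gc := Gc) (AdE g X))
  refine h1.unique (h2.congr_of_eventuallyEq (Eventually.of_forall fun t => ?_))
  change AdE g (AdE (expE (Gc := Gc) (t • X)) Y) = AdE (expE (Gc := Gc) (t • AdE g X)) (AdE g Y)
  have e : t • AdE (E := E) g X = AdE g (t • X) :=
    (((AdE (E := E) g).restrictScalars ℝ).map_smul t X).symm
  rw [e, ← conj_expE, AdE_mul_apply, AdE_mul_apply, AdE_inv_apply_apply]

section Semisimple

variable [FiniteDimensional ℂ E] [LieAlgebra.IsSemisimple ℂ (GroupLieAlgebra 𝓘(ℂ, E) Gc)]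

/-- `ad` is injective, the centre of a semisimple Lie algebra being trivial. -/
theorem adE_injective : Function.Injective (adE (E := E) Gc) := by
  rw [injective_iff_map_eq_zero]
  have h : ∀ X : GroupLieAlgebra 𝓘(ℂ, E) Gc, adE (E := E) Gc X = 0 → X = 0 := by
    intro X hX
    have hc : X ∈ LieAlgebra.center ℂ (GroupLieAlgebra 𝓘(ℂ, E) Gc) := by
      rw [LieModule.mem_maxTrivSubmodule]
      intro Y
      have h1 : adE (E := E) Gc Y X = 0 := by
        refine (adE_swap (E := E) (Gc := Gc) Y X).trans ?_
        rw [hX]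
        exact neg_zero
      exact (adE_apply Y X).symm.trans h1
    rwa [LieAlgebra.center_eq_bot, LieSubmodule.mem_bot] at hc
  exact fun X => h X

/-- Near `0`, the exponential map is obtained from `X ↦ exp (ad X)` by composing with a holomorphic
local inverse of a component of `Ad`, which exists because `ad` is injective. -/
theorem contMDiffAt_expE_zero : ContMDiffAt 𝓘(ℂ, E) 𝓘(ℂ, E) ω (expE (E := E) (Gc := Gc)) 0 := by
  obtain ⟨π', hπ'⟩ := LinearMap.exists_leftInverse_of_injective (adE (E := E) Gc).toLinearMap
    (LinearMap.ker_eq_bot.2 adE_injective)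
  set π : (E →L[ℂ] E) →L[ℂ] E := LinearMap.toContinuousLinearMap π' with hπ
  have hπ1 : π.comp (adE (E := E) Gc) = ContinuousLinearMap.id ℂ E := by
    ext X
    exact LinearMap.congr_fun hπ' X
  set c := extChartAt 𝓘(ℂ, E) (1 : Gc) with hc
  set o := c 1 with ho
  set F : E → E := fun x => π (AdE (E := E) (c.symm x)) with hF
  have hFc : ContDiffAt ℂ ω F o := π.contDiff.contDiffAt.comp o contDiffAt_AdE_symm
  have hFd : HasFDerivAt F (ContinuousLinearEquiv.refl ℂ E : E →L[ℂ] E) o := by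
    have h := π.hasFDerivAt.comp o (hasFDerivAt_AdE_symm (E := E) (Gc := Gc))
    rw [hπ1] at h
    exact h
  have hω : (ω : WithTop ℕ∞) ≠ 0 := by simp
  set e := hFc.toOpenPartialHomeomorph F hFd hω with he
  have heo : o ∈ e.source := hFc.mem_toOpenPartialHomeomorph_source hFd hω
  have heF : ∀ x, e x = F x := fun x => by
    rw [he, hFc.toOpenPartialHomeomorph_coe hFd hω]
  have hcs : c.symm o = 1 := extChartAt_to_inv (I := 𝓘(ℂ, E)) (1 : Gc)
  have hFo : π 1 = F o := by rw [hF]; simp only [hcs, AdE_one]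
  have hes : e.symm (π 1) = o := by rw [hFo, ← heF, e.left_inv heo]
  have hsymm : ContDiffAt ℂ ω e.symm (π 1) := by
    rw [hFo]; exact hFc.to_localInverse hFd hω
  set g : E → E := fun X => π (NormedSpace.exp (adE Gc X)) with hg
  have hgd : ContDiff ℂ ω g := by
    rw [contDiff_iff_contDiffAt]
    intro X
    exact π.contDiff.contDiffAt.comp X (ContDiffAt.comp X
      (NormedSpace.exp_analytic (𝕂 := ℂ) (adE (E := E) Gc X)).contDiffAt
      (ContinuousLinearMap.contDiff (adE (E := E) Gc)).contDiffAt)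
  have hg0 : g 0 = π 1 := by simp [hg]
  have hSd : ContMDiffAt 𝓘(ℂ, E) 𝓘(ℂ, E) ω (fun X => c.symm (e.symm (g X))) 0 := by
    have h1 : ContDiffAt ℂ ω (fun X => e.symm (g X)) 0 :=
      ContDiffAt.comp 0 (by rw [hg0]; exact hsymm) hgd.contDiffAt
    have h2 : ContMDiffAt 𝓘(ℂ, E) 𝓘(ℂ, E) ω c.symm (e.symm (g 0)) := by
      rw [hg0, hes]
      exact (contMDiffOn_extChartAt_symm (1 : Gc)).contMDiffAt (extChartAt_target_mem_nhds _)
    exact ContMDiffAt.comp (f := fun X => e.symm (g X)) 0 h2 h1.contMDiffAt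
  refine hSd.congr_of_eventuallyEq ?_
  -- `P` is a neighbourhood of `1` on which an element is determined by its adjoint action
  set P : Set Gc := c.source ∩ c ⁻¹' e.source with hP
  have hPo : IsOpen P := isOpen_extChartAt_preimage' (I := 𝓘(ℂ, E)) (1 : Gc) e.open_source
  have hPS : ∀ X : E, expE X ∈ P → expE X = c.symm (e.symm (g X)) := by
    intro X hX
    have h1 : g X = e (c (expE X)) := by
      rw [heF, hF, hg]
      simp only [c.left_inv hX.1, AdE_expE]
    rw [h1, e.left_inv hX.2, c.left_inv hX.1]
  have hgood : ∀ᶠ X in 𝓝 (0 : E), g X ∈ e.target ∩ e.symm ⁻¹' c.target := by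
    refine hgd.continuous.continuousAt.eventually_mem ?_
    refine IsOpen.mem_nhds ?_ ?_
    · exact e.symm.isOpen_inter_preimage (isOpen_extChartAt_target (I := 𝓘(ℂ, E)) (1 : Gc))
    · refine ⟨?_, ?_⟩
      · rw [hg0, hFo, ← heF]; exact e.map_source heo
      · rw [hg0, Set.mem_preimage, hes]; exact mem_extChartAt_target (I := 𝓘(ℂ, E)) (1 : Gc)
  obtain ⟨r, hr, hrg⟩ := Metric.eventually_nhds_iff_ball.1 hgood
  filter_upwards [Metric.ball_mem_nhds (0 : E) hr] with X hX
  have htX : ∀ t ∈ Set.Icc (0 : ℝ) 1, t • X ∈ Metric.ball (0 : E) r := by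
    intro t ht
    rw [mem_ball_zero_iff] at hX ⊢
    rw [norm_smul, Real.norm_of_nonneg ht.1]
    nlinarith [ht.2, norm_nonneg X, ht.1]
  have hSP : ∀ Y ∈ Metric.ball (0 : E) r, c.symm (e.symm (g Y)) ∈ P := by
    intro Y hY
    have h := hrg Y hY
    refine ⟨c.map_target h.2, ?_⟩
    rw [Set.mem_preimage, c.right_inv h.2]
    exact e.map_target h.1
  have hcont : ContinuousOn (fun t : ℝ => c.symm (e.symm (g (t • X)))) (Set.Icc 0 1) := by
    intro t ht
    have h := hrg _ (htX t ht)
    have h1 : ContinuousAt (fun t : ℝ => g (t • X)) t :=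
      (hgd.continuous.comp (continuous_id.smul continuous_const)).continuousAt
    have h2 : ContinuousAt (fun t : ℝ => e.symm (g (t • X))) t :=
      ContinuousAt.comp (f := fun t : ℝ => g (t • X)) (e.continuousAt_symm h.1) h1
    exact (ContinuousAt.comp (f := fun t : ℝ => e.symm (g (t • X)))
      (continuousAt_extChartAt_symm'' h.2) h2).continuousWithinAt
  -- the two curves in `t` agree on a closed set of times, open to the right by `hPS`
  have hsub : Set.Icc (0 : ℝ) 1 ⊆ {t | expE (t • X) = c.symm (e.symm (g (t • X)))} := by
    refine IsClosed.Icc_subset_of_forall_mem_nhdsWithin ?_ ?_ ?_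
    · rw [Set.inter_comm]
      exact ContinuousOn.preimage_isClosed_of_isClosed
        ((continuous_expE_smul (Gc := Gc) X).continuousOn.prodMk hcont) isClosed_Icc
        isClosed_diagonal
    · simp only [Set.mem_ofPred_eq, zero_smul, expE_zero, hg0, hes, hcs]
    · rintro t ⟨ht, ht'⟩
      have h1 : expE (t • X) ∈ P := by
        rw [show expE (t • X) = c.symm (e.symm (g (t • X))) from ht]
        exact hSP _ (htX t ⟨ht'.1, ht'.2.le⟩)
      have h2 := (continuous_expE_smul (Gc := Gc) X).continuousAt.eventually_mem
        (hPo.mem_nhds h1)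
      exact mem_nhdsWithin_of_mem_nhds (h2.mono fun s hs => hPS _ hs)
  have := hsub (Set.right_mem_Icc.2 zero_le_one)
  simpa only [Set.mem_ofPred_eq, one_smul] using this

/-- The exponential map is holomorphic, by `exp X = (exp (X / n)) ^ n` and its holomorphy near `0`.
-/
theorem contMDiff_expE : ContMDiff 𝓘(ℂ, E) 𝓘(ℂ, E) ω (expE (E := E) (Gc := Gc)) := by
  have h0 := (contMDiffAt_iff_contMDiffAt_nhds (by simp)).1
    (contMDiffAt_expE_zero (E := E) (Gc := Gc))
  obtain ⟨r, hr, hru⟩ := Metric.eventually_nhds_iff_ball.1 h0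
  intro X
  obtain ⟨n, hn⟩ := exists_nat_gt (‖X‖ / r)
  have hn0 : (0 : ℝ) < n := lt_of_le_of_lt (by positivity) hn
  have e : expE (E := E) (Gc := Gc) = (fun g => g ^ n) ∘ expE ∘ fun Y => ((n : ℂ)⁻¹) • Y := by
    ext1 Y
    have h : (n : ℝ) • ((n : ℂ)⁻¹ • Y) = Y := by
      have h2 : (n : ℂ) ≠ 0 := by exact_mod_cast hn0.ne'
      rw [← Complex.coe_smul, smul_smul]
      push_cast
      rw [mul_inv_cancel₀ h2, one_smul]
    rw [Function.comp_apply, Function.comp_apply, ← expE_nsmul, h]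
  have hmem : (n : ℂ)⁻¹ • X ∈ Metric.ball (0 : E) r := by
    rw [mem_ball_zero_iff, norm_smul, norm_inv, Complex.norm_natCast]
    rw [div_lt_iff₀ hr] at hn
    rw [inv_mul_lt_iff₀ hn0]
    linarith
  rw [e]
  have h1 : ContMDiffAt 𝓘(ℂ, E) 𝓘(ℂ, E) ω (expE (E := E) (Gc := Gc)) ((n : ℂ)⁻¹ • X) :=
    hru _ hmem
  have h2 : ContDiff ℂ ω (fun Y : E => ((n : ℂ)⁻¹) • Y) := contDiff_const_smul _
  exact (contMDiff_pow (I := 𝓘(ℂ, E)) (G := Gc) n).contMDiffAt.comp X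
    (ContMDiffAt.comp (f := fun Y : E => ((n : ℂ)⁻¹) • Y) X h1 h2.contMDiff.contMDiffAt)

end Semisimple

end T2

end Exponential

/-! ### Endomorphisms with purely imaginary eigenvalues -/

section Eigenspaces

variable {E : Type*} [AddCommGroup E] [Module ℂ E]

/-- The sum of the eigenspaces of `A` for the eigenvalues `i c` with `c > 0`. -/
def posPart (A : Module.End ℂ E) : Submodule ℂ E :=
  ⨆ c : {c : ℝ // 0 < c}, A.eigenspace (Complex.I * ((c : ℝ) : ℂ))

/-- The sum of the eigenspaces of `A` for the eigenvalues `i c` with `c ≤ 0`. -/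
def nonposPart (A : Module.End ℂ E) : Submodule ℂ E :=
  ⨆ c : {c : ℝ // c ≤ 0}, A.eigenspace (Complex.I * ((c : ℝ) : ℂ))

theorem iSupIndep_eigenspace_I_mul (A : Module.End ℂ E) :
    iSupIndep fun c : ℝ => A.eigenspace (Complex.I * (c : ℂ)) :=
  A.eigenspaces_iSupIndep.comp fun a b h => by simpa using h

theorem isCompl_posPart_nonposPart {A : Module.End ℂ E}
    (hA : ⨆ c : ℝ, A.eigenspace (Complex.I * (c : ℂ)) = ⊤) :
    IsCompl (posPart A) (nonposPart A) := by
  constructor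
  · have h := (iSupIndep_eigenspace_I_mul A).disjoint_biSup_biSup
      (s := {c : ℝ | 0 < c}) (t := {c : ℝ | c ≤ 0})
      (Set.disjoint_left.2 fun c (hc : 0 < c) (hc' : c ≤ 0) => not_lt.2 hc' hc)
    rw [iSup_subtype', iSup_subtype'] at h
    exact h
  · rw [codisjoint_iff, eq_top_iff, ← hA]
    refine iSup_le fun c => ?_
    rcases lt_or_ge 0 c with hc | hc
    · exact le_sup_of_le_left
        (le_iSup (fun c : {c : ℝ // 0 < c} => A.eigenspace (Complex.I * ((c : ℝ) : ℂ))) ⟨c, hc⟩)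
    · exact le_sup_of_le_right
        (le_iSup (fun c : {c : ℝ // c ≤ 0} => A.eigenspace (Complex.I * ((c : ℝ) : ℂ))) ⟨c, hc⟩)

theorem eigenspace_eq_bot_of_iSup_eq_top {A : Module.End ℂ E}
    (hA : ⨆ c : ℝ, A.eigenspace (Complex.I * (c : ℂ)) = ⊤) {μ : ℂ}
    (hμ : ∀ c : ℝ, μ ≠ Complex.I * c) : A.eigenspace μ = ⊥ := by
  have h := A.eigenspaces_iSupIndep μ
  have h2 : (⊤ : Submodule ℂ E) ≤ ⨆ ν, ⨆ (_ : ν ≠ μ), A.eigenspace ν := by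
    rw [← hA]
    exact iSup_le fun c => le_iSup₂_of_le (Complex.I * (c : ℂ)) (hμ c).symm le_rfl
  exact disjoint_top.1 (h.mono_right h2)

/-- An invariant subspace that meets the positive part trivially lies in the nonpositive part. -/
theorem le_nonposPart_of_disjoint [FiniteDimensional ℂ E] {A : Module.End ℂ E}
    (hA : ⨆ c : ℝ, A.eigenspace (Complex.I * (c : ℂ)) = ⊤) {N : Submodule ℂ E}
    (hN : ∀ x ∈ N, A x ∈ N) (hd : Disjoint N (posPart A)) : N ≤ nonposPart A := by
  have htop : ⨆ μ, A.genEigenspace μ 1 = ⊤ := by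
    rw [eq_top_iff, ← hA]
    exact iSup_le fun c => le_iSup (fun μ => A.eigenspace μ) _
  rw [Submodule.eq_iSup_inf_genEigenspace (f := A) (p := N) 1 hN htop]
  refine iSup_le fun μ => ?_
  change N ⊓ A.eigenspace μ ≤ _
  by_cases h : ∃ c : ℝ, μ = Complex.I * c
  · obtain ⟨c, rfl⟩ := h
    rcases lt_or_ge 0 c with hc | hc
    · have h1 : A.eigenspace (Complex.I * (c : ℂ)) ≤ posPart A :=
        le_iSup (fun c : {c : ℝ // 0 < c} => A.eigenspace (Complex.I * ((c : ℝ) : ℂ))) ⟨c, hc⟩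
      rw [(hd.mono_right h1).eq_bot]
      exact bot_le
    · exact inf_le_right.trans
        (le_iSup (fun c : {c : ℝ // c ≤ 0} => A.eigenspace (Complex.I * ((c : ℝ) : ℂ))) ⟨c, hc⟩)
  · rw [eigenspace_eq_bot_of_iSup_eq_top hA (not_exists.1 h), inf_bot_eq]
    exact bot_le

theorem posPart_induction {A : Module.End ℂ E} {p : E → Prop}
    (hmem : ∀ (c : ℝ) (x : E), 0 < c → A x = (Complex.I * c) • x → p x) (h0 : p 0)
    (hadd : ∀ x y, p x → p y → p (x + y)) {x : E} (hx : x ∈ posPart A) : p x :=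
  Submodule.iSup_induction _ (motive := p) hx
    (fun c x hx => hmem c x c.2 (Module.End.mem_eigenspace_iff.1 hx)) h0 hadd

theorem nonposPart_induction {A : Module.End ℂ E} {p : E → Prop}
    (hmem : ∀ (c : ℝ) (x : E), c ≤ 0 → A x = (Complex.I * c) • x → p x) (h0 : p 0)
    (hadd : ∀ x y, p x → p y → p (x + y)) {x : E} (hx : x ∈ nonposPart A) : p x :=
  Submodule.iSup_induction _ (motive := p) hx
    (fun c x hx => hmem c x c.2 (Module.End.mem_eigenspace_iff.1 hx)) h0 hadd

theorem mem_posPart {A : Module.End ℂ E} {c : ℝ} {x : E} (hc : 0 < c)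
    (hx : A x = (Complex.I * c) • x) : x ∈ posPart A :=
  Submodule.mem_iSup_of_mem (p := fun c : {c : ℝ // 0 < c} =>
    A.eigenspace (Complex.I * ((c : ℝ) : ℂ))) ⟨c, hc⟩ (Module.End.mem_eigenspace_iff.2 hx)

theorem mem_nonposPart {A : Module.End ℂ E} {c : ℝ} {x : E} (hc : c ≤ 0)
    (hx : A x = (Complex.I * c) • x) : x ∈ nonposPart A :=
  Submodule.mem_iSup_of_mem (p := fun c : {c : ℝ // c ≤ 0} =>
    A.eigenspace (Complex.I * ((c : ℝ) : ℂ))) ⟨c, hc⟩ (Module.End.mem_eigenspace_iff.2 hx)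

end Eigenspaces

section ExpInvariant

variable {E : Type*} [NormedAddCommGroup E] [NormedSpace ℂ E] [CompleteSpace E]

theorem hasSum_exp_apply (B : E →L[ℂ] E) (x : E) :
    HasSum (fun n : ℕ => ((n.factorial : ℂ)⁻¹) • (B ^ n) x) (NormedSpace.exp B x) := by
  have h := NormedSpace.exp_series_hasSum_exp' (𝕂 := ℂ) B
  exact (h.mapL (ContinuousLinearMap.apply ℂ E x)).congr_fun fun n => rfl

theorem exp_apply_of_eigenvector {B : E →L[ℂ] E} {x : E} {μ : ℂ} (h : B x = μ • x) :
    NormedSpace.exp B x = Complex.exp μ • x := by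
  have hn : ∀ n : ℕ, (B ^ n) x = μ ^ n • x := by
    intro n
    induction n with
    | zero => simp
    | succ n ih => rw [pow_succ, mul_apply_eq_comp, h, map_smul, ih, smul_smul, pow_succ,
        mul_comm]
  have h1 := hasSum_exp_apply B x
  have h2 : HasSum (fun n : ℕ => ((n.factorial : ℂ)⁻¹) • μ ^ n) (Complex.exp μ) := by
    rw [Complex.exp_eq_exp_ℂ]
    exact NormedSpace.exp_series_hasSum_exp' (𝕂 := ℂ) μ
  have h3 := h2.smul_const x
  refine h1.unique (h3.congr_fun fun n => ?_)
  rw [hn, smul_eq_mul, smul_smul]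

/-- `exp B x - x` is a limit of sums of the vectors `B ^ n (B x)`. -/
theorem exp_apply_sub_mem {B : E →L[ℂ] E} {W : Submodule ℂ E} (hW : IsClosed (W : Set E))
    (hB : ∀ w ∈ W, B w ∈ W) {x : E} (hx : B x ∈ W) : NormedSpace.exp B x - x ∈ W := by
  have h := ((hasSum_exp_apply B x).tendsto_sum_nat.comp (Filter.tendsto_add_atTop_nat 1)).sub_const
    x
  refine hW.mem_of_tendsto h (Filter.Eventually.of_forall fun N => ?_)
  simp only [Function.comp_apply]
  rw [Finset.sum_range_succ']
  simp only [Nat.factorial_zero, Nat.cast_one, inv_one, pow_zero, one_smul,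
    one_apply_eq_self, add_sub_cancel_right]
  refine Submodule.sum_mem _ fun n hn => Submodule.smul_mem _ _ ?_
  clear hn
  rw [pow_succ, mul_apply_eq_comp]
  generalize B x = y at hx
  induction n with
  | zero => simpa using hx
  | succ n ih => rw [pow_succ', mul_apply_eq_comp]; exact hB _ ih

theorem exp_apply_mem {B : E →L[ℂ] E} {W : Submodule ℂ E} (hW : IsClosed (W : Set E))
    (hB : ∀ w ∈ W, B w ∈ W) {x : E} (hx : x ∈ W) : NormedSpace.exp B x ∈ W := by
  have h := W.add_mem (exp_apply_sub_mem hW hB (hB x hx)) hx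
  rwa [sub_add_cancel] at h

end ExpInvariant

section Contraction

open Filter

/-- A holomorphic map that is locally invertible at the origin and commutes with a linear flow
contracting to the origin is globally invertible. -/
theorem exists_inverse_of_contraction {X : Type*} [NormedAddCommGroup X] [NormedSpace ℂ X]
    [CompleteSpace X] {Φ : X → X} (hΦ : ContDiffAt ℂ ω Φ 0) (h0 : Φ 0 = 0) (A : X ≃L[ℂ] X)
    (hA : HasFDerivAt Φ (A : X →L[ℂ] X) 0) (τ : ℝ → X →L[ℂ] X)
    (hτ : ∀ s x, τ (-s) (τ s x) = x) (hτ0 : ∀ x, Tendsto (fun s => τ s x) atTop (𝓝 0))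
    (hΦτ : ∀ s x, Φ (τ s x) = τ s (Φ x)) :
    ∃ Ψ : X → X, Differentiable ℂ Ψ ∧ (∀ x, Ψ (Φ x) = x) ∧ ∀ y, Φ (Ψ y) = y := by
  have hω : (ω : WithTop ℕ∞) ≠ 0 := by simp
  set e := hΦ.toOpenPartialHomeomorph Φ hA hω with he
  have heΦ : ∀ x, e x = Φ x := fun x => by rw [he, hΦ.toOpenPartialHomeomorph_coe hA hω]
  have hes : e.source ∈ 𝓝 (0 : X) :=
    e.open_source.mem_nhds (hΦ.mem_toOpenPartialHomeomorph_source hA hω)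
  have het : e.target ∈ 𝓝 (0 : X) := by
    have h := e.open_target.mem_nhds
      (e.map_source (hΦ.mem_toOpenPartialHomeomorph_source hA hω))
    rwa [heΦ, h0] at h
  have hsymm : ∀ᶠ y in 𝓝 (0 : X), ContDiffAt ℂ ω e.symm y := by
    have h : ContDiffAt ℂ ω e.symm (Φ 0) := hΦ.to_localInverse hA hω
    rw [h0] at h
    exact h.eventually (by simp)
  have hτ' : ∀ s x, τ s (τ (-s) x) = x := fun s x => by
    have := hτ (-s) x; rwa [neg_neg] at this
  have hinj : Function.Injective Φ := by
    intro x y hxy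
    obtain ⟨s, hsx, hsy⟩ := ((hτ0 x).eventually_mem hes |>.and ((hτ0 y).eventually_mem hes)).exists
    have h : τ s x = τ s y := e.injOn hsx hsy (by rw [heΦ, heΦ, hΦτ, hΦτ, hxy])
    rw [← hτ s x, h, hτ]
  have hright : ∀ s y, τ s y ∈ e.target → Φ (τ (-s) (e.symm (τ s y))) = y := by
    intro s y hs
    rw [hΦτ, ← heΦ, e.right_inv hs, hτ]
  have hsurj : Function.Surjective Φ := by
    intro y
    obtain ⟨s, hs⟩ := ((hτ0 y).eventually_mem het).exists
    exact ⟨_, hright s y hs⟩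
  obtain ⟨Ψ, hΨ⟩ := hsurj.hasRightInverse
  refine ⟨Ψ, fun y => ?_, fun x => hinj (hΨ _), hΨ⟩
  obtain ⟨s, hs, hd⟩ := (((hτ0 y).eventually_mem het).and ((hτ0 y).eventually hsymm)).exists
  have hev : Ψ =ᶠ[𝓝 y] fun y => τ (-s) (e.symm (τ s y)) := by
    filter_upwards [(τ s).continuous.continuousAt.eventually_mem (e.open_target.mem_nhds hs)]
      with z hz
    exact hinj ((hΨ z).trans (hright s z hz).symm)
  refine DifferentiableAt.congr_of_eventuallyEq ?_ hev
  exact (τ (-s)).differentiableAt.comp y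
    ((hd.differentiableAt hω).comp y (τ s).differentiableAt)

end Contraction

/-! ### Transversality of a moving subspace to a fixed one -/

section Transversality

variable {E : Type*} [NormedAddCommGroup E] [NormedSpace ℂ E] [FiniteDimensional ℂ E]

theorem contDiff_det {n : WithTop ℕ∞} : ContDiff ℂ n fun A : E →L[ℂ] E => A.det := by
  let b := Module.finBasis ℂ E
  have e : (fun A : E →L[ℂ] E => A.det) = fun A : E →L[ℂ] E =>
      ∑ σ : Equiv.Perm (Fin (Module.finrank ℂ E)),
        ((Equiv.Perm.sign σ : ℤ) : ℂ) * ∏ i, b.coord (σ i) (A (b i)) := by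
    ext A
    rw [ContinuousLinearMap.det, ← LinearMap.det_toMatrix b, Matrix.det_apply']
    simp [LinearMap.toMatrix_apply]
  rw [e]
  refine ContDiff.sum fun σ _ => contDiff_const.mul (contDiff_prod fun i _ => ?_)
  exact (LinearMap.toContinuousLinearMap (b.coord (σ i))).contDiff.comp
    (ContinuousLinearMap.apply ℂ E (b i)).contDiff

/-- If `E = u ⊕ q`, the condition that `A q` be transversal to `u` is the nonvanishing of a
holomorphic function of `A`, and the point of `u` where `A q` meets the translate `T + u` then
depends holomorphically on `A`. -/
theorem exists_transversality_function {u q : Submodule ℂ E} (huq : IsCompl u q) (T : E) :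
    ∃ (d : (E →L[ℂ] E) → ℂ) (a : (E →L[ℂ] E) → u), ContDiff ℂ ω d ∧
      (∀ A, d A ≠ 0 → ContDiffAt ℂ ω a A) ∧
      (∀ A, d A ≠ 0 ↔ ∀ w ∈ q, A w ∈ u → w = 0) ∧
      ∀ A, d A ≠ 0 → ∃ w ∈ q, A w = T + a A := by
  -- `B A` is `A` on `q` and the identity on `u`; it is invertible exactly when `A q` and `u` are
  -- transversal, and `(B A)⁻¹ T = w + v` means that `A w = T - v`
  let P : E →L[ℂ] u := LinearMap.toContinuousLinearMap (u.projectionOnto q huq)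
  have hPu : ∀ x : u, P x = x := fun x => Submodule.projectionOnto_apply_left huq x
  have hPq : ∀ x ∈ q, P x = 0 := fun x hx => (Submodule.projectionOnto_apply_eq_zero_iff huq).2 hx
  have hPs : ∀ x, x - P x ∈ q := fun x => Submodule.sub_projection_mem huq x
  let P' : E →L[ℂ] E := u.subtypeL.comp P
  let B : (E →L[ℂ] E) → (E →L[ℂ] E) := fun A => A.comp (1 - P') + P'
  have hBv : ∀ A v, B A v = A (v - P v) + P v := fun A v => rfl
  have hB : ContDiff ℂ ω B := (contDiff_id.clm_comp contDiff_const).add contDiff_const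
  have hdet : ∀ A, (B A).det ≠ 0 ↔ ∀ w ∈ q, A w ∈ u → w = 0 := by
    intro A
    constructor
    · intro hd w hw hAw
      have hinj := ((B A).toContinuousLinearEquivOfDetNeZero hd).injective
      have h1 : B A (w - A w) = 0 := by
        have h2 : P (w - A w) = -⟨A w, hAw⟩ := by
          rw [map_sub, hPq w hw, hPu ⟨A w, hAw⟩, zero_sub]
        rw [hBv, h2]
        simp
      have h3 : w - A w = 0 := hinj (by
        rw [ContinuousLinearMap.toContinuousLinearEquivOfDetNeZero_apply, h1, map_zero])
      have h4 : w ∈ u := by rw [sub_eq_zero.1 h3]; exact hAw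
      exact Submodule.disjoint_def.1 huq.disjoint w h4 hw
    · intro h hd
      obtain ⟨v, hv, hv0⟩ := (Submodule.ne_bot_iff _).1
        (LinearMap.bot_lt_ker_of_det_eq_zero hd).ne'
      have h1 : A (v - P v) + P v = 0 := hv
      have h2 : v - P v = 0 := h _ (hPs v) (by
        rw [eq_neg_of_add_eq_zero_left h1]; exact u.neg_mem (P v).2)
      rw [h2, map_zero, zero_add] at h1
      exact hv0 (by rw [sub_eq_zero.1 h2, h1])
  refine ⟨fun A => (B A).det, fun A => -P ((B A).inverse T), contDiff_det.comp hB, ?_, hdet, ?_⟩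
  · intro A hA
    have h1 : ContDiffAt ℂ ω ContinuousLinearMap.inverse (B A) := by
      have h := contDiffAt_map_inverse (n := ω) ((B A).toContinuousLinearEquivOfDetNeZero hA)
      rwa [ContinuousLinearMap.coe_toContinuousLinearEquivOfDetNeZero] at h
    have h2 : ContDiffAt ℂ ω (fun A => (B A).inverse) A := h1.comp A hB.contDiffAt
    exact (P.contDiff.contDiffAt.comp A (h2.clm_apply contDiffAt_const)).neg
  · intro A hA
    have h1 : B A ((B A).inverse T) = T := by
      have h := ContinuousLinearMap.inverse_equiv ((B A).toContinuousLinearEquivOfDetNeZero hA)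
      rw [ContinuousLinearMap.coe_toContinuousLinearEquivOfDetNeZero] at h
      rw [h, ← ContinuousLinearMap.toContinuousLinearEquivOfDetNeZero_apply (B A) hA]
      exact ContinuousLinearEquiv.apply_symm_apply _ _
    refine ⟨_, hPs ((B A).inverse T), ?_⟩
    rw [hBv] at h1
    rw [eq_sub_of_add_eq h1]
    simp [sub_eq_add_neg]

end Transversality

/-! ### The grading defined by an elliptic element, and the big cell -/

section BigCell

open Filter

variable {E : Type*} [NormedAddCommGroup E] [NormedSpace ℂ E]
  {Gc : Type*} [TopologicalSpace Gc] [ChartedSpace E Gc] [Group Gc] [LieGroup 𝓘(ℂ, E) ω Gc]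

variable (Gc) in
/-- The nilpotent subalgebra `𝔲⁺`, as a subspace of the model space. -/
def uE (T : E) : Submodule ℂ E := posPart (adE (E := E) Gc T).toLinearMap

variable (Gc) in
/-- The parabolic subalgebra `𝔮⁻`, as a subspace of the model space. -/
def qE (T : E) : Submodule ℂ E := nonposPart (adE (E := E) Gc T).toLinearMap

variable (Gc) in
/-- The model space is the sum of the eigenspaces `𝔤^c` of `ad T`. -/
def IsGraded (T : E) : Prop :=
  ⨆ c : ℝ, Module.End.eigenspace (adE (E := E) Gc T).toLinearMap (Complex.I * (c : ℂ)) = ⊤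

variable [CompleteSpace E]

theorem ad_eq_adE (T : GroupLieAlgebra 𝓘(ℂ, E) Gc) :
    LieAlgebra.ad ℂ (GroupLieAlgebra 𝓘(ℂ, E) Gc) T = (adE (E := E) Gc T).toLinearMap :=
  LinearMap.ext fun X => (adE_apply T X).symm

theorem mem_uPlus_iff {T X : GroupLieAlgebra 𝓘(ℂ, E) Gc} : X ∈ uPlus T ↔ X ∈ uE (E := E) Gc T := by
  have h : uPlus T = posPart (LieAlgebra.ad ℂ (GroupLieAlgebra 𝓘(ℂ, E) Gc) T) := rfl
  rw [h, ad_eq_adE]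
  rfl

theorem mem_qMinus_iff {T X : GroupLieAlgebra 𝓘(ℂ, E) Gc} :
    X ∈ qMinus T ↔ X ∈ qE (E := E) Gc T := by
  have h : qMinus T = nonposPart (LieAlgebra.ad ℂ (GroupLieAlgebra 𝓘(ℂ, E) Gc) T) := rfl
  rw [h, ad_eq_adE]
  rfl

theorem adE_eigen {T X Y : E} {c d : ℝ} (hX : adE Gc T X = (Complex.I * c) • X)
    (hY : adE Gc T Y = (Complex.I * d) • Y) :
    adE Gc T (adE Gc X Y) = (Complex.I * ((c + d : ℝ) : ℂ)) • adE Gc X Y := by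
  rw [adE_leibniz, hX, hY, map_smul, map_smul, smul_apply, ← add_smul]
  push_cast
  rw [mul_add]

theorem adE_mem_uE {T X Y : E} (hX : X ∈ uE Gc T) (hY : Y ∈ uE Gc T) : adE Gc X Y ∈ uE Gc T := by
  refine posPart_induction (p := fun X => adE Gc X Y ∈ uE Gc T) (fun c X hc hX => ?_) ?_ ?_ hX
  · refine posPart_induction (p := fun Y => adE Gc X Y ∈ uE Gc T) (fun d Y hd hY => ?_) ?_ ?_ hY
    · exact mem_posPart (add_pos hc hd) (adE_eigen hX hY)
    · rw [map_zero]; exact Submodule.zero_mem _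
    · intro Y Z h1 h2
      rw [map_add]; exact Submodule.add_mem _ h1 h2
  · rw [map_zero]; exact Submodule.zero_mem _
  · intro Z W h1 h2
    rw [map_add]; exact Submodule.add_mem _ h1 h2

theorem adE_mem_qE {T X Y : E} (hX : X ∈ qE Gc T) (hY : Y ∈ qE Gc T) : adE Gc X Y ∈ qE Gc T := by
  refine nonposPart_induction (p := fun X => adE Gc X Y ∈ qE Gc T) (fun c X hc hX => ?_) ?_ ?_ hX
  · refine nonposPart_induction (p := fun Y => adE Gc X Y ∈ qE Gc T) (fun d Y hd hY => ?_) ?_ ?_ hY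
    · exact mem_nonposPart (add_nonpos hc hd) (adE_eigen hX hY)
    · rw [map_zero]; exact Submodule.zero_mem _
    · intro Y Z h1 h2
      rw [map_add]; exact Submodule.add_mem _ h1 h2
  · rw [map_zero]; exact Submodule.zero_mem _
  · intro Z W h1 h2
    rw [map_add]; exact Submodule.add_mem _ h1 h2

theorem self_mem_qE (T : E) : T ∈ qE Gc T := by
  refine mem_nonposPart (c := 0) le_rfl ?_
  simpa using adE_self (Gc := Gc) T

theorem adE_self_mem_uE {T X : E} (hX : X ∈ uE Gc T) : adE Gc T X ∈ uE Gc T := by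
  refine posPart_induction (p := fun X => adE Gc T X ∈ uE Gc T) (fun c X hc hX => ?_) ?_ ?_ hX
  · rw [show adE Gc T X = _ from hX]
    exact Submodule.smul_mem _ _ (mem_posPart hc hX)
  · rw [map_zero]; exact Submodule.zero_mem _
  · intro Y Z h1 h2
    rw [map_add]; exact Submodule.add_mem _ h1 h2

variable [T2Space Gc] [FiniteDimensional ℂ E]

theorem mem_QMinus_iff_qE {T : E} {x : Gc} :
    x ∈ QMinus (E := E) (Gc := Gc) T ↔ ∀ X ∈ qE Gc T, AdE (E := E) x X ∈ qE Gc T := by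
  refine (mem_QMinus_iff (E := E) (Gc := Gc) T x).trans ?_
  exact forall_congr' fun X => imp_congr mem_qMinus_iff mem_qMinus_iff

theorem AdE_expE_mem_uE {T z w : E} (hz : z ∈ uE Gc T) (hw : w ∈ uE Gc T) :
    AdE (expE (Gc := Gc) z) w ∈ uE Gc T := by
  rw [AdE_expE]
  exact exp_apply_mem (Submodule.closed_of_finiteDimensional _) (fun _ h => adE_mem_uE hz h) hw

theorem AdE_expE_sub_mem_uE {T z : E} (hz : z ∈ uE Gc T) :
    AdE (expE (Gc := Gc) z) T - T ∈ uE Gc T := by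
  rw [AdE_expE]
  refine exp_apply_sub_mem (Submodule.closed_of_finiteDimensional _)
    (fun _ h => adE_mem_uE hz h) ?_
  rw [adE_swap]
  exact Submodule.neg_mem _ (adE_self_mem_uE hz)

theorem AdE_expE_mem_qE {T z w : E} (hz : z ∈ qE Gc T) (hw : w ∈ qE Gc T) :
    AdE (expE (Gc := Gc) z) w ∈ qE Gc T := by
  rw [AdE_expE]
  exact exp_apply_mem (Submodule.closed_of_finiteDimensional _) (fun _ h => adE_mem_qE hz h) hw

theorem AdE_expE_smul_of_eigenvector {T X : E} {c : ℝ} (h : adE Gc T X = (Complex.I * c) • X)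
    (a : ℂ) : AdE (expE (Gc := Gc) (a • T)) X = Complex.exp (a * (Complex.I * c)) • X := by
  rw [AdE_expE]
  refine exp_apply_of_eigenvector ?_
  rw [map_smul, smul_apply, h, smul_smul]

theorem AdE_expE_smul_self (T : E) (a : ℂ) : AdE (expE (Gc := Gc) (a • T)) T = T := by
  have h : adE Gc T T = (Complex.I * (0 : ℝ)) • T := by simpa using adE_self (Gc := Gc) T
  simpa using AdE_expE_smul_of_eigenvector h a

theorem AdE_expE_smul_mem_uE {T X : E} (a : ℂ) (hX : X ∈ uE Gc T) :
    AdE (expE (Gc := Gc) (a • T)) X ∈ uE Gc T := by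
  rw [AdE_expE]
  refine exp_apply_mem (Submodule.closed_of_finiteDimensional _) (fun w hw => ?_) hX
  rw [map_smul]
  exact Submodule.smul_mem _ _ (adE_self_mem_uE hw)

variable (Gc) in
/-- The action of `exp (a T)` on `𝔲⁺`. -/
def torusAction (T : E) (a : ℂ) : uE Gc T →L[ℂ] uE Gc T :=
  ((AdE (expE (Gc := Gc) (a • T))).comp (uE Gc T).subtypeL).codRestrict (uE Gc T)
    fun X => AdE_expE_smul_mem_uE a X.2

theorem coe_torusAction (T : E) (a : ℂ) (X : uE Gc T) :
    ((torusAction Gc T a X : uE Gc T) : E) = AdE (expE (Gc := Gc) (a • T)) (X : E) := rfl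

theorem expE_torusAction (T : E) (a : ℂ) (X : uE Gc T) :
    expE (Gc := Gc) ((torusAction Gc T a X : uE Gc T) : E) =
      expE (a • T) * expE (X : E) * (expE (a • T))⁻¹ :=
  (conj_expE _ _).symm

/-- The orbit map `z ↦ Ad (exp z) T - T` of `𝔲⁺` is a biholomorphic map of `𝔲⁺` onto itself. -/
theorem exists_orbitMap_inverse {T : E} (hT : IsGraded Gc T) :
    ∃ Ψ : uE Gc T → uE Gc T, Differentiable ℂ Ψ ∧
      (∀ z : uE Gc T, Ψ ⟨AdE (expE (Gc := Gc) (z : E)) T - T, AdE_expE_sub_mem_uE z.2⟩ = z) ∧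
      ∀ y : uE Gc T, AdE (expE (Gc := Gc) (Ψ y : E)) T = T + y := by
  have huq : IsCompl (uE Gc T) (qE Gc T) := isCompl_posPart_nonposPart hT
  let P : E →L[ℂ] uE Gc T := LinearMap.toContinuousLinearMap ((uE Gc T).projectionOnto _ huq)
  have hP : ∀ (x : E) (hx : x ∈ uE Gc T), P x = ⟨x, hx⟩ := fun x hx =>
    Submodule.projectionOnto_apply_left huq ⟨x, hx⟩
  let Φ : uE Gc T → uE Gc T := fun z =>
    ⟨AdE (expE (Gc := Gc) (z : E)) T - T, AdE_expE_sub_mem_uE z.2⟩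
  have hΦ : Φ = fun z : uE Gc T => P (NormedSpace.exp (adE Gc (z : E)) T - T) := by
    ext1 z
    have h : NormedSpace.exp (adE Gc (z : E)) T - T ∈ uE Gc T := by
      rw [← AdE_expE]; exact AdE_expE_sub_mem_uE z.2
    rw [hP _ h]
    exact Subtype.ext (by simp only [Φ, AdE_expE])
  have hΦd : ContDiffAt ℂ ω Φ 0 := by
    rw [hΦ]
    have h1 : ContDiffAt ℂ ω (fun z : uE Gc T => adE (E := E) Gc (z : E)) 0 :=
      ((adE (E := E) Gc).comp (uE Gc T).subtypeL).contDiff.contDiffAt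
    have h2 : ContDiffAt ℂ ω (fun z : uE Gc T => NormedSpace.exp (adE Gc (z : E))) 0 :=
      ContDiffAt.comp (0 : uE Gc T) (NormedSpace.exp_analytic (𝕂 := ℂ) _).contDiffAt h1
    exact P.contDiff.contDiffAt.comp 0 ((h2.clm_apply contDiffAt_const).sub contDiffAt_const)
  -- the derivative of `Φ` at `0` is `- ad T`, which is injective on `𝔲⁺`
  let A : uE Gc T →ₗ[ℂ] uE Gc T :=
    (-(adE (E := E) Gc T).toLinearMap).restrict (p := uE Gc T) (q := uE Gc T)
      fun X hX => Submodule.neg_mem _ (adE_self_mem_uE hX)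
  have hAinj : Function.Injective A := by
    rw [injective_iff_map_eq_zero]
    intro z hz
    have h1 : -adE Gc T (z : E) = 0 := congrArg Subtype.val hz
    have h2 : (z : E) ∈ qE Gc T := mem_nonposPart (c := 0) le_rfl (by
      simpa using neg_eq_zero.1 h1)
    exact Subtype.ext (Submodule.disjoint_def.1 huq.disjoint _ z.2 h2)
  let A' : uE Gc T ≃L[ℂ] uE Gc T :=
    (LinearEquiv.ofInjectiveEndo A hAinj).toContinuousLinearEquiv
  have hA' : ∀ z, (A' z : E) = -adE Gc T (z : E) := fun z => rfl
  have hΦA : HasFDerivAt Φ (A' : uE Gc T →L[ℂ] uE Gc T) 0 := by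
    rw [hΦ]
    have h1 : HasFDerivAt (fun z : uE Gc T => adE (E := E) Gc (z : E))
        ((adE (E := E) Gc).comp (uE Gc T).subtypeL) 0 :=
      ((adE (E := E) Gc).comp (uE Gc T).subtypeL).hasFDerivAt
    have h2 : HasFDerivAt (NormedSpace.exp : (E →L[ℂ] E) → (E →L[ℂ] E))
        (1 : (E →L[ℂ] E) →L[ℂ] (E →L[ℂ] E)) (adE (E := E) Gc ((0 : uE Gc T) : E)) := by
      rw [ZeroMemClass.coe_zero, map_zero]; exact hasFDerivAt_exp_zero
    have h3 := h2.comp (0 : uE Gc T) h1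
    have h4 := (ContinuousLinearMap.apply ℂ E T).hasFDerivAt.comp (0 : uE Gc T) h3
    have h5 := P.hasFDerivAt.comp (0 : uE Gc T) (h4.sub_const T)
    refine h5.congr_fderiv ?_
    ext1 z
    change P (adE Gc (z : E) T) = A' z
    have h6 : adE Gc (z : E) T = A' z := by rw [hA', adE_swap]
    rw [h6, hP _ (A' z).2]
  have hΦ0 : Φ 0 = 0 := Subtype.ext (by
    change AdE (expE (Gc := Gc) (0 : E)) T - T = 0
    rw [expE_zero, AdE_one]; exact sub_self T)
  -- `exp (i s T)` acts on `𝔤^c` by `exp (- s c)`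
  let τ : ℝ → uE Gc T →L[ℂ] uE Gc T := fun s => torusAction Gc T (s * Complex.I)
  have hτneg : ∀ s x, τ (-s) (τ s x) = x := by
    intro s x
    refine Subtype.ext ?_
    have e : (((-s : ℝ) : ℂ) * Complex.I) • T = -(((s : ℂ) * Complex.I) • T) := by
      rw [← neg_smul]; push_cast; ring_nf
    simp only [τ, coe_torusAction]
    rw [e, expE_neg, AdE_inv_apply_apply]
  have hτ0 : ∀ x, Tendsto (fun s => τ s x) atTop (𝓝 0) := by
    rintro ⟨x, hx⟩
    rw [tendsto_subtype_rng]
    refine posPart_induction (p := fun x => Tendsto (fun s : ℝ =>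
      AdE (expE (Gc := Gc) (((s : ℂ) * Complex.I) • T)) x) atTop (𝓝 0)) ?_ ?_ ?_ hx
    · intro c X hc hX
      have h : ∀ s : ℝ, AdE (expE (Gc := Gc) (((s : ℂ) * Complex.I) • T)) X
          = Real.exp (-(s * c)) • X := fun s => by
        rw [AdE_expE_smul_of_eigenvector hX, ← Complex.coe_smul, Complex.ofReal_exp]
        congr 2
        push_cast
        linear_combination (s : ℂ) * c * Complex.I_mul_I
      simp_rw [h]
      have h2 : Tendsto (fun s : ℝ => Real.exp (-(s * c))) atTop (𝓝 0) :=
        Real.tendsto_exp_neg_atTop_nhds_zero.comp (tendsto_id.atTop_mul_const hc)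
      simpa using h2.smul_const X
    · simp
    · intro X Y h1 h2
      simpa using h1.add h2
  have hΦτ : ∀ s x, Φ (τ s x) = τ s (Φ x) := by
    intro s x
    refine Subtype.ext ?_
    have h1 : ∀ Y : uE Gc T, (Φ Y : E) = AdE (expE (Gc := Gc) (Y : E)) T - T := fun _ => rfl
    simp only [h1, τ, coe_torusAction]
    rw [map_sub (AdE (E := E) (expE (Gc := Gc) (((s : ℂ) * Complex.I) • T)))]
    rw [← conj_expE, AdE_mul_apply, AdE_mul_apply, AdE_expE_smul_self, ← expE_neg, ← neg_smul,
      AdE_expE_smul_self]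
  obtain ⟨Ψ, hΨd, hΨ1, hΨ2⟩ := exists_inverse_of_contraction hΦd hΦ0 A' hΦA τ hτneg hτ0 hΦτ
  refine ⟨Ψ, hΨd, hΨ1, fun y => ?_⟩
  have h : AdE (expE (Gc := Gc) (Ψ y : E)) T - T = y := congrArg Subtype.val (hΨ2 y)
  rw [← h]; abel

/-- The big cell `U⁺ Q⁻`: it is the set where a holomorphic function `h` does not vanish, and the
factorization `x = exp (K x) q` of its elements is holomorphic in `x`. -/
theorem exists_bigCell_coordinates {T : E} (hT : IsGraded Gc T) :
    ∃ (h : Gc → ℂ) (K : Gc → uE Gc T),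
      MDifferentiable 𝓘(ℂ, E) 𝓘(ℂ, ℂ) h ∧
      (∀ x, h x ≠ 0 → MDifferentiableAt 𝓘(ℂ, E) 𝓘(ℂ, uE Gc T) K x) ∧
      (∀ x, h x ≠ 0 → (expE (E := E) (K x : E))⁻¹ * x ∈ QMinus (E := E) (Gc := Gc) T) ∧
      (∀ z : uE Gc T, h (expE (z : E)) ≠ 0 ∧ K (expE (z : E)) = z) ∧
      ∀ x, ∀ q ∈ QMinus (E := E) (Gc := Gc) T,
        (h (x * q) ≠ 0 ↔ h x ≠ 0) ∧ (h x ≠ 0 → K (x * q) = K x) := by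
  have huq : IsCompl (uE Gc T) (qE Gc T) := isCompl_posPart_nonposPart hT
  obtain ⟨d, a, hd, ha, hdiff, hmeet⟩ := exists_transversality_function huq T
  obtain ⟨Ψ, hΨd, hΨ1, hΨ2⟩ := exists_orbitMap_inverse (Gc := Gc) (T := T) hT
  -- the intersection point is unique
  have huniq : ∀ (A : E →L[ℂ] E) (y : uE Gc T), d A ≠ 0 → (∃ w ∈ qE Gc T, A w = T + y) →
      a A = y := by
    rintro A y hA ⟨w, hw, hwy⟩
    obtain ⟨w', hw', hwa⟩ := hmeet A hA
    have h1 : A (w' - w) ∈ uE Gc T := by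
      rw [map_sub, hwy, hwa, add_sub_add_left_eq_sub]
      exact Submodule.sub_mem _ (a A).2 y.2
    have h2 := (hdiff A).1 hA _ (Submodule.sub_mem _ hw' hw) h1
    rw [sub_eq_zero.1 h2, hwy] at hwa
    exact Subtype.ext (add_left_cancel hwa).symm
  have hQ : ∀ q ∈ QMinus (E := E) (Gc := Gc) T, ∀ w ∈ qE Gc T, AdE (E := E) q w ∈ qE Gc T :=
    fun q hq => mem_QMinus_iff_qE.1 hq
  have hinv : ∀ x, ∀ q ∈ QMinus (E := E) (Gc := Gc) T, d (AdE x) ≠ 0 → d (AdE (x * q)) ≠ 0 := by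
    intro x q hq hx
    rw [hdiff] at hx ⊢
    intro w hw hxw
    rw [AdE_mul_apply] at hxw
    have h := hx _ (hQ q hq w hw) hxw
    rw [← AdE_inv_apply_apply q w, h, map_zero]
  have hAd : ∀ x, MDifferentiableAt 𝓘(ℂ, E) 𝓘(ℂ, E →L[ℂ] E) (AdE (E := E) (Gc := Gc)) x :=
    contMDiff_AdE.mdifferentiable (by simp)
  refine ⟨fun x => d (AdE x), fun x => Ψ (a (AdE x)), fun x => ?_, fun x hx => ?_, fun x hx => ?_,
    fun z => ?_, fun x q hq => ⟨⟨fun h => ?_, hinv x q hq⟩, fun h => ?_⟩⟩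
  · exact (hd.differentiable (by simp) _).mdifferentiableAt.comp x (hAd x)
  · exact (hΨd _).mdifferentiableAt.comp x
      (((ha _ hx).differentiableAt (by simp)).mdifferentiableAt.comp x (hAd x))
  · -- `N = Ad (exp (K x))⁻¹ (Ad x 𝔮⁻)` contains `T`, hence is graded, and meets `𝔲⁺` trivially
    set y := a (AdE x) with hy
    set g : Gc := (expE (Ψ y : E))⁻¹ * x with hg
    let N : Submodule ℂ E := (qE Gc T).map (AdE (E := E) g).toLinearMap
    obtain ⟨w, hw, hwy⟩ := hmeet _ hx
    have hTN : AdE g w = T := by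
      rw [hg, AdE_mul_apply, hwy, ← hΨ2, AdE_inv_apply_apply]
    have hNT : ∀ X ∈ N, (adE (E := E) Gc T).toLinearMap X ∈ N := by
      rintro _ ⟨v, hv, rfl⟩
      refine ⟨adE Gc w v, adE_mem_qE hw hv, ?_⟩
      change AdE g (adE Gc w v) = adE Gc T (AdE g v)
      rw [AdE_adE, hTN]
    have hNu : Disjoint N (uE Gc T) := by
      rw [Submodule.disjoint_def]
      rintro _ ⟨v, hv, rfl⟩ hvu
      have h1 : AdE x v ∈ uE Gc T := by
        have h2 := AdE_expE_mem_uE (Ψ y).2 hvu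
        change AdE (expE (Ψ y : E)) (AdE g v) ∈ uE Gc T at h2
        rwa [hg, AdE_mul_apply, AdE_apply_inv_apply] at h2
      rw [(hdiff _).1 hx v hv h1, map_zero]
    have hle : N ≤ qE Gc T := le_nonposPart_of_disjoint hT hNT hNu
    exact mem_QMinus_iff_qE.2 fun X hX => hle ⟨X, hX, rfl⟩
  · have h1 : d (AdE (expE (Gc := Gc) (z : E))) ≠ 0 := by
      rw [hdiff]
      intro w hw hzw
      have h2 := AdE_expE_mem_uE (Submodule.neg_mem _ z.2) hzw
      rw [expE_neg, AdE_inv_apply_apply] at h2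
      exact Submodule.disjoint_def.1 huq.disjoint w h2 hw
    refine ⟨h1, ?_⟩
    change Ψ (a (AdE (expE (z : E)))) = z
    rw [huniq _ ⟨AdE (expE (Gc := Gc) (z : E)) T - T, AdE_expE_sub_mem_uE z.2⟩ h1
      ⟨T, self_mem_qE T, by simp⟩]
    exact hΨ1 z
  · have h2 := hinv (x * q) q⁻¹ ((QMinus (E := E) (Gc := Gc) T).inv_mem hq) h
    rwa [mul_inv_cancel_right] at h2
  · refine congrArg Ψ (huniq _ _ (hinv x q hq h) ?_)
    obtain ⟨w, hw, hwx⟩ := hmeet _ h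
    refine ⟨AdE q⁻¹ w, hQ _ ((QMinus (E := E) (Gc := Gc) T).inv_mem hq) w hw, ?_⟩
    rw [AdE_mul_apply, AdE_apply_inv_apply, hwx]

end BigCell

/-! ### Real forms and ellipticity -/

section RealForm

variable {E : Type*} [NormedAddCommGroup E] [NormedSpace ℂ E] [CompleteSpace E]
  {Gc : Type*} [TopologicalSpace Gc] [ChartedSpace E Gc] [Group Gc] [LieGroup 𝓘(ℂ, E) ω Gc]
  {𝔤 : LieSubalgebra ℝ (GroupLieAlgebra 𝓘(ℂ, E) Gc)}

variable (𝔤) in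
/-- The inclusion of a real subalgebra, as a map to the model space. -/
def inclE : 𝔤 →ₗ[ℝ] E := 𝔤.toSubmodule.subtype

theorem exists_add_I_smul (h_form : IsRealForm 𝔤) (Z : E) :
    ∃ X Y : 𝔤, Z = inclE 𝔤 X + Complex.I • inclE 𝔤 Y := by
  obtain ⟨P, hP, -⟩ := h_form Z
  exact ⟨P.1, P.2, hP⟩

theorem eq_of_add_I_smul_eq (h_form : IsRealForm 𝔤) {X Y X' Y' : 𝔤}
    (h : inclE 𝔤 X + Complex.I • inclE 𝔤 Y = inclE 𝔤 X' + Complex.I • inclE 𝔤 Y') :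
    X = X' ∧ Y = Y' := by
  obtain ⟨P, -, hP⟩ := h_form (inclE 𝔤 X + Complex.I • inclE 𝔤 Y)
  have h1 := (hP (X, Y) rfl).trans (hP (X', Y') h).symm
  exact ⟨congrArg Prod.fst h1, congrArg Prod.snd h1⟩

theorem adE_inclE (T X : 𝔤) : adE Gc (inclE 𝔤 T) (inclE 𝔤 X) = inclE 𝔤 ⁅T, X⁆ :=
  adE_apply _ _

theorem aeval_adE_inclE (T : 𝔤) (p : Polynomial ℝ) (X : 𝔤) :
    Polynomial.aeval (adE Gc (inclE 𝔤 T)).toLinearMap (p.map (algebraMap ℝ ℂ)) (inclE 𝔤 X) =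
      inclE 𝔤 (Polynomial.aeval (LieAlgebra.ad ℝ 𝔤 T) p X) := by
  have hpow : ∀ n : ℕ, ((adE Gc (inclE 𝔤 T)).toLinearMap ^ n) (inclE 𝔤 X) =
      inclE 𝔤 ((LieAlgebra.ad ℝ 𝔤 T ^ n) X) := by
    intro n
    induction n with
    | zero => rfl
    | succ n ih =>
      rw [pow_succ', pow_succ', Module.End.mul_apply, ih]
      exact adE_inclE T _
  induction p using Polynomial.induction_on' with
  | add p q hp hq =>
    rw [Polynomial.map_add, map_add, map_add, LinearMap.add_apply, LinearMap.add_apply, hp, hq,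
      map_add]
  | monomial n r =>
    rw [Polynomial.map_monomial, Polynomial.aeval_monomial, Polynomial.aeval_monomial]
    exact congrArg (fun Z : E => (r : ℂ) • Z) (hpow n)

/-- Ellipticity of `T` gives the grading: the minimal polynomial of `ad T` on the real form has
simple, purely imaginary roots and annihilates `ad T` on the complexification. -/
theorem isGraded_of_isElliptic [FiniteDimensional ℂ E] (h_form : IsRealForm 𝔤) {T : 𝔤}
    (hT : IsElliptic T) : IsGraded Gc (inclE 𝔤 T) := by
  set A : Module.End ℂ E := (adE Gc (inclE 𝔤 T)).toLinearMap with hA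
  set a : Module.End ℝ 𝔤 := LieAlgebra.ad ℝ 𝔤 T with ha
  set P : Polynomial ℂ := (minpoly ℝ a).map (algebraMap ℝ ℂ) with hP
  have hsq : Squarefree P :=
    (PerfectField.separable_iff_squarefree.2 hT.1.minpoly_squarefree).map.squarefree
  have hPA : Polynomial.aeval A P = 0 := by
    ext Z
    obtain ⟨X, Y, rfl⟩ := exists_add_I_smul h_form Z
    have h : ∀ X : 𝔤, Polynomial.aeval A P (inclE 𝔤 X) = 0 := fun X => by
      refine (aeval_adE_inclE T _ X).trans ?_
      rw [minpoly.aeval, LinearMap.zero_apply, map_zero]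
    rw [map_add, map_smul, h, h, smul_zero, add_zero, LinearMap.zero_apply]
  have hss : A.IsSemisimple := Module.End.isSemisimple_of_squarefree_aeval_eq_zero hsq hPA
  have htop : ⨆ μ, A.eigenspace μ = ⊤ := by
    rw [← A.iSup_maxGenEigenspace_eq_top]
    exact iSup_congr fun μ => (hss.isFinitelySemisimple.maxGenEigenspace_eq_eigenspace μ).symm
  change ⨆ c : ℝ, A.eigenspace (Complex.I * (c : ℂ)) = ⊤
  rw [eq_top_iff, ← htop]
  refine iSup_le fun μ => ?_
  by_cases hμ : A.eigenspace μ = ⊥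
  · rw [hμ]; exact bot_le
  obtain ⟨v, hv, hv0⟩ := (Submodule.ne_bot_iff _).1 hμ
  have h1 : P.eval μ = 0 := by
    have h2 := Module.End.aeval_apply_of_hasEigenvector (f := A) (p := P) ⟨hv, hv0⟩
    rw [hPA, LinearMap.zero_apply] at h2
    exact (smul_eq_zero.1 h2.symm).resolve_right hv0
  have h3 : μ ∈ a.charpoly.aroots ℂ := by
    rw [Polynomial.mem_aroots]
    refine ⟨(LinearMap.charpoly_monic a).ne_zero, ?_⟩
    obtain ⟨q, hq⟩ := LinearMap.minpoly_dvd_charpoly a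
    rw [hq, map_mul, ← Polynomial.eval_map_algebraMap, h1, zero_mul]
  have h4 : μ = Complex.I * (μ.im : ℂ) := by
    conv_lhs => rw [← Complex.re_add_im μ, hT.2 μ h3]
    simp [mul_comm]
  rw [h4]
  exact le_iSup (fun c : ℝ => A.eigenspace (Complex.I * (c : ℂ))) μ.im

/-- A real form and `𝔮⁻` together span: `𝔤^c` with `c > 0` is the conjugate of `𝔤^{-c}`. -/
theorem range_inclE_sup_qE (h_form : IsRealForm 𝔤) {T : 𝔤} (hT : IsGraded Gc (inclE 𝔤 T)) :
    LinearMap.range (inclE 𝔤) ⊔ (qE Gc (inclE 𝔤 T)).restrictScalars ℝ = ⊤ := by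
  have hu : ∀ z ∈ uE Gc (inclE 𝔤 T), z ∈
      LinearMap.range (inclE 𝔤) ⊔ (qE Gc (inclE 𝔤 T)).restrictScalars ℝ := by
    intro z hz
    refine posPart_induction (p := fun z => z ∈
      LinearMap.range (inclE 𝔤) ⊔ (qE Gc (inclE 𝔤 T)).restrictScalars ℝ) (fun c Z hc hZ => ?_)
      (Submodule.zero_mem _) (fun _ _ => Submodule.add_mem _) hz
    replace hZ : adE Gc (inclE 𝔤 T) Z = (Complex.I * c) • Z := hZ
    obtain ⟨X, Y, rfl⟩ := exists_add_I_smul h_form Z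
    have e : ∀ (b : ℝ) (W : 𝔤), inclE 𝔤 (b • W) = (b : ℂ) • inclE 𝔤 W := fun b W => by
      rw [map_smul, Complex.coe_smul]
    rw [map_add, map_smul, adE_inclE, adE_inclE] at hZ
    -- comparing real and imaginary parts, `[T, X] = - c Y` and `[T, Y] = c X`
    obtain ⟨h1, h2⟩ := eq_of_add_I_smul_eq h_form (X := ⁅T, X⁆) (Y := ⁅T, Y⁆) (X' := (-c) • Y)
      (Y' := c • X) (by
        rw [hZ, e, e, smul_add, smul_smul, smul_smul, add_comm, mul_right_comm, Complex.I_mul_I,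
          neg_one_mul, Complex.ofReal_neg])
    have h3 : inclE 𝔤 X - Complex.I • inclE 𝔤 Y ∈ qE Gc (inclE 𝔤 T) := by
      refine mem_nonposPart (c := -c) (by linarith) ?_
      change adE Gc (inclE 𝔤 T) _ = _
      rw [map_sub, map_smul, adE_inclE, adE_inclE, h1, h2, e, e, smul_sub, smul_smul, smul_smul]
      push_cast
      rw [show Complex.I * -(c : ℂ) * Complex.I = c by
        linear_combination -(c : ℂ) * Complex.I_mul_I]
      rw [mul_neg, neg_smul, neg_smul]
      abel
    rw [show inclE 𝔤 X + Complex.I • inclE 𝔤 Y = (2 : ℝ) • inclE 𝔤 X +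
      -(inclE 𝔤 X - Complex.I • inclE 𝔤 Y) by rw [two_smul]; abel]
    exact Submodule.add_mem_sup (Submodule.smul_mem _ _ ⟨X, rfl⟩) (Submodule.neg_mem _ h3)
  rw [eq_top_iff]
  intro Z _
  have huq := isCompl_posPart_nonposPart hT
  have hZ : Z ∈ uE Gc (inclE 𝔤 T) ⊔ qE Gc (inclE 𝔤 T) := huq.sup_eq_top ▸ Submodule.mem_top
  obtain ⟨z, hz, w, hw, rfl⟩ := Submodule.mem_sup.1 hZ
  exact Submodule.add_mem _ (hu z hz) (Submodule.mem_sup_right hw)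

end RealForm

/-! ### Products of exponentials -/

section ExpMulExp

open Filter

variable {E : Type*} [NormedAddCommGroup E] [NormedSpace ℂ E] [CompleteSpace E]
  [FiniteDimensional ℂ E]
  {Gc : Type*} [TopologicalSpace Gc] [T2Space Gc] [ChartedSpace E Gc] [Group Gc]
  [LieGroup 𝓘(ℂ, E) ω Gc] [LieAlgebra.IsSemisimple ℂ (GroupLieAlgebra 𝓘(ℂ, E) Gc)]

/-- If two real subspaces span the Lie algebra, the products of their exponentials fill a
neighbourhood of the identity. -/
theorem exp_mul_exp_mem_nhds {M N : Submodule ℝ E} (hMN : M ⊔ N = ⊤) :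
    {x : Gc | ∃ X ∈ M, ∃ Y ∈ N, x = expE X * expE Y} ∈ 𝓝 1 := by
  have := lieGroup_real (E := E) (Gc := Gc)
  have : FiniteDimensional ℝ E := FiniteDimensional.complexToReal E
  have hexp : ContMDiff 𝓘(ℝ, E) 𝓘(ℝ, E) ω (expE (E := E) (Gc := Gc)) :=
    contMDiff_restrictScalars contMDiff_expE
  let Θ : M × N → Gc := fun P => expE (P.1 : E) * expE (P.2 : E)
  have hΘ : ContMDiff 𝓘(ℝ, M × N) 𝓘(ℝ, E) ω Θ := by
    have h1 : ContDiff ℝ ω fun P : M × N => (P.1 : E) :=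
      (M.subtypeL.comp (ContinuousLinearMap.fst ℝ M N)).contDiff
    have h2 : ContDiff ℝ ω fun P : M × N => (P.2 : E) :=
      (N.subtypeL.comp (ContinuousLinearMap.snd ℝ M N)).contDiff
    exact (hexp.comp h1.contMDiff).mul (hexp.comp h2.contMDiff)
  have hΘ0 : Θ 0 = 1 := by
    change expE (0 : E) * expE (0 : E) = 1
    rw [expE_zero, one_mul]
  obtain ⟨D, hD⟩ : ∃ D : M × N →L[ℝ] E, HasMFDerivAt 𝓘(ℝ, M × N) 𝓘(ℝ, E) Θ 0 D :=
    ⟨_, (hΘ.mdifferentiable (by simp) 0).hasMFDerivAt⟩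
  -- the derivative of `Θ` is computed along curves that `Θ` maps to one-parameter subgroups
  have hcurve : ∀ (P : M × N) (X : E), (∀ t : ℝ, Θ (t • P) = expE (t • X)) → D P = X := by
    intro P X hP
    have h1 : HasMFDerivAt 𝓘(ℝ, M × N) 𝓘(ℝ, E) Θ ((0 : ℝ) • P) D := by rw [zero_smul]; exact hD
    have h2 : HasMFDerivAt 𝓘(ℝ, ℝ) 𝓘(ℝ, M × N) (fun t : ℝ => t • P) 0
        (ContinuousLinearMap.toSpanSingleton ℝ P : ℝ →L[ℝ] M × N) :=
      ((ContinuousLinearMap.toSpanSingleton ℝ P).hasFDerivAt).hasMFDerivAt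
    have h3 := HasMFDerivAt.comp (f := fun t : ℝ => t • P) 0 h1 h2
    have h4 := hasMFDerivAt_unique
      (h3.congr_of_eventuallyEq (Eventually.of_forall fun t => (hP t).symm))
      (hasMFDerivAt_expE_smul X)
    have h5 : D ((1 : ℝ) • P) = (1 : ℝ) • X := DFunLike.congr_fun h4 (1 : ℝ)
    rwa [one_smul, one_smul] at h5
  have hsurj : Function.Surjective D := by
    intro Z
    obtain ⟨X, hX, Y, hY, rfl⟩ := Submodule.mem_sup.1 (hMN ▸ Submodule.mem_top : Z ∈ M ⊔ N)
    refine ⟨((⟨X, hX⟩ : M), (⟨Y, hY⟩ : N)), ?_⟩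
    have e : ((⟨X, hX⟩ : M), (⟨Y, hY⟩ : N)) =
        ((⟨X, hX⟩ : M), (0 : N)) + ((0 : M), (⟨Y, hY⟩ : N)) := by
      simp
    rw [e, map_add, hcurve _ X, hcurve _ Y]
    · intro t
      change expE (((t • (0 : M) : M) : E)) * expE (t • Y) = _
      rw [smul_zero, ZeroMemClass.coe_zero, expE_zero, one_mul]
    · intro t
      change expE (t • X) * expE (((t • (0 : N) : N) : E)) = _
      rw [smul_zero, ZeroMemClass.coe_zero, expE_zero, mul_one]
  set c := extChartAt 𝓘(ℝ, E) (1 : Gc) with hc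
  have hcΘ : ContDiffAt ℝ ω (c ∘ Θ) 0 := by
    have h1 : ContMDiffAt 𝓘(ℝ, E) 𝓘(ℝ, E) ω c (Θ 0) := by rw [hΘ0]; exact contMDiffAt_extChartAt
    exact (h1.comp 0 hΘ.contMDiffAt).contDiffAt
  have hcD : HasFDerivAt (c ∘ Θ) D 0 := by
    have h1 : HasMFDerivAt 𝓘(ℝ, E) 𝓘(ℝ, E) c (Θ 0)
        ((ContinuousLinearMap.id ℂ E).restrictScalars ℝ : E →L[ℝ] E) := by
      rw [hΘ0]
      exact hasMFDerivAt_restrictScalars (hasMFDerivAt_extChartAt_one (E := E) (Gc := Gc))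
    exact hasMFDerivAt_iff_hasFDerivAt.1 (HasMFDerivAt.comp 0 h1 hD)
  have hs : HasStrictFDerivAt (c ∘ Θ) D 0 := by
    have h := hcΘ.hasStrictFDerivAt (by simp)
    rwa [hcD.fderiv] at h
  have hmap := hs.map_nhds_eq_of_surj (LinearMap.range_eq_top.2 hsurj)
  have hmem : (c ∘ Θ) '' (Θ ⁻¹' c.source) ∈ 𝓝 (c 1) := by
    rw [← hΘ0, show c (Θ 0) = (c ∘ Θ) 0 from rfl, ← hmap]
    refine image_mem_map (hΘ.continuous.continuousAt.preimage_mem_nhds ?_)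
    rw [hΘ0]; exact extChartAt_source_mem_nhds (1 : Gc)
  filter_upwards [(continuousAt_extChartAt (I := 𝓘(ℝ, E)) (1 : Gc)).preimage_mem_nhds hmem,
    extChartAt_source_mem_nhds (I := 𝓘(ℝ, E)) (1 : Gc)] with x hx hxs
  obtain ⟨P, hP, hPx⟩ := hx
  refine ⟨P.1, P.1.2, P.2, P.2.2, ?_⟩
  exact (c.injOn hP hxs hPx).symm

end ExpMulExp

/-! ### The identity theorem off the zero set of a holomorphic function -/

section ManifoldIdentity

open Filter Metric

variable {E : Type*} [NormedAddCommGroup E] [NormedSpace ℂ E]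
  {M : Type*} [TopologicalSpace M] [ChartedSpace E M] [IsManifold 𝓘(ℂ, E) ω M]
  {W : Type*} [NormedAddCommGroup W] [NormedSpace ℂ W]

theorem differentiableAt_comp_extChartAt_symm {f : M → W} {y : M} {x : E}
    (hx : x ∈ (extChartAt 𝓘(ℂ, E) y).target)
    (hf : MDifferentiableAt 𝓘(ℂ, E) 𝓘(ℂ, W) f ((extChartAt 𝓘(ℂ, E) y).symm x)) :
    DifferentiableAt ℂ (fun x => f ((extChartAt 𝓘(ℂ, E) y).symm x)) x := by
  have h : MDifferentiableAt 𝓘(ℂ, E) 𝓘(ℂ, E) (extChartAt 𝓘(ℂ, E) y).symm x :=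
    ((contMDiffOn_extChartAt_symm (I := 𝓘(ℂ, E)) (n := ω) y).contMDiffAt
      ((isOpen_extChartAt_target y).mem_nhds hx)).mdifferentiableAt (by simp)
  exact (hf.comp x h).differentiableAt

theorem exists_ball_extChartAt {y : M} {N : Set M} (hN : N ∈ 𝓝 y) :
    ∃ r > 0, ball (extChartAt 𝓘(ℂ, E) y y) r ⊆ (extChartAt 𝓘(ℂ, E) y).target ∧
      ∀ x ∈ ball (extChartAt 𝓘(ℂ, E) y y) r, (extChartAt 𝓘(ℂ, E) y).symm x ∈ N := by
  have h1 := extChartAt_target_mem_nhds (I := 𝓘(ℂ, E)) y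
  have h2 := (continuousAt_extChartAt_symm (I := 𝓘(ℂ, E)) y).preimage_mem_nhds
    (by rw [extChartAt_to_inv]; exact hN)
  obtain ⟨r, hr, h⟩ := Metric.mem_nhds_iff.1 (inter_mem h1 h2)
  exact ⟨r, hr, fun x hx => (h hx).1, fun x hx => (h hx).2⟩

theorem eventually_of_forall_ball {y : M} {r : ℝ} (hr : 0 < r) {P : M → Prop}
    (h : ∀ x ∈ ball (extChartAt 𝓘(ℂ, E) y y) r, P ((extChartAt 𝓘(ℂ, E) y).symm x)) :
    ∀ᶠ x in 𝓝 y, P x := by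
  filter_upwards [extChartAt_source_mem_nhds (I := 𝓘(ℂ, E)) y,
    (continuousAt_extChartAt (I := 𝓘(ℂ, E)) y).preimage_mem_nhds (ball_mem_nhds _ hr)]
    with x hx hx'
  rw [← (extChartAt 𝓘(ℂ, E) y).left_inv hx]
  exact h _ hx'

/-- On a connected complex manifold, a holomorphic function that is not identically zero vanishes
on no nonempty open set. -/
theorem frequently_ne_zero [ConnectedSpace M] {h : M → ℂ}
    (hh : MDifferentiable 𝓘(ℂ, E) 𝓘(ℂ, ℂ) h) {x₀ : M} (hx₀ : h x₀ ≠ 0) (x : M) :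
    ∃ᶠ y in 𝓝 x, h y ≠ 0 := by
  set Z : Set M := {x | ∀ᶠ y in 𝓝 x, h y = 0} with hZ
  have hZo : IsOpen Z := isOpen_setOfPred_eventually_nhds
  have hZc : IsClosed Z := by
    refine isClosed_of_closure_subset fun x hx => ?_
    obtain ⟨r, hr, hrt, -⟩ := exists_ball_extChartAt (E := E) (univ_mem : Set.univ ∈ 𝓝 x)
    have hnhds : ∀ᶠ y in 𝓝 x, y ∈ (extChartAt 𝓘(ℂ, E) x).source ∧
        extChartAt 𝓘(ℂ, E) x y ∈ ball (extChartAt 𝓘(ℂ, E) x x) r :=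
      Filter.Eventually.and (extChartAt_source_mem_nhds (I := 𝓘(ℂ, E)) x)
        ((continuousAt_extChartAt (I := 𝓘(ℂ, E)) x).eventually_mem (ball_mem_nhds _ hr))
    obtain ⟨y, ⟨hys, hyb⟩, hyZ⟩ := mem_closure_iff_nhds.1 hx _ hnhds
    have hyc : (extChartAt 𝓘(ℂ, E) x).symm (extChartAt 𝓘(ℂ, E) x y) = y :=
      (extChartAt 𝓘(ℂ, E) x).left_inv hys
    refine eventually_of_forall_ball (E := E) hr fun z hz => ?_
    refine eq_zero_of_eventually_ball (D := fun z => h ((extChartAt 𝓘(ℂ, E) x).symm z))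
      (fun z hz => (differentiableAt_comp_extChartAt_symm (hrt hz) (hh _)).differentiableWithinAt)
      hyb ?_ hz
    refine Tendsto.eventually (p := fun w => h w = 0)
      (continuousAt_extChartAt_symm'' (hrt hyb)) ?_
    rw [hyc]
    exact hyZ
  intro hx
  have hxZ : x ∈ Z := hx.mono fun y hy => not_not.1 hy
  have h1 := IsClopen.eq_univ ⟨hZc, hZo⟩ ⟨x, hxZ⟩
  have h2 : x₀ ∈ Z := h1 ▸ Set.mem_univ x₀
  exact hx₀ h2.self_of_nhds

/-- Let `D` be holomorphic where the holomorphic function `h` does not vanish. If `D` vanishes there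
near one point of a connected set, then it does so near every point of that set. -/
theorem eventually_eq_zero_of_isPreconnected [CompleteSpace W] {h : M → ℂ}
    (hh : MDifferentiable 𝓘(ℂ, E) 𝓘(ℂ, ℂ) h) (hne : ∀ x, ∃ᶠ y in 𝓝 x, h y ≠ 0) {O : Set M}
    (hO : IsOpen O) {D : M → W}
    (hD : ∀ x ∈ O, h x ≠ 0 → MDifferentiableAt 𝓘(ℂ, E) 𝓘(ℂ, W) D x) {S : Set M}
    (hS : IsPreconnected S) (hSO : S ⊆ O) {x₀ : M} (hx₀ : x₀ ∈ S)
    (hx₀D : ∀ᶠ y in 𝓝 x₀, h y ≠ 0 → D y = 0) {x : M} (hx : x ∈ S) :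
    ∀ᶠ y in 𝓝 x, h y ≠ 0 → D y = 0 := by
  refine hS.subset_of_closure_inter_subset (u := {x | ∀ᶠ y in 𝓝 x, h y ≠ 0 → D y = 0})
    isOpen_setOfPred_eventually_nhds ⟨x₀, hx₀, hx₀D⟩ ?_ hx
  rintro x ⟨hxc, hxS⟩
  obtain ⟨r, hr, hrt, hrO⟩ := exists_ball_extChartAt (E := E) (hO.mem_nhds (hSO hxS))
  set c := extChartAt 𝓘(ℂ, E) x with hc
  have hnhds : ∀ᶠ y in 𝓝 x, y ∈ c.source ∧ c y ∈ ball (c x) r :=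
    Filter.Eventually.and (extChartAt_source_mem_nhds (I := 𝓘(ℂ, E)) x)
      ((continuousAt_extChartAt (I := 𝓘(ℂ, E)) x).eventually_mem (ball_mem_nhds _ hr))
  obtain ⟨y, hyb, hyD⟩ := mem_closure_iff_nhds.1 hxc _ (eventually_eventually_nhds.2 hnhds)
  -- a point near `y` at which `h` does not vanish, and near which `D` does
  obtain ⟨p, hp0, ⟨hps, hpb⟩, hpD⟩ := ((hne y).and_eventually
    (hyb.and (eventually_eventually_nhds.2 hyD))).exists
  have hpc : c.symm (c p) = p := c.left_inv hps
  change ∀ᶠ y in 𝓝 x, h y ≠ 0 → D y = 0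
  refine eventually_of_forall_ball (E := E) hr fun z hz hz0 => ?_
  refine eq_zero_of_ne_zero_ball (x := c x) (r := r) (h := fun z => h (c.symm z))
    (D := fun z => D (c.symm z))
    (fun z hz => (differentiableAt_comp_extChartAt_symm (hrt hz) (hh _)).differentiableWithinAt)
    (fun z hz hz0 => differentiableAt_comp_extChartAt_symm (hrt hz) (hD _ (hrO z hz) hz0))
    hpb (by simpa only [hpc] using hp0) ?_ hz hz0
  refine Tendsto.eventually (p := fun w => D w = 0)
    (continuousAt_extChartAt_symm'' (hrt hpb)) ?_
  change ∀ᶠ y in 𝓝 (c.symm (c p)), D y = 0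
  rw [hpc]
  filter_upwards [hpD, (hh p).continuousAt.eventually_ne hp0] with w hw hw0
  exact hw hw0

end ManifoldIdentity

theorem mvPolynomial_eq_of_eventually_eq {r : ℕ} {P Q : MvPolynomial (Fin r) ℂ}
    (h : ∀ᶠ z in 𝓝 (0 : Fin r → ℂ), MvPolynomial.eval z P = MvPolynomial.eval z Q) : P = Q := by
  obtain ⟨δ, hδ, hball⟩ := Metric.eventually_nhds_iff_ball.1 h
  refine MvPolynomial.funext_set (fun _ => Metric.ball 0 δ) (fun _ => ?_) fun z hz => hball z ?_
  · exact infinite_of_mem_nhds (0 : ℂ) (Metric.ball_mem_nhds 0 hδ)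
  · rw [ball_pi _ hδ]
    exact hz

/-! ### Sections near the orbit -/

section OpenOrbit

open Filter

variable {E : Type*} [NormedAddCommGroup E] [NormedSpace ℂ E] [FiniteDimensional ℂ E]
  [CompleteSpace E]
  {Gc : Type*} [TopologicalSpace Gc] [T2Space Gc] [ChartedSpace E Gc] [Group Gc]
  [LieGroup 𝓘(ℂ, E) ω Gc]

variable {G : Subgroup Gc} {T : E}

theorem one_mem_GQ : (1 : Gc) ∈ GQ (E := E) G T := ⟨1, G.one_mem, 1, (QMinus _).one_mem, mul_one 1⟩

theorem coe_subset_GQ : (G : Set Gc) ⊆ GQ (E := E) G T := fun g hg =>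
  ⟨g, hg, 1, (QMinus _).one_mem, mul_one g⟩

theorem expE_mem_QMinus {X : E} (hX : X ∈ qE Gc T) : expE X ∈ QMinus (E := E) (Gc := Gc) T :=
  mem_QMinus_iff_qE.2 fun _ h => AdE_expE_mem_qE hX h

variable [LieAlgebra.IsSemisimple ℂ (GroupLieAlgebra 𝓘(ℂ, E) Gc)]

/-- `G Q⁻` is a neighbourhood of the identity, since `𝔤 + 𝔮⁻` is the whole Lie algebra; translations
then show that it is open. -/
theorem isOpen_GQ {𝔤 : LieSubalgebra ℝ (GroupLieAlgebra 𝓘(ℂ, E) Gc)} (h𝔤 : IsLieAlgebraOf 𝔤 G)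
    (h_form : IsRealForm 𝔤) {T : 𝔤} (hT : IsGraded Gc (inclE 𝔤 T)) :
    IsOpen (GQ (E := E) G (inclE 𝔤 T)) := by
  have : IsTopologicalGroup Gc := topologicalGroup_of_lieGroup 𝓘(ℂ, E) ω
  have h1 : GQ (E := E) G (inclE 𝔤 T) ∈ 𝓝 1 := by
    filter_upwards [exp_mul_exp_mem_nhds (Gc := Gc) (range_inclE_sup_qE h_form hT)] with x hx
    obtain ⟨_, ⟨X, rfl⟩, Y, hY, rfl⟩ := hx
    refine ⟨expE (inclE 𝔤 X), ?_, expE Y, expE_mem_QMinus hY, rfl⟩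
    have h := (h𝔤 X).1 X.2 1
    rw [one_smul] at h
    exact h
  rw [isOpen_iff_mem_nhds]
  rintro _ ⟨g, hg, q, hq, rfl⟩
  have h2 : ContinuousAt (fun x : Gc => g⁻¹ * x * q⁻¹) (g * q) := by fun_prop
  have h3 := h2.preimage_mem_nhds (t := GQ (E := E) G (inclE 𝔤 T)) (by
    simpa [mul_assoc] using h1)
  filter_upwards [h3] with x hx
  obtain ⟨a, ha, b, hb, hab⟩ := hx
  refine ⟨g * a, G.mul_mem hg ha, b * q, (QMinus _).mul_mem hb hq, ?_⟩
  change a * b = g⁻¹ * x * q⁻¹ at hab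
  change g * a * (b * q) = x
  rw [mul_assoc, ← mul_assoc a, hab]
  group

theorem mdifferentiable_expE : MDifferentiable 𝓘(ℂ, E) 𝓘(ℂ, E) (expE (E := E) (Gc := Gc)) :=
  contMDiff_expE.mdifferentiable (by simp)

theorem mdifferentiable_expE_coe (N : Submodule ℂ E) :
    MDifferentiable 𝓘(ℂ, N) 𝓘(ℂ, E) fun z : N => expE (Gc := Gc) (z : E) := fun z =>
  MDifferentiableAt.comp (f := fun z : N => (z : E)) z (mdifferentiable_expE (z : E))
    N.subtypeL.differentiableAt.mdifferentiableAt

/-- A holomorphic function on `G Q⁻` that agrees near the identity of `U⁺` with an entire function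
of the exponential coordinates agrees with it on all of `U⁺ ∩ G Q⁻`, even if this intersection is
not connected. -/
theorem eq_of_eventually_eq_expE [ConnectedSpace Gc] (hT : IsGraded Gc T)
    (hG : IsConnected (G : Set Gc)) (hO : IsOpen (GQ (E := E) G T))
    {W : Type*} [NormedAddCommGroup W] [NormedSpace ℂ W] [CompleteSpace W] {f : Gc → W}
    (hf : ∀ x ∈ GQ (E := E) G T, MDifferentiableAt 𝓘(ℂ, E) 𝓘(ℂ, W) f x) {p : uE Gc T → W}
    (hp : Differentiable ℂ p)
    (hfp : ∀ᶠ z : uE Gc T in 𝓝 0, f (expE (z : E)) = p z) (z : uE Gc T)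
    (hz : expE (z : E) ∈ GQ (E := E) G T) : f (expE (z : E)) = p z := by
  obtain ⟨h, K, hh, hK, hKQ, hexp, hinv⟩ := exists_bigCell_coordinates hT
  have h1 : h 1 ≠ 0 ∧ K 1 = 0 := by
    have := hexp 0
    rwa [ZeroMemClass.coe_zero, expE_zero] at this
  -- `y ↦ exp (K y)` maps `G Q⁻` into itself
  have hKO : ∀ y ∈ GQ (E := E) G T, h y ≠ 0 → expE (K y : E) ∈ GQ (E := E) G T := by
    intro y hy hy0
    have h2 := mul_mem_GQ_right hy
      ⟨((expE (K y : E))⁻¹ * y)⁻¹, (QMinus (E := E) (Gc := Gc) T).inv_mem (hKQ y hy0)⟩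
    simpa using h2
  -- by `hinv`, `D` does not change when `y` is multiplied on the right by an element of `Q⁻`
  let D : Gc → W := fun y => f (expE (K y : E)) - p (K y)
  have hD : ∀ y ∈ GQ (E := E) G T, h y ≠ 0 → MDifferentiableAt 𝓘(ℂ, E) 𝓘(ℂ, W) D y := by
    intro y hy hy0
    have h2 : MDifferentiableAt 𝓘(ℂ, E) 𝓘(ℂ, E) (fun y => expE (Gc := Gc) (K y : E)) y :=
      (mdifferentiable_expE_coe (uE Gc T) (K y)).comp y (hK y hy0)
    exact ((hf _ (hKO y hy hy0)).comp y h2).sub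
      ((hp (K y)).mdifferentiableAt.comp y (hK y hy0))
  have hD1 : ∀ᶠ y in 𝓝 (1 : Gc), h y ≠ 0 → D y = 0 := by
    have h2 : Tendsto K (𝓝 1) (𝓝 0) := by
      have := (hK 1 h1.1).continuousAt.tendsto
      rwa [h1.2] at this
    filter_upwards [h2.eventually hfp] with y hy _
    exact sub_eq_zero.2 hy
  obtain ⟨g, hg, q, hq, hgq⟩ := hz
  change g * q = expE (z : E) at hgq
  -- `exp z = g q` with `g` on the connected set `G`, where `D` vanishes by the identity theorem
  have hg0 : h g ≠ 0 := by
    rw [← (hinv g q hq).1, hgq]; exact (hexp z).1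
  have hgD := (eventually_eq_zero_of_isPreconnected hh (frequently_ne_zero hh h1.1) hO hD
    hG.isPreconnected coe_subset_GQ G.one_mem hD1 hg).self_of_nhds hg0
  have hKg : K g = z := by
    rw [← (hinv g q hq).2 hg0, hgq]; exact (hexp z).2
  simp only [D, hKg] at hgD
  exact sub_eq_zero.1 hgD

end OpenOrbit

/-! ### `K`-finite sections in exponential coordinates -/

section Sections

open Filter

variable {E : Type*} [NormedAddCommGroup E] [NormedSpace ℂ E] [FiniteDimensional ℂ E]
  [CompleteSpace E]
  {Gc : Type*} [TopologicalSpace Gc] [T2Space Gc] [ChartedSpace E Gc] [Group Gc]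
  [LieGroup 𝓘(ℂ, E) ω Gc] {G : Subgroup Gc} {T : E}
  {V : Type*} [NormedAddCommGroup V] [NormedSpace ℂ V]

/-- The extension by zero of a function on `G Q⁻`. -/
def extendZero (ψ : GQ (E := E) G T → V) : Gc → V := Function.extend Subtype.val ψ 0

theorem extendZero_apply (ψ : GQ (E := E) G T → V) {y : Gc} (hy : y ∈ GQ (E := E) G T) :
    extendZero ψ y = ψ ⟨y, hy⟩ :=
  Subtype.val_injective.extend_apply ψ 0 ⟨y, hy⟩

theorem mdifferentiableAt_extendZero {ψ : GQ (E := E) G T → V} (hO : IsOpen (GQ (E := E) G T))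
    (hψ : IsHolomorphic (E := E) ψ) {y : Gc} (hy : y ∈ GQ (E := E) G T) :
    MDifferentiableAt 𝓘(ℂ, E) 𝓘(ℂ, V) (extendZero ψ) y := by
  obtain ⟨N, F, hN, hyN, hF, hFψ⟩ := hψ y hy
  refine (hF.mdifferentiableAt (hN.mem_nhds hyN)).congr_of_eventuallyEq ?_
  filter_upwards [hN.mem_nhds hyN, hO.mem_nhds hy] with x hxN hxO
  rw [extendZero_apply ψ hxO]
  exact (hFψ ⟨x, hxO⟩ hxN).symm

variable {ρ : QMinus (E := E) (Gc := Gc) T →* LinearMap.GeneralLinearGroup ℂ V}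

/-- `ψ (g x g⁻¹) = ρ(g) ((ϱ(g⁻¹) ψ) (x))` for `g ∈ G ∩ Q⁻`. -/
theorem extendZero_conj (ψ : Sections G T ρ) {g x : Gc} (hg : g ∈ G)
    (hgQ : g ∈ QMinus (E := E) (Gc := Gc) T) (hx : x ∈ GQ (E := E) G T) :
    extendZero ψ.1 (g * x * g⁻¹) =
      (ρ ⟨g, hgQ⟩ : V →ₗ[ℂ] V) (extendZero (sectionRep G T ρ (⟨g, hg⟩ : G)⁻¹ ψ).1 x) := by
  have h1 : g * x ∈ GQ (E := E) G T := mul_mem_GQ_left (⟨g, hg⟩ : G) hx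
  have h2 := ψ.2.2 ⟨g * x, h1⟩ (⟨g, hgQ⟩ : QMinus (E := E) (Gc := Gc) T)⁻¹
  have h3 : g * x * g⁻¹ ∈ GQ (E := E) G T :=
    mul_mem_GQ_right h1 (⟨g, hgQ⟩ : QMinus (E := E) (Gc := Gc) T)⁻¹
  rw [extendZero_apply _ h3, extendZero_apply _ hx]
  rw [map_inv, inv_inv] at h2
  refine h2.trans (congrArg _ ?_)
  refine congrArg ψ.1 (Subtype.ext ?_)
  change g * x = ((g⁻¹)⁻¹ : Gc) * x
  rw [inv_inv]

theorem extendZero_sum {n : ℕ} (a : Fin n → ℂ) (ψ : Fin n → Sections G T ρ) {x : Gc}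
    (hx : x ∈ GQ (E := E) G T) :
    extendZero (∑ j, a j • ψ j).1 x = ∑ j, a j • extendZero (ψ j).1 x := by
  simp only [extendZero_apply _ hx]
  have h := map_sum ((LinearMap.proj (R := ℂ) (φ := fun _ : GQ (E := E) G T => V) ⟨x, hx⟩).comp
    (Sections G T ρ).subtype) (fun j => a j • ψ j) Finset.univ
  simp only [map_smul] at h
  exact h

theorem sectionRep_mem_orbitSpan {K : Subgroup Gc} {φ ψ : Sections G T ρ} (hψ : ψ ∈ orbitSpan K φ)
    {k : G} (hk : (k : Gc) ∈ K) : sectionRep G T ρ k ψ ∈ orbitSpan K φ := by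
  refine Submodule.span_induction (p := fun ψ _ => sectionRep G T ρ k ψ ∈ orbitSpan K φ)
    ?_ ?_ ?_ ?_ hψ
  · rintro _ ⟨l, hl, rfl⟩
    refine Submodule.subset_span ⟨k * l, K.mul_mem hk hl, ?_⟩
    rw [map_mul]; rfl
  · rw [map_zero]; exact Submodule.zero_mem _
  · intro ψ χ _ _ h1 h2
    rw [map_add]; exact Submodule.add_mem _ h1 h2
  · intro a ψ _ h
    rw [map_smul]; exact Submodule.smul_mem _ _ h

theorem exists_finBasis {M : Type*} [AddCommGroup M] [Module ℂ M] (S : Submodule ℂ M)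
    (hS : FiniteDimensional ℂ S) : ∃ n : ℕ, Nonempty (Module.Basis (Fin n) ℂ S) :=
  ⟨_, ⟨Module.finBasis ℂ S⟩⟩

theorem coe_eq_sum_repr {M : Type*} [AddCommGroup M] [Module ℂ M] {S : Submodule ℂ M} {n : ℕ}
    (b : Module.Basis (Fin n) ℂ S) (x : S) : (x : M) = ∑ j, b.repr x j • (b j : M) := by
  have h := congrArg S.subtype (b.sum_repr x)
  rw [map_sum] at h
  simp only [map_smul] at h
  exact h.symm

theorem span_torusAction_eigenvectors :
    Submodule.span ℂ {x : uE Gc T | ∃ c : ℝ, 0 < c ∧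
      ∀ t : ℝ, torusAction Gc T t x = Complex.exp (Complex.I * c * t) • x} = ⊤ := by
  rw [eq_top_iff]
  rintro ⟨x, hx⟩ -
  obtain ⟨_, h⟩ : ∃ hx : x ∈ uE Gc T, (⟨x, hx⟩ : uE Gc T) ∈ Submodule.span ℂ {x : uE Gc T |
      ∃ c : ℝ, 0 < c ∧ ∀ t : ℝ, torusAction Gc T t x = Complex.exp (Complex.I * c * t) • x} := by
    refine posPart_induction (p := fun x => ∃ hx : x ∈ uE Gc T, (⟨x, hx⟩ : uE Gc T) ∈
      Submodule.span ℂ {x : uE Gc T | ∃ c : ℝ, 0 < c ∧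
        ∀ t : ℝ, torusAction Gc T t x = Complex.exp (Complex.I * c * t) • x}) ?_ ?_ ?_ hx
    · intro c X hc hX
      refine ⟨mem_posPart hc hX, Submodule.subset_span ⟨c, hc, fun t => Subtype.ext ?_⟩⟩
      rw [coe_torusAction, AdE_expE_smul_of_eigenvector hX, mul_comm]
      rfl
    · exact ⟨Submodule.zero_mem _, Submodule.zero_mem _⟩
    · rintro X Y ⟨hX, hX'⟩ ⟨hY, hY'⟩
      exact ⟨Submodule.add_mem _ hX hY, Submodule.add_mem _ hX' hY'⟩
  exact h

variable [LieAlgebra.IsSemisimple ℂ (GroupLieAlgebra 𝓘(ℂ, E) Gc)] [FiniteDimensional ℂ V]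

/-- Near the origin, a `K`-finite section is polynomial in the exponential coordinates on `U⁺`:
a basis of its `K`-span is a vector-valued function that is equivariant under the one-parameter
group generated by `T`, whose weights on `𝔲⁺` are positive. -/
theorem exists_polynomial_eventually_eq (hO : IsOpen (GQ (E := E) G T)) {K : Subgroup Gc}
    (hKG : ∀ t : ℝ, expE (t • T) ∈ G) (hK : ∀ t : ℝ, expE (t • T) ∈ K)
    {φ : Sections G T ρ} {n : ℕ} (b : Module.Basis (Fin n) ℂ (orbitSpan K φ)) {ψ : Sections G T ρ}
    (hψ : ψ ∈ orbitSpan K φ) :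
    ∃ p : uE Gc T → V, Differentiable ℂ p ∧
      (∀ᶠ z : uE Gc T in 𝓝 0, extendZero ψ.1 (expE (z : E)) = p z) ∧
      ∀ (r : ℕ) (e : Fin r → uE Gc T) (ℓ : V →ₗ[ℂ] ℂ), ∃ P : MvPolynomial (Fin r) ℂ,
        ∀ z : Fin r → ℂ, ℓ (p (∑ j, z j • e j)) = MvPolynomial.eval z P := by
  let f : uE Gc T → Fin n → V := fun z i => extendZero (b i).1.1 (expE (z : E))
  let U : Set (uE Gc T) := {z | expE (z : E) ∈ GQ (E := E) G T}
  have hU : IsOpen U := hO.preimage (mdifferentiable_expE_coe (uE Gc T)).continuous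
  have h0 : (0 : uE Gc T) ∈ U := by
    change expE (0 : E) ∈ GQ (E := E) G T
    rw [expE_zero]; exact one_mem_GQ
  have hf : DifferentiableOn ℂ f U := by
    rw [differentiableOn_pi]
    intro i z hz
    exact ((mdifferentiableAt_extendZero hO (b i).1.2.1 hz).comp z
      (mdifferentiable_expE_coe (uE Gc T) z)).differentiableAt.differentiableWithinAt
  have hQ : ∀ t : ℝ, expE (t • T) ∈ QMinus (E := E) (Gc := Gc) T := fun t =>
    expE_mem_QMinus ((qE Gc T).smul_of_tower_mem t (self_mem_qE T))
  have hmem : ∀ (t : ℝ) (i : Fin n),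
      sectionRep G T ρ (⟨expE (t • T), hKG t⟩ : G)⁻¹ (b i).1 ∈ orbitSpan K φ := fun t i =>
    sectionRep_mem_orbitSpan (b i).2 (K.inv_mem (hK t))
  -- the `K`-span acts by its matrix in the basis `b`, and `V` through `ρ`
  let R : ℝ → (Fin n → V) →ₗ[ℂ] (Fin n → V) := fun t => LinearMap.pi fun i =>
    (ρ ⟨expE (t • T), hQ t⟩ : V →ₗ[ℂ] V).comp
      (∑ j, b.repr ⟨_, hmem t i⟩ j • LinearMap.proj (R := ℂ) (φ := fun _ : Fin n => V) j)
  have hR : ∀ t : ℝ, ∀ᶠ z in 𝓝 (0 : uE Gc T), f (torusAction Gc T t z) = R t (f z) := by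
    intro t
    filter_upwards [hU.mem_nhds h0] with z hz
    ext i
    change extendZero (b i).1.1 (expE ((torusAction Gc T t z : uE Gc T) : E)) =
      (ρ ⟨expE (t • T), hQ t⟩ : V →ₗ[ℂ] V) ((∑ j, b.repr ⟨_, hmem t i⟩ j •
        LinearMap.proj (R := ℂ) (φ := fun _ : Fin n => V) j) (f z))
    rw [expE_torusAction, Complex.coe_smul, extendZero_conj _ (hKG t) (hQ t) hz]
    refine congrArg _ ?_
    refine (congrArg (fun χ : Sections G T ρ => extendZero χ.1 (expE (z : E)))
      (coe_eq_sum_repr b ⟨_, hmem t i⟩)).trans ((extendZero_sum _ _ hz).trans ?_)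
    simp [LinearMap.sum_apply, f]
  obtain ⟨p, hpd, hpf, hpoly⟩ := exists_polynomial_of_equivariant hU h0 hf
    (fun t => torusAction Gc T t) span_torusAction_eigenvectors R hR
  let L : (Fin n → V) →ₗ[ℂ] V :=
    ∑ j, b.repr ⟨ψ, hψ⟩ j • LinearMap.proj (R := ℂ) (φ := fun _ : Fin n => V) j
  refine ⟨fun z => L (p z), ?_, ?_, fun r e ℓ => hpoly r e (ℓ.comp L)⟩
  · exact (LinearMap.toContinuousLinearMap L).differentiable.comp hpd
  · filter_upwards [hpf, hU.mem_nhds h0] with z hz hzU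
    rw [← hz]
    refine (congrArg (fun χ : Sections G T ρ => extendZero χ.1 (expE (z : E)))
      (coe_eq_sum_repr b ⟨ψ, hψ⟩)).trans ((extendZero_sum _ _ hzU).trans ?_)
    simp [LinearMap.sum_apply, f, L]

end Sections

/-! ### Holomorphic functions on `U⁺` -/

section UPlus

open Filter

variable {E : Type*} [NormedAddCommGroup E] [NormedSpace ℂ E] [FiniteDimensional ℂ E]
  [CompleteSpace E]
  {Gc : Type*} [TopologicalSpace Gc] [T2Space Gc] [ChartedSpace E Gc] [Group Gc]
  [LieGroup 𝓘(ℂ, E) ω Gc] [LieAlgebra.IsSemisimple ℂ (GroupLieAlgebra 𝓘(ℂ, E) Gc)]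
  {T : E} {W : Type*} [NormedAddCommGroup W] [NormedSpace ℂ W]

theorem mem_UPlus_iff {x : Gc} :
    x ∈ UPlus (E := E) (Gc := Gc) T ↔ ∃ z ∈ uE Gc T, expE z = x := by
  constructor
  · rintro ⟨z, hz, rfl⟩
    exact ⟨z, mem_uPlus_iff.1 hz, rfl⟩
  · rintro ⟨z, hz, rfl⟩
    exact ⟨z, mem_uPlus_iff.2 hz, rfl⟩

theorem expE_mem_UPlus (z : uE Gc T) : expE (z : E) ∈ UPlus (E := E) (Gc := Gc) T :=
  mem_UPlus_iff.2 ⟨z, z.2, rfl⟩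

/-- An entire function of the exponential coordinates defines a holomorphic function on `U⁺`, being
the restriction of a holomorphic function on the big cell. -/
theorem exists_isHolomorphic_UPlus (hT : IsGraded Gc T) {p : uE Gc T → W}
    (hp : Differentiable ℂ p) : ∃ F : UPlus (E := E) (Gc := Gc) T → W,
      IsHolomorphic (E := E) F ∧ ∀ z : uE Gc T, F ⟨expE (z : E), expE_mem_UPlus z⟩ = p z := by
  obtain ⟨h, K, hh, hK, -, hexp, -⟩ := exists_bigCell_coordinates hT
  refine ⟨fun u => p (K u),
    fun x hx => ⟨{x | h x ≠ 0}, fun x => p (K x), ?_, ?_, ?_, fun _ _ => rfl⟩, fun z => congrArg p (hexp z).2⟩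
  · exact isOpen_ne_fun hh.continuous continuous_const
  · obtain ⟨z, hz, rfl⟩ := mem_UPlus_iff.1 hx
    exact (hexp ⟨z, hz⟩).1
  · exact fun y hy => ((hp (K y)).mdifferentiableAt.comp y (hK y hy)).mdifferentiableWithinAt

theorem differentiable_comp_expE_smul {F : UPlus (E := E) (Gc := Gc) T → W}
    (hF : IsHolomorphic (E := E) F) (z : uE Gc T) :
    Differentiable ℂ fun t : ℂ => F ⟨expE ((t • z : uE Gc T) : E), expE_mem_UPlus _⟩ := by
  intro t
  obtain ⟨N, F', hN, hxN, hF', h⟩ := hF _ (expE_mem_UPlus (t • z))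
  have h1 : MDifferentiableAt 𝓘(ℂ, ℂ) 𝓘(ℂ, E)
      (fun t : ℂ => expE (Gc := Gc) ((t • z : uE Gc T) : E)) t :=
    MDifferentiableAt.comp (f := fun t : ℂ => t • z) t (mdifferentiable_expE_coe (uE Gc T) (t • z))
      (differentiableAt_id.smul_const z).mdifferentiableAt
  have h2 : DifferentiableAt ℂ (fun t : ℂ => F' (expE ((t • z : uE Gc T) : E))) t :=
    ((hF'.mdifferentiableAt (hN.mem_nhds hxN)).comp t h1).differentiableAt
  refine h2.congr_of_eventuallyEq ?_
  filter_upwards [h1.continuousAt.preimage_mem_nhds (hN.mem_nhds hxN)] with s hs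
  exact (h ⟨_, expE_mem_UPlus (s • z)⟩ hs).symm

/-- Holomorphic functions on `U⁺` that agree near the identity are equal, since they are entire
along the complex lines of `𝔲⁺`. -/
theorem eq_of_isHolomorphic_UPlus [CompleteSpace W] {F F' : UPlus (E := E) (Gc := Gc) T → W}
    (hF : IsHolomorphic (E := E) F) (hF' : IsHolomorphic (E := E) F') {N : Set Gc} (hN : N ∈ 𝓝 1)
    (h : ∀ u : UPlus (E := E) (Gc := Gc) T, (u : Gc) ∈ N → F u = F' u) : F = F' := by
  ext ⟨x, hx⟩
  obtain ⟨z, hz, rfl⟩ := mem_UPlus_iff.1 hx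
  let z' : uE Gc T := ⟨z, hz⟩
  have hd := (differentiable_comp_expE_smul hF z').sub (differentiable_comp_expE_smul hF' z')
  have hc : ContinuousAt (fun t : ℂ => expE (Gc := Gc) ((t • z' : uE Gc T) : E)) 0 := by
    have h1 := (mdifferentiable_expE_coe (Gc := Gc) (uE Gc T)).continuous
    exact (h1.comp (continuous_id.smul continuous_const)).continuousAt
  have h0 : ∀ᶠ t : ℂ in 𝓝 0, expE ((t • z' : uE Gc T) : E) ∈ N :=
    hc.preimage_mem_nhds (by simpa only [zero_smul, ZeroMemClass.coe_zero, expE_zero] using hN)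
  have h1 := eq_zero_of_eventually_ball (x := (0 : ℂ)) (r := 2) hd.differentiableOn
    (p := 0) (by simp) (h0.mono fun t ht => sub_eq_zero.2 (h ⟨_, expE_mem_UPlus (t • z')⟩ ht))
    (q := 1) (by simp)
  have h2 := sub_eq_zero.1 h1
  simpa only [one_smul] using h2

end UPlus

end EllipticOrbit

end

open EllipticOrbit in
theorem proposition3p7
    {E : Type*} [NormedAddCommGroup E] [NormedSpace ℂ E] [FiniteDimensional ℂ E] [CompleteSpace E]
    -- a connected complex semisimple Lie group
    {Gc : Type*} [TopologicalSpace Gc] [T2Space Gc] [ConnectedSpace Gc] [ChartedSpace E Gc]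
    [Group Gc] [LieGroup 𝓘(ℂ, E) ω Gc]
    [LieAlgebra.IsSemisimple ℂ (GroupLieAlgebra 𝓘(ℂ, E) Gc)]
    -- a connected closed subgroup whose Lie algebra is a real form
    (G : Subgroup Gc) (hG_closed : IsClosed (G : Set Gc)) (hG_conn : IsConnected (G : Set Gc))
    (𝔤 : LieSubalgebra ℝ (GroupLieAlgebra 𝓘(ℂ, E) Gc)) (h𝔤 : IsLieAlgebraOf 𝔤 G)
    (h_form : IsRealForm 𝔤)
    -- a non-zero elliptic element, and a Cartan decomposition
    (T : 𝔤) (hT_ne : T ≠ 0) (hT : IsElliptic T)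
    (𝔨 : LieSubalgebra ℝ 𝔤) (𝔭 : Submodule ℝ 𝔤) (h_cartan : IsCartanDecomposition 𝔨 𝔭)
    (hT𝔨 : T ∈ 𝔨)
    -- a holomorphic representation of the parabolic subgroup
    {V : Type*} [NormedAddCommGroup V] [NormedSpace ℂ V] [FiniteDimensional ℂ V]
    (ρ : QMinus (T : GroupLieAlgebra 𝓘(ℂ, E) Gc) →* LinearMap.GeneralLinearGroup ℂ V)
    (hρ : IsHolomorphicHom ρ)
    -- a `K`-finite section
    (φ : Sections G (T : GroupLieAlgebra 𝓘(ℂ, E) Gc) ρ)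
    (hφ : FiniteDimensional ℂ (orbitSpan (connectedSubgroup 𝔨) φ)) :
    (∀ (r m k : ℕ)
      (e : Module.Basis (Fin r) ℂ (uPlus (T : GroupLieAlgebra 𝓘(ℂ, E) Gc)))
      (φb : Module.Basis (Fin m) ℂ (orbitSpan (connectedSubgroup 𝔨) φ)) (μ : Fin m → ℝ)
      (_ : ∀ (a : Fin m) (t : ℝ) (g : G),
        (g : Gc) = lieExp (t • (T : GroupLieAlgebra 𝓘(ℂ, E) Gc)) →
        sectionRep G (T : GroupLieAlgebra 𝓘(ℂ, E) Gc) ρ g (φb a)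
          = Complex.exp (Complex.I * μ a * t) • (φb a : Sections G _ ρ))
      (v : Module.Basis (Fin k) ℂ V) (θ : Fin k → ℝ)
      (_ : ∀ (b : Fin k) (t : ℝ) (q : QMinus (T : GroupLieAlgebra 𝓘(ℂ, E) Gc)),
        (q : Gc) = lieExp (t • (T : GroupLieAlgebra 𝓘(ℂ, E) Gc)) →
        (ρ q : V →ₗ[ℂ] V) (v b) = Complex.exp (Complex.I * θ b * t) • v b)
      (a : Fin m) (b : Fin k),
      ∃! P : MvPolynomial (Fin r) ℂ, ∀ (z : Fin r → ℂ)
        (hz : lieExp (∑ j, z j • (e j : GroupLieAlgebra 𝓘(ℂ, E) Gc)) ∈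
          GQ G (T : GroupLieAlgebra 𝓘(ℂ, E) Gc)),
        v.repr ((φb a : Sections G _ ρ).1 ⟨_, hz⟩) b = MvPolynomial.eval z P) ∧
    (∀ f ∈ orbitSpan (connectedSubgroup 𝔨) φ,
      ∃! F : UPlus (T : GroupLieAlgebra 𝓘(ℂ, E) Gc) → V, IsHolomorphic (E := E) F ∧
        ∀ (u : UPlus (T : GroupLieAlgebra 𝓘(ℂ, E) Gc))
          (hu : (u : Gc) ∈ GQ G (T : GroupLieAlgebra 𝓘(ℂ, E) Gc)), F u = f.1 ⟨u, hu⟩) := by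
  have hT' : IsGraded Gc (inclE 𝔤 T) := isGraded_of_isElliptic h_form hT
  have hO : IsOpen (GQ (E := E) G (inclE 𝔤 T)) := isOpen_GQ h𝔤 h_form hT'
  have hTG : ∀ t : ℝ, expE (t • inclE 𝔤 T) ∈ G := (h𝔤 T).1 T.2
  have hTK : ∀ t : ℝ, expE (t • inclE 𝔤 T) ∈ connectedSubgroup 𝔨 := fun t =>
    Subgroup.subset_closure ⟨t • T, 𝔨.smul_mem t hT𝔨, rfl⟩
  obtain ⟨n, ⟨b⟩⟩ := exists_finBasis (orbitSpan (connectedSubgroup 𝔨) φ) hφ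
  have hext : ∀ ψ ∈ orbitSpan (connectedSubgroup 𝔨) φ,
      ∃ p : uE Gc (inclE 𝔤 T) → V, Differentiable ℂ p ∧
        (∀ (z : uE Gc (inclE 𝔤 T)) (hz : expE (z : E) ∈ GQ (E := E) G (inclE 𝔤 T)),
          ψ.1 ⟨expE (z : E), hz⟩ = p z) ∧
        ∀ (r : ℕ) (e : Fin r → uE Gc (inclE 𝔤 T)) (ℓ : V →ₗ[ℂ] ℂ), ∃ P : MvPolynomial (Fin r) ℂ,
          ∀ z : Fin r → ℂ, ℓ (p (∑ j, z j • e j)) = MvPolynomial.eval z P := by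
    intro ψ hψ
    obtain ⟨p, hpd, hpψ, hpoly⟩ := exists_polynomial_eventually_eq (T := inclE 𝔤 T) hO hTG hTK b hψ
    refine ⟨p, hpd, fun z hz => ?_, hpoly⟩
    have h := eq_of_eventually_eq_expE hT' hG_conn hO
      (fun x hx => mdifferentiableAt_extendZero hO ψ.2.1 hx) hpd hpψ z hz
    exact (extendZero_apply _ hz).symm.trans h
  constructor
  · intro r m k e φb μ _ v θ _ a b
    obtain ⟨p, -, hpψ, hpoly⟩ := hext (φb a) (φb a).2
    let e' : Fin r → uE Gc (inclE 𝔤 T) := fun j => ⟨(e j).1, mem_uPlus_iff.1 (e j).2⟩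
    obtain ⟨P, hP⟩ := hpoly r e' (v.coord b)
    have hcoe : ∀ z : Fin r → ℂ, ((∑ j, z j • e' j : uE Gc (inclE 𝔤 T)) : E) =
        ∑ j, z j • ((e j : GroupLieAlgebra 𝓘(ℂ, E) Gc) : E) := fun z => by
      rw [Submodule.coe_sum]; rfl
    have hexp : ∀ z : Fin r → ℂ, expE (Gc := Gc) ((∑ j, z j • e' j : uE Gc (inclE 𝔤 T)) : E) =
        lieExp (∑ j, z j • (e j : GroupLieAlgebra 𝓘(ℂ, E) Gc)) := fun z =>
      congrArg (expE (Gc := Gc)) (hcoe z)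
    have key : ∀ (z : Fin r → ℂ) (hz : lieExp (∑ j, z j • (e j : GroupLieAlgebra 𝓘(ℂ, E) Gc)) ∈
        GQ G (T : GroupLieAlgebra 𝓘(ℂ, E) Gc)),
        v.repr ((φb a : Sections G _ ρ).1 ⟨_, hz⟩) b = MvPolynomial.eval z P := by
      intro z hz
      have hz' : expE ((∑ j, z j • e' j : uE Gc (inclE 𝔤 T)) : E) ∈ GQ (E := E) G (inclE 𝔤 T) := by
        rw [hexp]; exact hz
      have h1 : (φb a : Sections G _ ρ).1 ⟨_, hz⟩ = p (∑ j, z j • e' j) := by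
        rw [← hpψ _ hz']
        exact congrArg (φb a : Sections G _ ρ).1 (Subtype.ext (hexp z).symm)
      rw [h1]
      exact hP z
    refine ⟨P, key, fun P' hP' => mvPolynomial_eq_of_eventually_eq ?_⟩
    have hc : Continuous fun z : Fin r → ℂ =>
        expE (Gc := Gc) ((∑ j, z j • e' j : uE Gc (inclE 𝔤 T)) : E) := by
      have h1 := (mdifferentiable_expE_coe (Gc := Gc) (uE Gc (inclE 𝔤 T))).continuous
      exact h1.comp (by fun_prop)
    have h0 : ∀ᶠ z : Fin r → ℂ in 𝓝 0,
        expE ((∑ j, z j • e' j : uE Gc (inclE 𝔤 T)) : E) ∈ GQ (E := E) G (inclE 𝔤 T) := by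
      refine hc.continuousAt.preimage_mem_nhds (hO.mem_nhds ?_)
      simp only [Pi.zero_apply, zero_smul, Finset.sum_const_zero, ZeroMemClass.coe_zero, expE_zero]
      exact one_mem_GQ
    filter_upwards [h0] with z hz
    rw [hexp] at hz
    rw [← key z hz, hP' z hz]
  · intro f hf
    obtain ⟨p, hpd, hpψ, -⟩ := hext f hf
    obtain ⟨F, hF, hFp⟩ := exists_isHolomorphic_UPlus hT' hpd
    have hFf : ∀ (u : UPlus (T : GroupLieAlgebra 𝓘(ℂ, E) Gc))
        (hu : (u : Gc) ∈ GQ G (T : GroupLieAlgebra 𝓘(ℂ, E) Gc)), F u = f.1 ⟨u, hu⟩ := by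
      rintro ⟨x, hx⟩ hu
      obtain ⟨z, hz, rfl⟩ := mem_UPlus_iff.1 hx
      exact (hFp ⟨z, hz⟩).trans (hpψ ⟨z, hz⟩ hu).symm
    refine ⟨F, ⟨hF, hFf⟩, fun F' hF' => ?_⟩
    exact eq_of_isHolomorphic_UPlus hF'.1 hF (hO.mem_nhds one_mem_GQ) fun u hu =>
      (hF'.2 u hu).trans (hFf u hu).symm
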